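/- **Setting.** An episodic MDP has finite state and action sets $\mathcal S,\mathcal A$ with $S,A\ge 1$ elements, horizon $H\ge1$, a known initial law $\mu$ and unknown transition kernels $p_h(\cdot\mid s,a)$, $h=1,\dots,H$. For a table $\ell=(\ell_h(s,a))$ let $V^\pi(\ell,p)=\mathbb E\big[\sum_{h=1}^H\ell_h(s_h,a_h)\big]$ under $s_1\sim\mu$, policy $\pi$ and kernel $p$, and let $q^\pi(p)\in\mathbb R^{SAH}$ be the occupancy measure $q_h(s,a)=\Pr(s_h=s,a_h=a)$. Let $\mathcal Q$ be the set of all $q^\pi(p')$ (all policies $\pi$, all kernels $p'$), and let $\mathcal N$ be the maximum over $(h,s,a)$ of the number of $s'$ with $p_h(s'\mid s,a)>0$. In episode $k=1,\dots,K$ the learner plays a policy $\pi_k$ determined by the past; given the past, the trajectory has the law induced by $\mu,p,\pi_k$. The reward tables $r_k\in[0,1]^{SAH}$ are i.i.d. with mean $\bar r$, where $r_k$ is independent of the past and of the $k$-th trajectory, and only the entries $r_{k,h}(s_h^k,a_h^k)$ are observed. The cost tables $d_k\in[-1,1]^{SAH}$ are * *stochastic*: the pairs $(r_k,d_k)$ are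 i.i.d. in the same sense, $\bar d=\mathbb E d_k$, and only the entries of $d_k$ along the trajectory are observed; or * *adversarial*: $d_k$ is chosen by an adaptive adversary and fully revealed after episode $k$. Let $\pi^*$ maximize $V^\pi(\bar r,p)$ over all policies with $V^\pi(\bar d,p)\le0$ (stochastic), respectively $V^\pi(d_k,p)\le0$ for all $k\le K$ (adversarial); such a policy is assumed to exist, but neither a Slater condition nor a known safe policy is. Put $\mathrm{Regret}(K)=\sum_{k=1}^K\big(V^{\pi^*}(\bar r,p)-V^{\pi_k}(\bar r,p)\big)$ and $\mathrm{Violation}(K)=\sum_{k=1}^K[V^{\pi_k}(\bar d,p)]^+$ (stochastic), respectively $\sum_{k=1}^K[V^{\pi_k}(d_k,p)]^+$ (adversarial). **Algorithm (OMDPD).** Fix $\delta\in(0,1)$, $L_\delta=\ln\frac{12SAHK}{\delta}$, $L^p_\delta=\ln\frac{6SAHK}{\delta}$. Let $n=n_h^{k-1}(s,a)\vee1$, where $n_h^{k-1}(s,a)$ is the number of visits to $(s,a)$ at step $h$ in the first $k-1$ episodes, and let $\hat p^{k-1},\hat r^{k-1},\hat d^{k-1}$ be the empirical means (sums divided by $n$).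 Put $\tilde r_1=\tilde d_1=0$ and, for $k\ge2$, $\tilde r_k=\hat r^{k-1}+\sqrt{L_\delta/n}$ and $\tilde d_k=\hat d^{k-1}-\sqrt{2L_\delta/n}$ (stochastic), $\tilde d_k=d_k$ (adversarial). Let $B_k$ be the set of kernels $\tilde p$ with $|\tilde p_h(s'|s,a)-\hat p_h^{k-1}(s'|s,a)|\le 2\sqrt{\hat p_h^{k-1}(s'|s,a)(1-\hat p_h^{k-1}(s'|s,a))L^p_\delta/n}+\frac{14}{3}L^p_\delta/n$ for all $h,s,a,s'$, and $\mathcal Q_k=\{q^\pi(\tilde p):\pi\text{ a policy},\ \tilde p\in B_k\}$. Let $U$ be $1$-strongly convex (Euclidean norm) on $\mathcal Q$ and differentiable at its points, $\mathcal D(a,b)=U(a)-U(b)-\langle\nabla U(b),a-b\rangle$, $\mathcal C=\sup_{\mathcal Q\times\mathcal Q}\mathcal D<\infty$. Choose $$\alpha=\frac1{2(1+\sqrt{L_\delta})SAH},\qquad \beta=\frac{SAH}{8\sqrt{\mathcal C}\sqrt{6SAHK}},\qquad \Phi(x)=e^{\beta x}-1,$$ $f_k(q)=\alpha\big(-\tilde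 r_k^\top q+\Phi'(\lambda_k)[\tilde d_k^\top q]^+\big)-\frac12\|q-q_k\|^2$, let $\nabla_0=0$, let $\nabla_k$ be a (sub)gradient of $f_k$ at $q_k$, and $$\eta_k=\sqrt{\mathcal C}\,\min\Big\{\Big(\sqrt{\textstyle\sum_{i=1}^{k-1}\|\nabla_i-\nabla_{i-1}\|^2}+\sqrt{\textstyle\sum_{i=1}^{k-2}\|\nabla_i-\nabla_{i-1}\|^2}\Big)^{-1},1\Big\}.$$ Start from arbitrary $q_1,\hat q_1\in\mathcal Q_1$ and $\lambda_1=0$, and iterate $\hat q_{k+1}=\arg\min_{q\in\mathcal Q_k}\eta_k\langle q,\nabla_k\rangle+\mathcal D(q,\hat q_k)$, $q_{k+1}=\arg\min_{q\in\mathcal Q_{k+1}}\eta_{k+1}\langle q,\nabla_k\rangle+\mathcal D(q,\hat q_{k+1})$, $\lambda_{k+1}=\lambda_k+\alpha[\tilde d_{k+1}^\top q_{k+1}]^+$. In episode $k$ play $\pi_{k,h}(a|s)=q_{k,h}(s,a)/\sum_{a'}q_{k,h}(s,a')$ (arbitrary where the denominator is $0$). **Theorem.** There are absolute constants $c>0$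 and $m\in\mathbb N$ such that, in the stochastic and in the adversarial cost setting alike, with probability at least $1-2\delta$ both $$\mathrm{Regret}(K)\le c\,L_\delta^m\Big(\sqrt{\mathcal N SAH^3K}+S^2AH^3+\sqrt{\mathcal C}\sqrt{SAHK}+SAH\Big),$$ $$\mathrm{Violation}(K)\le c\,L_\delta^m\Big(\sqrt{\mathcal N SAH^3K}+S^2AH^3+\sqrt{\mathcal C}\sqrt{SAHK}\Big)$$ hold, for all $K\ge1$ and all data as above. -/

import Mathlib

open MeasureTheory Finset
open scoped InnerProductSpace

noncomputable section

namespace OMDPD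

/-! ### Episodic finite-horizon Markov decision processes -/

/-- Real tables indexed by step, state and action (rewards, costs, policies). -/
abbrev Table (S A : Type*) (H : ℕ) := Fin H → S → A → ℝ

/-- Transition kernels `p h s a s'`. -/
abbrev Kern (S A : Type*) (H : ℕ) := Fin H → S → A → S → ℝ

/-- Trajectories of one episode: the states `s_1, …, s_{H+1}` and the actions `a_1, …, a_H`. -/
abbrev Traj (S A : Type*) (H : ℕ) := (Fin (H + 1) → S) × (Fin H → A)

/-- The Euclidean space `ℝ^{SAH}` of occupancy vectors. -/
abbrev Occ (S A : Type*) (H : ℕ) := EuclideanSpace ℝ (Fin H × S × A)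

section MDP

variable {S A : Type*} [Fintype S] [Fintype A] [DecidableEq S] [DecidableEq A] {H : ℕ}

/-- `π h s` is a probability distribution on actions. -/
def IsPolicy (π : Table S A H) : Prop := ∀ h s, π h s ∈ stdSimplex ℝ A

/-- `p h s a` is a probability distribution on next states. -/
def IsKernel (p : Kern S A H) : Prop := ∀ h s a, p h s a ∈ stdSimplex ℝ S

/-- Probability of the trajectory `τ` under initial law `μ`, kernel `p` and policy `π`. -/
def trajProb (μ : S → ℝ) (p : Kern S A H) (π : Table S A H) (τ : Traj S A H) : ℝ :=
  μ (τ.1 0) * ∏ h : Fin H,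
    π h (τ.1 h.castSucc) (τ.2 h) * p h (τ.1 h.castSucc) (τ.2 h) (τ.1 h.succ)

/-- The value `V^π(ℓ, p) = 𝔼[∑_h ℓ_h(s_h, a_h)]`. -/
def value (μ : S → ℝ) (p : Kern S A H) (π : Table S A H) (ℓ : Table S A H) : ℝ :=
  ∑ τ : Traj S A H, trajProb μ p π τ * ∑ h : Fin H, ℓ h (τ.1 h.castSucc) (τ.2 h)

/-- The occupancy measure `q_h(s, a) = Pr(s_h = s, a_h = a)`. -/
def occ (μ : S → ℝ) (p : Kern S A H) (π : Table S A H) : Occ S A H :=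
  WithLp.toLp 2 fun x => ∑ τ : Traj S A H,
    if τ.1 x.1.castSucc = x.2.1 ∧ τ.2 x.1 = x.2.2 then trajProb μ p π τ else 0

/-- A table as a vector of `ℝ^{SAH}`. -/
def vec (ℓ : Table S A H) : Occ S A H := WithLp.toLp 2 fun x => ℓ x.1 x.2.1 x.2.2

/-- All valid occupancy measures (any policy, any kernel) with initial law `μ`. -/
def allOcc (μ : S → ℝ) : Set (Occ S A H) :=
  {q | ∃ (π : Table S A H) (p : Kern S A H), IsPolicy π ∧ IsKernel p ∧ q = occ μ p π}

/-- The maximal number of possible next states of a state-action-step triple. -/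
def maxSupport (p : Kern S A H) : ℕ := by
  classical
  exact Finset.univ.sup fun x : Fin H × S × A => #{s' : S | 0 < p x.1 x.2.1 x.2.2 s'}

/-- `π` maximizes the value of `r` among the policies for which every cost table in `D` has
nonpositive value. -/
def IsOptimal (μ : S → ℝ) (p : Kern S A H) (r : Table S A H) (D : Set (Table S A H))
    (π : Table S A H) : Prop :=
  (IsPolicy π ∧ ∀ d ∈ D, value μ p π d ≤ 0) ∧
    ∀ π', IsPolicy π' → (∀ d ∈ D, value μ p π' d ≤ 0) → value μ p π' r ≤ value μ p π r

/-- Cumulative regret over episodes `1, …, K` of the policies `π k` against `πs`. -/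
def regret (μ : S → ℝ) (p : Kern S A H) (r : Table S A H) (πs : Table S A H)
    (π : ℕ → Table S A H) (K : ℕ) : ℝ :=
  ∑ k ∈ Icc 1 K, (value μ p πs r - value μ p (π k) r)

/-- Strong cumulative constraint violation over episodes `1, …, K`, with cost `d k` in
episode `k`. -/
def violation (μ : S → ℝ) (p : Kern S A H) (d : ℕ → Table S A H)
    (π : ℕ → Table S A H) (K : ℕ) : ℝ :=
  ∑ k ∈ Icc 1 K, max (value μ p (π k) (d k)) 0

/-! ### Estimates and confidence sets -/

/-- The factor `L_δ = ln (12 S A H K / δ)`. -/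
def logTerm (S A : Type*) [Fintype S] [Fintype A] (H K : ℕ) (δ : ℝ) : ℝ :=
  Real.log (12 * Fintype.card S * Fintype.card A * H * K / δ)

/-- The factor `L^p_δ = ln (6 S A H K / δ)`. -/
def logTermP (S A : Type*) [Fintype S] [Fintype A] (H K : ℕ) (δ : ℝ) : ℝ :=
  Real.log (6 * Fintype.card S * Fintype.card A * H * K / δ)

/-- The episodes before `k` in which `(s, a)` is visited at step `h`. -/
def visitSet (traj : ℕ → Traj S A H) (k : ℕ) (h : Fin H) (s : S) (a : A) : Finset ℕ :=
  {j ∈ Ico 1 k | (traj j).1 h.castSucc = s ∧ (traj j).2 h = a}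

/-- `n_h^{k-1}(s, a) ∨ 1`. -/
def visits (traj : ℕ → Traj S A H) (k : ℕ) (h : Fin H) (s : S) (a : A) : ℝ :=
  max (#(visitSet traj k h s a) : ℝ) 1

/-- The empirical transition probability from the episodes before `k`. -/
def empTrans (traj : ℕ → Traj S A H) (k : ℕ) : Kern S A H := fun h s a s' =>
  (#{j ∈ visitSet traj k h s a | (traj j).1 h.succ = s'} : ℝ) / visits traj k h s a

/-- The empirical mean of the observed entries of the tables `ℓ j`, `j < k` (only entries at
visited state-action pairs are used). -/
def empMean (traj : ℕ → Traj S A H) (ℓ : ℕ → Table S A H) (k : ℕ) : Table S A H := fun h s a =>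
  (∑ j ∈ visitSet traj k h s a, ℓ j h s a) / visits traj k h s a

/-- The transition bonus. -/
def bonusP (L : ℝ) (traj : ℕ → Traj S A H) (k : ℕ) : Kern S A H := fun h s a s' =>
  2 * √(empTrans traj k h s a s' * (1 - empTrans traj k h s a s') * L / visits traj k h s a)
    + 14 / 3 * L / visits traj k h s a

/-- The confidence set of transition kernels used for episode `k`. -/
def confSet (L : ℝ) (traj : ℕ → Traj S A H) (k : ℕ) : Set (Kern S A H) :=
  {p | IsKernel p ∧ ∀ h s a s',
    |p h s a s' - empTrans traj k h s a s'| ≤ bonusP L traj k h s a s'}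

/-- The candidate set `𝒬_k` of occupancy measures for episode `k`. -/
def candSet (μ : S → ℝ) (L : ℝ) (traj : ℕ → Traj S A H) (k : ℕ) : Set (Occ S A H) :=
  {q | ∃ (π : Table S A H) (p : Kern S A H), IsPolicy π ∧ p ∈ confSet L traj k ∧ q = occ μ p π}

/-- The optimistic reward vector: zero for the first episode, then empirical mean plus bonus. -/
def optReward (L : ℝ) (traj : ℕ → Traj S A H) (r : ℕ → Table S A H) (k : ℕ) : Occ S A H :=
  if k ≤ 1 then 0 else
    vec fun h s a => empMean traj r k h s a + √(L / visits traj k h s a)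

/-- The optimistic cost vector: zero for the first episode, then empirical mean minus bonus.
The costs range over an interval of length `2`, hence the factor `2` in the bonus. -/
def optCost (L : ℝ) (traj : ℕ → Traj S A H) (d : ℕ → Table S A H) (k : ℕ) : Occ S A H :=
  if k ≤ 1 then 0 else
    vec fun h s a => empMean traj d k h s a - √(2 * L / visits traj k h s a)

/-- The cost vector used when full costs are revealed: zero for the first episode, then the
revealed cost. -/
def revealedCost (d : ℕ → Table S A H) (k : ℕ) : Occ S A H :=
  if k ≤ 1 then 0 else vec (d k)

/-! ### The algorithm -/

/-- Bregman divergence `𝒟(a, b) = U(a) - U(b) - ⟨∇U(b), a - b⟩`. -/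
def bregman (U : Occ S A H → ℝ) (a b : Occ S A H) : ℝ :=
  U a - U b - ⟪gradient U b, a - b⟫_ℝ

/-- The values of the Bregman divergence on the set of all valid occupancy measures. -/
def bregmanValues (μ : S → ℝ) (U : Occ S A H → ℝ) : Set ℝ :=
  {x | ∃ a ∈ allOcc μ, ∃ b ∈ allOcc μ, x = bregman U a b}

/-- `U` is a mirror map: `1`-strongly convex on the set of valid occupancy measures,
differentiable at its points, with finite Bregman diameter. -/
def IsMirrorMap (μ : S → ℝ) (U : Occ S A H → ℝ) : Prop :=
  StrongConvexOn (allOcc μ) 1 U ∧ (∀ q ∈ allOcc μ, DifferentiableAt ℝ U q) ∧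
    BddAbove (bregmanValues μ U)

/-- `𝒞 = sup 𝒟(q₁, q₂)` over all valid occupancy measures. -/
def bregmanSup (μ : S → ℝ) (U : Occ S A H → ℝ) : ℝ := sSup (bregmanValues μ U)

/-- `S A H` as a real number. -/
def dimSAH (S A : Type*) [Fintype S] [Fintype A] (H : ℕ) : ℝ :=
  Fintype.card S * Fintype.card A * H

/-- `α = 1 / (2 (1 + √L_δ) S A H)`. -/
def alpha (S A : Type*) [Fintype S] [Fintype A] (H K : ℕ) (δ : ℝ) : ℝ :=
  1 / (2 * (1 + √(logTerm S A H K δ)) * dimSAH S A H)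

/-- `β = S A H / (8 √𝒞 √(6 S A H K))`. -/
def beta (μ : S → ℝ) (U : Occ S A H → ℝ) (K : ℕ) : ℝ :=
  dimSAH S A H / (8 * √(bregmanSup μ U) * √(6 * dimSAH S A H * K))

/-- The surrogate objective
`f(q) = α (-⟨r, q⟩ + Φ'(lam) [⟨d, q⟩]⁺) - ½ ‖q - qk‖²`, where `Φ(x) = exp (β x) - 1`. -/
def surrogate (α β lam : ℝ) (r d qk q : Occ S A H) : ℝ :=
  α * (-⟪r, q⟫_ℝ + deriv (fun x => Real.exp (β * x) - 1) lam * max ⟪d, q⟫_ℝ 0)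
    - 1 / 2 * ‖q - qk‖ ^ 2

/-- `g` is a (generalized) gradient at `x` of a function `f` for which `f + ½ ‖·‖²` is convex:
`g + x` is a subgradient of `f + ½ ‖·‖²` at `x`. Where `f` is differentiable, `g = ∇ f x`. -/
def IsGenGradient (f : Occ S A H → ℝ) (g x : Occ S A H) : Prop :=
  ∀ y, f x + ⟪g, y - x⟫_ℝ - 1 / 2 * ‖y - x‖ ^ 2 ≤ f y

/-- The step size
`η_k = √𝒞 min {1 / (√(∑_{i<k} ‖∇_i - ∇_{i-1}‖²) + √(∑_{i<k-1} ‖∇_i - ∇_{i-1}‖²)), 1}`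
(with `1 / 0 = ∞` inside the minimum). -/
def stepSize (C : ℝ) (g : ℕ → Occ S A H) (k : ℕ) : ℝ :=
  √C / max 1 (√(∑ i ∈ Ico 1 k, ‖g i - g (i - 1)‖ ^ 2)
    + √(∑ i ∈ Ico 1 (k - 1), ‖g i - g (i - 1)‖ ^ 2))

/-- `x` minimizes `q ↦ η ⟨q, g⟩ + 𝒟(q, c)` over `Q`. -/
def IsMirrorStep (U : Occ S A H → ℝ) (Q : Set (Occ S A H)) (η : ℝ) (g c x : Occ S A H) : Prop :=
  x ∈ Q ∧ IsMinOn (fun q => η * ⟪q, g⟫_ℝ + bregman U q c) Q x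

/-- A run of the optimistic mirror descent primal-dual algorithm over `K` episodes, along
trajectories `traj`, with reward vectors `rt k` and cost vectors `dt k`. The variables are the
occupancy measures `q k` and `qh k`, the gradients `g k = ∇ f_k (q k)`, the dual variables
`lam k` and the policies `π k`. Where a state has occupancy zero, the policy is arbitrary. -/
structure IsRun (μ : S → ℝ) (U : Occ S A H → ℝ) (K : ℕ) (δ : ℝ) (traj : ℕ → Traj S A H)
    (rt dt q qh g : ℕ → Occ S A H) (lam : ℕ → ℝ) (π : ℕ → Table S A H) : Prop where
  q_one : q 1 ∈ candSet μ (logTermP S A H K δ) traj 1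
  qh_one : qh 1 ∈ candSet μ (logTermP S A H K δ) traj 1
  lam_one : lam 1 = 0
  g_zero : g 0 = 0
  g_eq : ∀ k ∈ Icc 1 K, IsGenGradient
    (surrogate (alpha S A H K δ) (beta μ U K) (lam k) (rt k) (dt k) (q k)) (g k) (q k)
  qh_succ : ∀ k ∈ Icc 1 K, IsMirrorStep U (candSet μ (logTermP S A H K δ) traj k)
    (stepSize (bregmanSup μ U) g k) (g k) (qh k) (qh (k + 1))
  q_succ : ∀ k ∈ Ico 1 K, IsMirrorStep U (candSet μ (logTermP S A H K δ) traj (k + 1))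
    (stepSize (bregmanSup μ U) g (k + 1)) (g k) (qh (k + 1)) (q (k + 1))
  lam_succ : ∀ k ∈ Ico 1 K,
    lam (k + 1) = lam k + alpha S A H K δ * max ⟪dt (k + 1), q (k + 1)⟫_ℝ 0
  isPolicy : ∀ k ∈ Icc 1 K, IsPolicy (π k)
  policy_eq : ∀ k ∈ Icc 1 K, ∀ h s a, ∑ a', q k (h, s, a') ≠ 0 →
    π k h s a = q k (h, s, a) / ∑ a', q k (h, s, a')

/-! ### The interaction -/

/-- The learner plays `π k` in episode `k = 1, …, K`. Here `𝓕 k` is the information available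
after `k` episodes. Given `𝓕 k`, the trajectory of episode `k + 1` has the law induced by
`μ`, `p` and `π (k + 1)`, and, independently of it, `x (k + 1)` has law `ν`. -/
structure IsInteraction {Ω X : Type*} [MeasurableSpace Ω] [MeasurableSpace X]
    (P : Measure Ω) (𝓕 : Filtration ℕ (inferInstance : MeasurableSpace Ω))
    (μ : S → ℝ) (p : Kern S A H) (ν : Measure X) (K : ℕ)
    (traj : ℕ → Ω → Traj S A H) (x : ℕ → Ω → X) (π : ℕ → Ω → Table S A H) : Prop where
  policy_meas : ∀ k < K, Measurable[𝓕 k] (π (k + 1))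
  traj_meas : ∀ k < K, ∀ τ, MeasurableSet[𝓕 (k + 1)] {ω | traj (k + 1) ω = τ}
  x_meas : ∀ k < K, Measurable[𝓕 (k + 1)] (x (k + 1))
  law : ∀ k < K, ∀ E, MeasurableSet[𝓕 k] E → ∀ τ, ∀ B, MeasurableSet B →
    P (E ∩ {ω | traj (k + 1) ω = τ} ∩ {ω | x (k + 1) ω ∈ B}) =
      (∫⁻ ω in E, ENNReal.ofReal (trajProb μ p (π (k + 1) ω) τ) ∂P) * ν B

/-! ### The bound -/

/-- `√(𝒩 S A H³ K) + S² A H³ + √𝒞 √(S A H K)`. -/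
def rate (μ : S → ℝ) (p : Kern S A H) (U : Occ S A H → ℝ) (K : ℕ) : ℝ :=
  √(maxSupport p * Fintype.card S * Fintype.card A * H ^ 3 * K)
    + (Fintype.card S : ℝ) ^ 2 * Fintype.card A * H ^ 3
    + √(bregmanSup μ U) * √(dimSAH S A H * K)

end MDP

end OMDPD

end

/-!
The learner's decisions are occupancy measures, on which values are linear. On the event that all
estimates are accurate (`IsAccurate`), the occupancy measure `u` of the optimal policy lies in every
candidate set, and the optimistic costs give it a nonpositive estimated cost. So `u` is an admissible
comparator for mirror descent, and optimism takes the place of a Slater condition.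

*Primal-dual part.* Optimistic mirror descent has linearized regret at most
`√𝒞 (1 + 9/2 √(∑ ‖∇_k - ∇_{k-1}‖²))` (`sum_inner_sub_le`), and the gradients have norm at most
`(1 + 3/2 β exp (β λ_K)) / √(SAH)`. The penalties in the surrogates add up to at least
`exp (β λ_K) - 1`, because `λ` increases by the multiples `α [⟨d̃_k, q_k⟩]⁺` of the estimated
violations and `exp` is convex. With the given `β`, the penalty part of the regret is absorbed and
`IsRun.drift_le` remains:
`α ∑ ⟨r̃_k, u - q_k⟩ + 1/4 exp (β λ_K) ≤ 1 + √𝒞 (1 + 9 √(K / SAH))`.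
Dropping the exponential bounds the regret for the estimated rewards. Since `α ⟨r̃_k, u - q_k⟩` is at
least `-1`, the inequality also bounds `exp (β λ_K)` by a polynomial, so `λ_K` is at most of the
order `L_δ / β`, and `λ_K / α` is the estimated violation. When `𝒞 = 0` there is only one occupancy
measure, and when `K < SAH` (regret) or `√𝒞 ≥ KH` (violation) the trivial bound `KH` suffices.

*Estimation part.* The played policy realizes the iterate `q_k` under some kernel of the confidence
set. The value of a bounded table under that kernel and under the true one differ, by a backward
recursion, by sums of `√(𝒩 Var / n)` and `1 / n` over the occupancy measure
(`abs_inner_occ_sub_le`); Cauchy-Schwarz, the law of total variance (`sum_occ_distVar_le`) and a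
bound for the expected visits weighted by `1 / n` (`visitMass`) yield the leading terms of the rate.

*Probability.* Every deviation bound comes from products of factors whose conditional expectation
given the past is at most `1` (`measure_le_prod_le`). For the first `n` visits to a state-action
pair, with exponential moments of Bernstein type for transitions and of Hoeffding type for rewards
and costs, they give the confidence sets and the bonuses; for the expected visits they give a
multiplicative comparison with a harmonic sum. Union bounds over steps, states, actions and visit
numbers make each kind of estimate fail with probability at most `δ / 2`.
-/

noncomputable section

namespace OMDPD

set_option linter.unusedSectionVars false

/-! ### Trajectories, occupancy measures and values -/

section Marginals

variable {S A : Type*} [Fintype S] [Fintype A] {H : ℕ}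

lemma trajProb_nonneg {μ : S → ℝ} (hμ : ∀ s, 0 ≤ μ s) {p : Kern S A H} {π : Table S A H}
    (hp : IsKernel p) (hπ : IsPolicy π) (τ : Traj S A H) : 0 ≤ trajProb μ p π τ :=
  mul_nonneg (hμ _) (prod_nonneg fun i _ => mul_nonneg ((hπ i _).1 _) ((hp i _ _).1 _))

/-- The law of the state `s_h`, by forward recursion from the initial law `μ`. -/
def stateDist (μ : S → ℝ) (p : Kern S A H) (π : Table S A H) : Fin (H + 1) → S → ℝ :=
  Fin.induction (motive := fun _ => S → ℝ) μ
    (fun h ρ s' => ∑ s, ∑ a, ρ s * π h s a * p h s a s')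

@[simp] lemma stateDist_zero (μ : S → ℝ) (p : Kern S A H) (π : Table S A H) :
    stateDist μ p π 0 = μ := rfl

lemma stateDist_succ (μ : S → ℝ) (p : Kern S A H) (π : Table S A H) (h : Fin H) (s' : S) :
    stateDist μ p π h.succ s' =
      ∑ s, ∑ a, stateDist μ p π h.castSucc s * π h s a * p h s a s' := rfl

lemma sum_traj_cons (G : Traj S A (H + 1) → ℝ) :
    ∑ τ, G τ = ∑ s, ∑ a, ∑ τ : Traj S A H, G (Fin.cons s τ.1, Fin.cons a τ.2) := by
  let e : (S × A) × Traj S A H ≃ Traj S A (H + 1) :=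
    (Equiv.prodProdProdComm S A (Fin (H + 1) → S) (Fin H → A)).trans
      (Equiv.prodCongr (Fin.consEquiv fun _ => S) (Fin.consEquiv fun _ => A))
  rw [← e.sum_comp, Fintype.sum_prod_type, Fintype.sum_prod_type]
  rfl

lemma trajProb_cons (μ : S → ℝ) (p : Kern S A (H + 1)) (π : Table S A (H + 1)) (s : S) (a : A)
    (τ : Traj S A H) :
    trajProb μ p π (Fin.cons s τ.1, Fin.cons a τ.2) =
      trajProb (fun s' => μ s * π 0 s a * p 0 s a s') (fun h => p h.succ) (fun h => π h.succ)
        τ := by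
  simp only [trajProb, Fin.prod_univ_succ, Fin.castSucc_zero, Fin.cons_zero, Fin.cons_succ,
    ← Fin.succ_castSucc]
  ring

lemma trajProb_mul_init (μ : S → ℝ) (p : Kern S A H) (π : Table S A H) (f : S → ℝ)
    (τ : Traj S A H) :
    trajProb μ p π τ * f (τ.1 0) = trajProb (fun s => μ s * f s) p π τ := by
  simp only [trajProb]; ring

lemma sum_trajProb_init (μ : S → ℝ) {p : Kern S A H} {π : Table S A H}
    (hp : IsKernel p) (hπ : IsPolicy π) :
    ∑ τ, trajProb μ p π τ = ∑ s, μ s := by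
  induction H generalizing μ with
  | zero =>
    rw [Fintype.sum_prod_type]
    simp only [trajProb, univ_eq_empty, prod_empty, mul_one, Fintype.sum_unique]
    exact (Equiv.funUnique (Fin 1) S).sum_comp (fun s => μ s)
  | succ H ih =>
    rw [sum_traj_cons]
    simp only [trajProb_cons]
    refine sum_congr rfl fun s _ => ?_
    have : ∀ a, ∑ τ : Traj S A H, trajProb (fun s' => μ s * π 0 s a * p 0 s a s')
        (fun h => p h.succ) (fun h => π h.succ) τ = μ s * π 0 s a := fun a => by
      rw [ih _ (fun h => hp h.succ) (fun h => hπ h.succ), ← mul_sum, (hp 0 s a).2, mul_one]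
    simp only [this, ← mul_sum, (hπ 0 s).2, mul_one]

/-- After the first step, the episode is one of horizon `H` started from the law of the second
state. -/
lemma stateDist_shift (μ : S → ℝ) (p : Kern S A (H + 1)) (π : Table S A (H + 1))
    (j : Fin (H + 1)) :
    stateDist μ p π j.succ = stateDist (fun s' => ∑ s, ∑ a, μ s * π 0 s a * p 0 s a s')
      (fun h => p h.succ) (fun h => π h.succ) j := by
  induction j using Fin.induction with
  | zero => rfl
  | succ i ih =>
    ext s'
    rw [stateDist_succ, stateDist_succ, ← ih]
    rfl

/-- The joint law of `(s_h, a_h, s_{h+1})`. -/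
lemma sum_trajProb_step (μ : S → ℝ) {p : Kern S A H} {π : Table S A H}
    (hp : IsKernel p) (hπ : IsPolicy π) (h : Fin H) (F : S → A → S → ℝ) :
    ∑ τ, trajProb μ p π τ * F (τ.1 h.castSucc) (τ.2 h) (τ.1 h.succ) =
      ∑ s, ∑ a, ∑ s', stateDist μ p π h.castSucc s * π h s a * p h s a s' * F s a s' := by
  induction H generalizing μ with
  | zero => exact h.elim0
  | succ H ih =>
    rw [sum_traj_cons]
    simp only [trajProb_cons]
    induction h using Fin.cases with
    | zero =>
      refine sum_congr rfl fun s _ => sum_congr rfl fun a _ => ?_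
      simp only [Fin.castSucc_zero, Fin.cons_zero, Fin.cons_succ]
      simp only [trajProb_mul_init _ _ _ (F s a)]
      rw [sum_trajProb_init _ (fun h => hp h.succ) (fun h => hπ h.succ)]
      rfl
    | succ h =>
      simp only [← Fin.succ_castSucc, Fin.cons_succ]
      rw [stateDist_shift, ← ih _ (fun h => hp h.succ) (fun h => hπ h.succ)]
      rw [sum_congr rfl fun s _ => sum_comm, sum_comm]
      refine sum_congr rfl fun τ _ => ?_
      simp only [trajProb, ← sum_mul]

lemma stateDist_nonneg {μ : S → ℝ} (hμ : ∀ s, 0 ≤ μ s) {p : Kern S A H} {π : Table S A H}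
    (hp : IsKernel p) (hπ : IsPolicy π) (j : Fin (H + 1)) (s : S) : 0 ≤ stateDist μ p π j s := by
  induction j using Fin.induction generalizing s with
  | zero => exact hμ s
  | succ h ih =>
    rw [stateDist_succ]
    exact sum_nonneg fun s _ => sum_nonneg fun a _ =>
      mul_nonneg (mul_nonneg (ih s) ((hπ h s).1 a)) ((hp h s a).1 _)

lemma sum_stateDist {μ : S → ℝ} (hμ : μ ∈ stdSimplex ℝ S) {p : Kern S A H} {π : Table S A H}
    (hp : IsKernel p) (hπ : IsPolicy π) (j : Fin (H + 1)) : ∑ s, stateDist μ p π j s = 1 := by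
  induction j using Fin.induction with
  | zero => exact hμ.2
  | succ h ih =>
    simp only [stateDist_succ]
    rw [sum_comm, ← ih]
    refine sum_congr rfl fun s _ => ?_
    rw [sum_comm]
    simp only [← mul_sum, (hp h s _).2, mul_one, (hπ h s).2]

/-- Integrating a function of the next state against the occupancy measure. -/
lemma sum_stateDist_succ_mul (μ : S → ℝ) (p : Kern S A H) (π : Table S A H) (h : Fin H)
    (f : S → ℝ) :
    ∑ s', stateDist μ p π h.succ s' * f s' =
      ∑ s, stateDist μ p π h.castSucc s * ∑ a, π h s a * ∑ s', p h s a s' * f s' := by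
  simp only [stateDist_succ, sum_mul, mul_sum]
  rw [sum_comm]
  refine sum_congr rfl fun s _ => ?_
  rw [sum_comm]
  refine sum_congr rfl fun a _ => sum_congr rfl fun s' _ => by ring

variable [DecidableEq S] [DecidableEq A]

lemma occ_apply {μ : S → ℝ} {p : Kern S A H} {π : Table S A H}
    (hp : IsKernel p) (hπ : IsPolicy π) (h : Fin H) (s : S) (a : A) :
    occ μ p π (h, s, a) = stateDist μ p π h.castSucc s * π h s a := by
  have := sum_trajProb_step μ hp hπ h (fun s₁ a₁ _ => if s₁ = s ∧ a₁ = a then 1 else 0)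
  simp only [mul_ite, mul_one, mul_zero] at this
  simp only [occ]
  rw [this]
  rw [sum_eq_single s, sum_eq_single a]
  · simp [← mul_sum, (hp h s a).2]
  · intro b _ hb; simp [hb]
  · simp
  · intro b _ hb; simp [hb]
  · simp

lemma occ_nonneg {μ : S → ℝ} (hμ : ∀ s, 0 ≤ μ s) {p : Kern S A H} {π : Table S A H}
    (hp : IsKernel p) (hπ : IsPolicy π) (x : Fin H × S × A) : 0 ≤ occ μ p π x := by
  rw [show x = (x.1, x.2.1, x.2.2) from rfl, occ_apply hp hπ]
  exact mul_nonneg (stateDist_nonneg hμ hp hπ _ _) ((hπ _ _).1 _)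

lemma sum_action_occ {μ : S → ℝ} {p : Kern S A H} {π : Table S A H}
    (hp : IsKernel p) (hπ : IsPolicy π) (h : Fin H) (s : S) :
    ∑ a, occ μ p π (h, s, a) = stateDist μ p π h.castSucc s := by
  simp only [occ_apply hp hπ, ← mul_sum, (hπ h s).2, mul_one]

lemma sum_occ {μ : S → ℝ} (hμ : μ ∈ stdSimplex ℝ S) {p : Kern S A H} {π : Table S A H}
    (hp : IsKernel p) (hπ : IsPolicy π) : ∑ x, occ μ p π x = H := by
  rw [Fintype.sum_prod_type]
  simp only [Fintype.sum_prod_type, sum_action_occ hp hπ, sum_stateDist hμ hp hπ]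
  simp

lemma inner_eq_sum (v w : Occ S A H) : ⟪v, w⟫_ℝ = ∑ x, v x * w x := by
  rw [PiLp.inner_apply]
  exact sum_congr rfl fun x _ => by simp [mul_comm]

lemma value_eq_inner (μ : S → ℝ) (p : Kern S A H) (π ℓ : Table S A H) :
    value μ p π ℓ = ⟪vec ℓ, occ μ p π⟫_ℝ := by
  rw [inner_eq_sum]
  simp only [value, occ, vec, mul_sum]
  rw [sum_comm, Fintype.sum_prod_type]
  refine sum_congr rfl fun h _ => ?_
  rw [sum_comm]
  refine sum_congr rfl fun τ _ => ?_
  rw [sum_eq_single (τ.1 h.castSucc, τ.2 h)]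
  · simp [mul_comm]
  · rintro ⟨s, a⟩ _ hne
    rw [if_neg, mul_zero]
    rintro ⟨h1, h2⟩
    exact hne (Prod.ext h1.symm h2.symm)
  · simp

/-- The forward recursion of the state laws in terms of occupancies. -/
lemma stateDist_succ_occ {μ : S → ℝ} {p : Kern S A H} {π : Table S A H}
    (hp : IsKernel p) (hπ : IsPolicy π) (h : Fin H) (s' : S) :
    stateDist μ p π h.succ s' = ∑ s, ∑ a, occ μ p π (h, s, a) * p h s a s' := by
  simp only [stateDist_succ, occ_apply hp hπ]

/-- An occupancy measure is not changed by replacing its policy by the normalized occupancies. -/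
lemma occ_eq_of_policy_eq {μ : S → ℝ} {p : Kern S A H} {π π' : Table S A H}
    (hp : IsKernel p) (hπ : IsPolicy π) (hπ' : IsPolicy π')
    (h : ∀ h s a, ∑ a', occ μ p π' (h, s, a') ≠ 0 →
      π h s a = occ μ p π' (h, s, a) / ∑ a', occ μ p π' (h, s, a')) :
    occ μ p π = occ μ p π' := by
  have key : ∀ h : Fin H, stateDist μ p π h.castSucc = stateDist μ p π' h.castSucc →
      ∀ s a, occ μ p π (h, s, a) = occ μ p π' (h, s, a) := by
    intro i hi s a
    by_cases h0 : ∑ a', occ μ p π' (i, s, a') = 0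
    · rw [occ_apply hp hπ, occ_apply hp hπ', hi, ← sum_action_occ hp hπ', h0]; simp
    · rw [occ_apply hp hπ, h i s a h0, hi, ← sum_action_occ hp hπ']
      field_simp
  have hst : ∀ j, stateDist μ p π j = stateDist μ p π' j := by
    intro j
    induction j using Fin.induction with
    | zero => rfl
    | succ i ih =>
      ext s'
      rw [stateDist_succ_occ hp hπ, stateDist_succ_occ hp hπ']
      simp only [key i ih]
  ext ⟨i, s, a⟩
  exact key i (hst _) s a

/-- Averages of points of a convex set with arbitrary nonnegative weights; when both weights vanish,
the first point is taken. -/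
lemma weighted_mem {ι : Type*} {X : Set (ι → ℝ)} (hX : Convex ℝ X) {x y : ι → ℝ} (hx : x ∈ X)
    (hy : y ∈ X) {u v : ℝ} (hu : 0 ≤ u) (hv : 0 ≤ v) :
    (fun i => if u + v = 0 then x i else (u * x i + v * y i) / (u + v)) ∈ X := by
  by_cases h : u + v = 0
  · simpa [h] using hx
  · have hpos : 0 < u + v := lt_of_le_of_ne (by positivity) (Ne.symm h)
    have := hX hx hy (a := u / (u + v)) (b := v / (u + v)) (by positivity) (by positivity)
      (by field_simp)
    convert this using 1
    ext i
    simp only [h, if_false, Pi.add_apply, Pi.smul_apply, smul_eq_mul]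
    field_simp

/-- The candidate sets are convex: a mixture of occupancy measures is the occupancy measure of the
policy and of the kernel averaged with the occupancies as weights. -/
lemma convex_candSet {μ : S → ℝ} (hμ : ∀ s, 0 ≤ μ s) (L : ℝ) (traj : ℕ → Traj S A H) (k : ℕ) :
    Convex ℝ (candSet μ L traj k) := by
  rintro _ ⟨π₁, p₁, hπ₁, hp₁, rfl⟩ _ ⟨π₂, p₂, hπ₂, hp₂, rfl⟩ u v hu hv huv
  set q₁ := occ μ p₁ π₁ with hq₁
  set q₂ := occ μ p₂ π₂ with hq₂
  have hn₁ : ∀ x, 0 ≤ q₁ x := occ_nonneg hμ hp₁.1 hπ₁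
  have hn₂ : ∀ x, 0 ≤ q₂ x := occ_nonneg hμ hp₂.1 hπ₂
  have hd₁ := fun j s => stateDist_nonneg (π := π₁) hμ hp₁.1 hπ₁ j s
  have hd₂ := fun j s => stateDist_nonneg (π := π₂) hμ hp₂.1 hπ₂ j s
  let σ : Fin (H + 1) → S → ℝ := fun j s => u * stateDist μ p₁ π₁ j s + v * stateDist μ p₂ π₂ j s
  let π : Table S A H := fun h s a =>
    if u * stateDist μ p₁ π₁ h.castSucc s + v * stateDist μ p₂ π₂ h.castSucc s = 0 then π₁ h s a
    else (u * stateDist μ p₁ π₁ h.castSucc s * π₁ h s a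
      + v * stateDist μ p₂ π₂ h.castSucc s * π₂ h s a) /
      (u * stateDist μ p₁ π₁ h.castSucc s + v * stateDist μ p₂ π₂ h.castSucc s)
  let p : Kern S A H := fun h s a s' =>
    if u * q₁ (h, s, a) + v * q₂ (h, s, a) = 0 then p₁ h s a s'
    else (u * q₁ (h, s, a) * p₁ h s a s' + v * q₂ (h, s, a) * p₂ h s a s') /
      (u * q₁ (h, s, a) + v * q₂ (h, s, a))
  have hπ : IsPolicy π := fun h s =>
    weighted_mem (convex_stdSimplex ℝ A) (hπ₁ h s) (hπ₂ h s)
      (mul_nonneg hu (hd₁ _ _)) (mul_nonneg hv (hd₂ _ _))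
  have hp : p ∈ confSet L traj k := by
    let X : Fin H → S → A → Set (S → ℝ) := fun h s a =>
      {x | ∀ s', |x s' - empTrans traj k h s a s'| ≤ bonusP L traj k h s a s'}
    have hmem : ∀ h s a, p h s a ∈ stdSimplex ℝ S ∩ X h s a := by
      intro h s a
      refine weighted_mem (X := stdSimplex ℝ S ∩ X h s a)
        (Convex.inter (convex_stdSimplex ℝ S) ?_)
        ⟨hp₁.1 h s a, hp₁.2 h s a⟩ ⟨hp₂.1 h s a, hp₂.2 h s a⟩
        (mul_nonneg hu (hn₁ _)) (mul_nonneg hv (hn₂ _))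
      intro x hx y hy c d hc hd hcd s'
      have h1 := abs_le.1 (hx s')
      have h2 := abs_le.1 (hy s')
      simp only [Pi.add_apply, Pi.smul_apply, smul_eq_mul]
      obtain rfl : d = 1 - c := by linarith
      rw [abs_le]
      constructor <;> nlinarith
    exact ⟨fun h s a => (hmem h s a).1, fun h s a => (hmem h s a).2⟩
  -- the occupancies at step `h` are mixtures as soon as the state law is, and they determine the
  -- next state law
  have key : ∀ h : Fin H, stateDist μ p π h.castSucc = σ h.castSucc →
      ∀ s a, occ μ p π (h, s, a) = u * q₁ (h, s, a) + v * q₂ (h, s, a) := by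
    intro h hh s a
    rw [occ_apply hp.1 hπ, hh, hq₁, hq₂, occ_apply hp₁.1 hπ₁, occ_apply hp₂.1 hπ₂]
    simp only [π, σ]
    split_ifs with h0
    · have h1 := mul_nonneg hu (hd₁ h.castSucc s)
      have h2 := mul_nonneg hv (hd₂ h.castSucc s)
      have e1 : u * stateDist μ p₁ π₁ h.castSucc s = 0 := by linarith
      have e2 : v * stateDist μ p₂ π₂ h.castSucc s = 0 := by linarith
      rw [← mul_assoc, ← mul_assoc, e1, e2]; simp
    · field_simp
  have hst : ∀ j, stateDist μ p π j = σ j := by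
    intro j
    induction j using Fin.induction with
    | zero =>
      ext s
      simp only [σ, stateDist_zero]
      rw [← add_mul, huv, one_mul]
    | succ h ih =>
      ext s'
      simp only [σ]
      rw [stateDist_succ_occ hp.1 hπ, stateDist_succ_occ hp₁.1 hπ₁, stateDist_succ_occ hp₂.1 hπ₂,
        mul_sum, mul_sum, ← sum_add_distrib]
      refine sum_congr rfl fun s _ => ?_
      rw [mul_sum, mul_sum, ← sum_add_distrib]
      refine sum_congr rfl fun a _ => ?_
      rw [key h ih, ← hq₁, ← hq₂]
      simp only [p]
      split_ifs with h0
      · have h1 := mul_nonneg hu (hn₁ (h, s, a))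
        have h2 := mul_nonneg hv (hn₂ (h, s, a))
        have e1 : u * q₁ (h, s, a) = 0 := by linarith
        have e2 : v * q₂ (h, s, a) = 0 := by linarith
        rw [← mul_assoc, ← mul_assoc, e1, e2]; simp
      · field_simp
  refine ⟨π, p, hπ, hp, ?_⟩
  ext ⟨h, s, a⟩
  rw [key h (hst _)]
  rfl

end Marginals

/-! ### Value differences and the total variance -/

section ValueDifference

variable {S A : Type*} [Fintype S] [Fintype A] {H : ℕ}

lemma sum_fin_telescope {H : ℕ} (f : Fin (H + 1) → ℝ) :
    ∑ h : Fin H, (f h.castSucc - f h.succ) = f 0 - f (Fin.last H) := by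
  have h1 := Fin.sum_univ_succ f
  have h2 := Fin.sum_univ_castSucc f
  rw [sum_sub_distrib]; linarith

/-- A backward recursion with growth factor `1 + 1 / H` loses a factor of at most `e ≤ 3`. -/
lemma backward_recursion_le {H : ℕ} (x : Fin (H + 1) → ℝ) (B : Fin H → ℝ) (hB : ∀ h, 0 ≤ B h)
    (hlast : x (Fin.last H) = 0)
    (hstep : ∀ h, x h.castSucc ≤ B h + (1 + 1 / (H : ℝ)) * x h.succ) :
    x 0 ≤ 3 * ∑ h, B h := by
  set c : ℝ := 1 + 1 / (H : ℝ) with hc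
  have hc1 : 1 ≤ c := by rw [hc]; simp
  have hcH : c ^ H ≤ 3 := by
    rcases Nat.eq_zero_or_pos H with rfl | hpos
    · norm_num
    calc c ^ H ≤ (Real.exp (1 / (H : ℝ))) ^ H := by
          gcongr
          rw [hc, add_comm]
          exact Real.add_one_le_exp _
      _ = Real.exp 1 := by
          rw [← Real.exp_nat_mul]; congr 1; field_simp
      _ ≤ 3 := Real.exp_one_lt_three.le
  have hsum := sum_fin_telescope fun j : Fin (H + 1) => c ^ (j : ℕ) * x j
  simp only [Fin.val_zero, pow_zero, one_mul, hlast, mul_zero, sub_zero] at hsum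
  rw [← hsum, mul_sum]
  refine sum_le_sum fun h _ => ?_
  have h1 : c ^ (h : ℕ) * x h.castSucc ≤ c ^ (h : ℕ) * (B h + c * x h.succ) := by
    gcongr; exact hstep h
  have h2 : c ^ (h : ℕ) * B h ≤ 3 * B h := by
    refine mul_le_mul_of_nonneg_right ?_ (hB h)
    exact (pow_le_pow_right₀ hc1 h.2.le).trans hcH
  simp only [Fin.val_castSucc, Fin.val_succ, pow_succ]
  linarith [mul_assoc (c ^ (h : ℕ)) c (x h.succ)]

/-- The value function `V_h(s)` of the policy `π` for the table `ℓ`, by backward recursion. -/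
def valueFn (p : Kern S A H) (π ℓ : Table S A H) : Fin (H + 1) → S → ℝ :=
  Fin.reverseInduction (motive := fun _ => S → ℝ) (fun _ => 0)
    (fun h V s => ∑ a, π h s a * (ℓ h s a + ∑ s', p h s a s' * V s'))

lemma valueFn_last (p : Kern S A H) (π ℓ : Table S A H) (s : S) :
    valueFn p π ℓ (Fin.last H) s = 0 := by
  simp [valueFn]

lemma valueFn_castSucc (p : Kern S A H) (π ℓ : Table S A H) (h : Fin H) (s : S) :
    valueFn p π ℓ h.castSucc s =
      ∑ a, π h s a * (ℓ h s a + ∑ s', p h s a s' * valueFn p π ℓ h.succ s') := by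
  simp [valueFn]

lemma abs_sum_simplex_le {ι : Type*} [Fintype ι] {w : ι → ℝ} (hw : w ∈ stdSimplex ℝ ι)
    {f : ι → ℝ} {M : ℝ} (hf : ∀ i, |f i| ≤ M) : |∑ i, w i * f i| ≤ M := by
  calc |∑ i, w i * f i| ≤ ∑ i, |w i * f i| := abs_sum_le_sum_abs _ _
    _ ≤ ∑ i, w i * M := sum_le_sum fun i _ => by
        rw [abs_mul, abs_of_nonneg (hw.1 i)]
        exact mul_le_mul_of_nonneg_left (hf i) (hw.1 i)
    _ = M := by rw [← sum_mul, hw.2, one_mul]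

lemma abs_valueFn_le {p : Kern S A H} {π ℓ : Table S A H} (hp : IsKernel p) (hπ : IsPolicy π)
    (hℓ : ∀ h s a, |ℓ h s a| ≤ 1) (j : Fin (H + 1)) (s : S) :
    |valueFn p π ℓ j s| ≤ (H : ℝ) - (j : ℕ) := by
  induction j using Fin.reverseInduction generalizing s with
  | last => simp [valueFn_last]
  | cast h ih =>
    rw [valueFn_castSucc]
    refine abs_sum_simplex_le (hπ h s) fun a => ?_
    have h1 := abs_sum_simplex_le (hp h s a) ih
    have h2 := abs_add_le (ℓ h s a) (∑ s', p h s a s' * valueFn p π ℓ h.succ s')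
    have h3 := hℓ h s a
    simp only [Fin.val_succ, Fin.val_castSucc, Nat.cast_add, Nat.cast_one] at h1 ⊢
    linarith

/-- The variance of `f` under the distribution `w`. -/
def distVar (w f : S → ℝ) : ℝ := ∑ s, w s * (f s - ∑ s', w s' * f s') ^ 2

lemma distVar_nonneg {w : S → ℝ} (hw : w ∈ stdSimplex ℝ S) (f : S → ℝ) : 0 ≤ distVar w f :=
  sum_nonneg fun s _ => mul_nonneg (hw.1 s) (sq_nonneg _)

lemma distVar_eq {w : S → ℝ} (hw : w ∈ stdSimplex ℝ S) (f : S → ℝ) :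
    distVar w f = ∑ s, w s * f s ^ 2 - (∑ s, w s * f s) ^ 2 := by
  rw [distVar]
  set m := ∑ s', w s' * f s'
  have : ∀ s, w s * (f s - m) ^ 2 = w s * f s ^ 2 - 2 * m * (w s * f s) + m ^ 2 * w s :=
    fun s => by ring
  simp only [this, sum_add_distrib, sum_sub_distrib, ← mul_sum, hw.2]
  ring

variable [DecidableEq S] [DecidableEq A]

/-- The occupancy sum in terms of the state laws. -/
lemma sum_occ_mul {μ : S → ℝ} {p : Kern S A H} {π : Table S A H}
    (hp : IsKernel p) (hπ : IsPolicy π) (f : Fin H → S → A → ℝ) :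
    ∑ x : Fin H × S × A, occ μ p π x * f x.1 x.2.1 x.2.2 =
      ∑ h : Fin H, ∑ s, stateDist μ p π h.castSucc s * ∑ a, π h s a * f h s a := by
  rw [Fintype.sum_prod_type]
  refine sum_congr rfl fun h _ => ?_
  rw [Fintype.sum_prod_type]
  refine sum_congr rfl fun s _ => ?_
  rw [mul_sum]
  refine sum_congr rfl fun a _ => ?_
  rw [occ_apply hp hπ, mul_assoc]

/-- The value of a policy is the mean of its value function under the initial law. -/
lemma inner_vec_occ_eq {μ : S → ℝ} {p : Kern S A H} {π : Table S A H}
    (hp : IsKernel p) (hπ : IsPolicy π) (ℓ : Table S A H) :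
    ⟪vec ℓ, occ μ p π⟫_ℝ = ∑ s, μ s * valueFn p π ℓ 0 s := by
  have h1 : ⟪vec ℓ, occ μ p π⟫_ℝ = ∑ x : Fin H × S × A, occ μ p π x * ℓ x.1 x.2.1 x.2.2 := by
    rw [inner_eq_sum]; exact sum_congr rfl fun x _ => mul_comm _ _
  have h2 := sum_fin_telescope fun j => ∑ s, stateDist μ p π j s * valueFn p π ℓ j s
  simp only [valueFn_last, mul_zero, sum_const_zero, sub_zero, stateDist_zero] at h2
  rw [h1, sum_occ_mul hp hπ, ← h2]
  refine sum_congr rfl fun h _ => ?_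
  rw [sum_stateDist_succ_mul, ← sum_sub_distrib]
  refine sum_congr rfl fun s _ => ?_
  rw [valueFn_castSucc, ← mul_sub, ← sum_sub_distrib]
  congr 1
  exact sum_congr rfl fun a _ => by ring

/-- **Law of total variance**: along an episode, the variances of the next-step values add up to
order `H ^ 2` rather than `H ^ 3`. This saves a factor `√H` in the estimation error. -/
lemma sum_occ_distVar_le {μ : S → ℝ} (hμ : μ ∈ stdSimplex ℝ S) {p : Kern S A H}
    {π ℓ : Table S A H} (hp : IsKernel p) (hπ : IsPolicy π) (hℓ : ∀ h s a, |ℓ h s a| ≤ 1) :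
    ∑ x : Fin H × S × A,
      occ μ p π x * distVar (p x.1 x.2.1 x.2.2) (valueFn p π ℓ x.1.succ) ≤ 2 * (H : ℝ) ^ 2 := by
  rw [sum_occ_mul hp hπ (fun h s a => distVar (p h s a) (valueFn p π ℓ h.succ))]
  have hρ := fun j s => stateDist_nonneg (π := π) hμ.1 hp hπ j s
  -- up to `2 H`, the variance at step `h` is the increment of the mean squared value
  have hstep : ∀ h : Fin H,
      ∑ s, stateDist μ p π h.castSucc s *
        ∑ a, π h s a * distVar (p h s a) (valueFn p π ℓ h.succ) ≤
      (∑ s, stateDist μ p π h.succ s * valueFn p π ℓ h.succ s ^ 2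
        - ∑ s, stateDist μ p π h.castSucc s * valueFn p π ℓ h.castSucc s ^ 2) + 2 * H := by
    intro h
    have e : (2 * H : ℝ) = ∑ s, stateDist μ p π h.castSucc s * (2 * H) := by
      rw [← sum_mul, sum_stateDist hμ hp hπ, one_mul]
    rw [e, sum_stateDist_succ_mul, ← sum_sub_distrib, ← sum_add_distrib]
    refine sum_le_sum fun s _ => ?_
    rw [← mul_sub, ← mul_add]
    refine mul_le_mul_of_nonneg_left ?_ (hρ _ _)
    set m : A → ℝ := fun a => ∑ s', p h s a s' * valueFn p π ℓ h.succ s' with hm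
    have hmb : ∀ a, |m a| ≤ (H : ℝ) - 1 := fun a => by
      have := abs_sum_simplex_le (hp h s a) (abs_valueFn_le hp hπ hℓ h.succ)
      refine this.trans ?_
      simp only [Fin.val_succ, Nat.cast_add, Nat.cast_one]
      have : (0 : ℝ) ≤ ((h : ℕ) : ℝ) := by positivity
      linarith
    have hjensen : valueFn p π ℓ h.castSucc s ^ 2 ≤ ∑ a, π h s a * (ℓ h s a + m a) ^ 2 := by
      have := distVar_nonneg (hπ h s) (fun a => ℓ h s a + m a)
      rw [distVar_eq (hπ h s)] at this
      rw [valueFn_castSucc]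
      linarith
    have hsq : ∑ a, π h s a * (ℓ h s a + m a) ^ 2 ≤ ∑ a, π h s a * (m a ^ 2) + 2 * H := by
      have e : (2 * H : ℝ) = ∑ a, π h s a * (2 * H) := by rw [← sum_mul, (hπ h s).2, one_mul]
      rw [e, ← sum_add_distrib]
      refine sum_le_sum fun a _ => ?_
      rw [← mul_add]
      refine mul_le_mul_of_nonneg_left ?_ ((hπ h s).1 a)
      have h1 := abs_le.1 (hmb a)
      have h2 := abs_le.1 (hℓ h s a)
      nlinarith
    have hdv : ∑ a, π h s a * distVar (p h s a) (valueFn p π ℓ h.succ) =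
        ∑ a, π h s a * ∑ s', p h s a s' * valueFn p π ℓ h.succ s' ^ 2
          - ∑ a, π h s a * (m a ^ 2) := by
      rw [← sum_sub_distrib]
      refine sum_congr rfl fun a _ => ?_
      rw [distVar_eq (hp h s a), ← mul_sub]
    linarith
  have htel := sum_fin_telescope fun j => ∑ s, stateDist μ p π j s * valueFn p π ℓ j s ^ 2
  have h0 : 0 ≤ ∑ s, stateDist μ p π 0 s * valueFn p π ℓ 0 s ^ 2 :=
    sum_nonneg fun s _ => mul_nonneg (hρ _ _) (sq_nonneg _)
  simp only [valueFn_last] at htel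
  calc _ ≤ _ := sum_le_sum fun h _ => hstep h
    _ ≤ 2 * (H : ℝ) ^ 2 := by
      rw [sum_add_distrib]
      have e : ∑ _h : Fin H, (2 * H : ℝ) = 2 * (H : ℝ) ^ 2 := by simp; ring
      have e2 : ∑ h : Fin H, (∑ s, stateDist μ p π h.succ s * valueFn p π ℓ h.succ s ^ 2
        - ∑ s, stateDist μ p π h.castSucc s * valueFn p π ℓ h.castSucc s ^ 2) =
        -∑ h : Fin H, (∑ s, stateDist μ p π h.castSucc s * valueFn p π ℓ h.castSucc s ^ 2
        - ∑ s, stateDist μ p π h.succ s * valueFn p π ℓ h.succ s ^ 2) := by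
        rw [← sum_neg_distrib]; exact sum_congr rfl fun _ _ => by ring
      rw [e, e2, htel]
      simp only [ne_eq, OfNat.ofNat_ne_zero, not_false_eq_true, zero_pow, mul_zero,
        sum_const_zero]
      linarith

/-- One step of the comparison of two kernels: the value of the next state under the second kernel
is compared with the value under the first one, with an error governed by the variance of the
latter. -/
lemma abs_transition_sub_le {w wt V Vt : S → ℝ} (hw : w ∈ stdSimplex ℝ S)
    (hwt : wt ∈ stdSimplex ℝ S) {y : ℝ} (hy : 0 ≤ y) {N : ℝ}
    (hN : (#{s : S | 0 < w s} : ℝ) ≤ N) {H : ℝ} (hH : 1 ≤ H)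
    (hV : ∀ s, |V s| ≤ H) (hVt : ∀ s, |Vt s| ≤ H)
    (hclose : ∀ s, |wt s - w s| ≤ 6 * √(w s * y) + 24 * y) :
    |∑ s, wt s * Vt s - ∑ s, w s * V s| ≤
      6 * √(N * y * distVar w V) + 114 * Fintype.card S * H ^ 2 * y
        + (1 + 1 / H) * ∑ s, w s * |Vt s - V s| := by
  have hH0 : 0 < H := by linarith
  set m := ∑ s, w s * V s with hm
  have hmb : |m| ≤ H := abs_sum_simplex_le hw hV
  -- both weights have the same mass, so that `V` may be centred at its mean
  have hsplit : ∑ s, wt s * Vt s - m =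
      ∑ s, (wt s - w s) * (V s - m) + ∑ s, (wt s - w s) * (Vt s - V s)
        + ∑ s, w s * (Vt s - V s) := by
    have : ∀ s, (wt s - w s) * (V s - m) + (wt s - w s) * (Vt s - V s) + w s * (Vt s - V s) =
        wt s * Vt s - w s * V s - m * wt s + m * w s := fun s => by ring
    rw [← sum_add_distrib, ← sum_add_distrib]
    simp only [this, sum_add_distrib, sum_sub_distrib, ← mul_sum, hw.2, hwt.2]
    rw [← hm]; ring
  have h1 : |∑ s, (wt s - w s) * (V s - m)| ≤
      6 * √(N * y * distVar w V) + 48 * Fintype.card S * H * y := by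
    have hcs : ∑ s, √(w s) * |V s - m| ≤ √(N * distVar w V) := by
      have e : ∑ s, √(w s) * |V s - m| = ∑ s with 0 < w s, √(w s) * |V s - m| := by
        rw [sum_filter]
        refine sum_congr rfl fun s _ => ?_
        split_ifs with h
        · rfl
        · rw [Real.sqrt_eq_zero_of_nonpos (not_lt.1 h), zero_mul]
      rw [e]
      refine Real.le_sqrt_of_sq_le ?_
      refine sq_sum_le_card_mul_sum_sq.trans ?_
      refine mul_le_mul hN ?_ (sum_nonneg fun s _ => sq_nonneg _)
        (le_trans (by positivity) hN)
      have e2 : ∀ s, (√(w s) * |V s - m|) ^ 2 = w s * (V s - m) ^ 2 := fun s => by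
        rw [mul_pow, Real.sq_sqrt (hw.1 s), sq_abs]
      simp only [e2]
      exact sum_le_sum_of_subset_of_nonneg (filter_subset _ _)
        fun s _ _ => mul_nonneg (hw.1 s) (sq_nonneg _)
    calc |∑ s, (wt s - w s) * (V s - m)| ≤ ∑ s, |(wt s - w s) * (V s - m)| :=
          abs_sum_le_sum_abs _ _
      _ ≤ ∑ s, (6 * √y * (√(w s) * |V s - m|) + 48 * H * y) := by
          refine sum_le_sum fun s _ => ?_
          rw [abs_mul]
          have hb : |V s - m| ≤ 2 * H := by
            have := abs_sub (V s) m
            linarith [hV s]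
          have hc := mul_le_mul_of_nonneg_right (hclose s) (abs_nonneg (V s - m))
          rw [Real.sqrt_mul (hw.1 s)] at hc
          nlinarith [mul_le_mul_of_nonneg_left hb hy]
      _ ≤ 6 * √y * √(N * distVar w V) + 48 * Fintype.card S * H * y := by
          rw [sum_add_distrib, ← mul_sum]
          have : ∑ _s : S, 48 * H * y = 48 * Fintype.card S * H * y := by simp; ring
          rw [this]
          gcongr
      _ = 6 * √(N * y * distVar w V) + 48 * Fintype.card S * H * y := by
          rw [mul_assoc, ← Real.sqrt_mul hy,
            show y * (N * distVar w V) = N * y * distVar w V by ring]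
  have h2 : |∑ s, (wt s - w s) * (Vt s - V s)| ≤
      1 / H * ∑ s, w s * |Vt s - V s| + 66 * Fintype.card S * H ^ 2 * y := by
    calc |∑ s, (wt s - w s) * (Vt s - V s)| ≤ ∑ s, |(wt s - w s) * (Vt s - V s)| :=
          abs_sum_le_sum_abs _ _
      _ ≤ ∑ s, (1 / H * (w s * |Vt s - V s|) + 66 * H ^ 2 * y) := by
          refine sum_le_sum fun s _ => ?_
          rw [abs_mul]
          have hb : |Vt s - V s| ≤ 2 * H := by
            have := abs_sub (Vt s) (V s)
            linarith [hV s, hVt s]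
          -- the first-order term is absorbed into the growth factor `1 + 1 / H`
          have hamgm : 6 * √(w s * y) ≤ w s / H + 9 * H * y := by
            have hws := hw.1 s
            have h1 : √(w s * y) = √(w s / H) * √(H * y) := by
              rw [← Real.sqrt_mul (by positivity)]; congr 1; field_simp
            have h2 := Real.sq_sqrt (show 0 ≤ w s / H by positivity)
            have h3 := Real.sq_sqrt (show 0 ≤ H * y by positivity)
            rw [h1]
            nlinarith [sq_nonneg (√(w s / H) - 3 * √(H * y))]
          have hc := mul_le_mul_of_nonneg_right ((hclose s).trans (add_le_add_left hamgm (24 * y)))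
            (abs_nonneg (Vt s - V s))
          have hd : (9 * H * y + 24 * y) * |Vt s - V s| ≤ 66 * H ^ 2 * y := by
            have : 9 * H * y + 24 * y ≤ 33 * H * y := by nlinarith
            calc _ ≤ (33 * H * y) * (2 * H) := by gcongr
              _ = _ := by ring
          have e : 1 / H * (w s * |Vt s - V s|) = w s / H * |Vt s - V s| := by ring
          rw [e]
          linarith
      _ = _ := by
          rw [sum_add_distrib, ← mul_sum]
          congr 1; simp; ring
  have h3 : |∑ s, w s * (Vt s - V s)| ≤ ∑ s, w s * |Vt s - V s| := by
    refine (abs_sum_le_sum_abs _ _).trans (le_of_eq ?_)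
    exact sum_congr rfl fun s _ => by rw [abs_mul, abs_of_nonneg (hw.1 s)]
  have h4 : 48 * (Fintype.card S : ℝ) * H * y ≤ 48 * Fintype.card S * H ^ 2 * y := by
    gcongr; nlinarith
  rw [hsplit]
  have h5 := abs_add_le (∑ s, (wt s - w s) * (V s - m) + ∑ s, (wt s - w s) * (Vt s - V s))
    (∑ s, w s * (Vt s - V s))
  have h6 := abs_add_le (∑ s, (wt s - w s) * (V s - m)) (∑ s, (wt s - w s) * (Vt s - V s))
  linarith

/-- **Value difference under an estimated kernel.** The occupancy measures of one policy under two
kernels that are close in the Bernstein sense are compared by testing with a bounded table. -/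
lemma abs_inner_occ_sub_le {μ : S → ℝ} (hμ : μ ∈ stdSimplex ℝ S) {p pt : Kern S A H}
    {π ℓ : Table S A H} (hp : IsKernel p) (hpt : IsKernel pt) (hπ : IsPolicy π)
    (hℓ : ∀ h s a, |ℓ h s a| ≤ 1) {y : Table S A H} (hy : ∀ h s a, 0 ≤ y h s a) {N : ℝ}
    (hN : ∀ h s a, (#{s' : S | 0 < p h s a s'} : ℝ) ≤ N)
    (hclose : ∀ h s a s', |pt h s a s' - p h s a s'| ≤
      6 * √(p h s a s' * y h s a) + 24 * y h s a) :
    |⟪vec ℓ, occ μ pt π⟫_ℝ - ⟪vec ℓ, occ μ p π⟫_ℝ| ≤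
      3 * ∑ x : Fin H × S × A, occ μ p π x *
        (6 * √(N * y x.1 x.2.1 x.2.2 * distVar (p x.1 x.2.1 x.2.2) (valueFn p π ℓ x.1.succ))
          + 114 * Fintype.card S * (H : ℝ) ^ 2 * y x.1 x.2.1 x.2.2) := by
  set V := valueFn p π ℓ with hV
  set Vt := valueFn pt π ℓ with hVt
  have hVb : ∀ j s, |V j s| ≤ H := fun j s =>
    (abs_valueFn_le hp hπ hℓ j s).trans (by simp)
  have hVtb : ∀ j s, |Vt j s| ≤ H := fun j s =>
    (abs_valueFn_le hpt hπ hℓ j s).trans (by simp)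
  have hρ := fun j s => stateDist_nonneg (π := π) hμ.1 hp hπ j s
  rw [sum_occ_mul hp hπ fun h s a => 6 * √(N * y h s a * distVar (p h s a) (V h.succ))
          + 114 * Fintype.card S * (H : ℝ) ^ 2 * y h s a]
  rw [inner_vec_occ_eq hpt hπ, inner_vec_occ_eq hp hπ]
  have hx0 : |∑ s, μ s * Vt 0 s - ∑ s, μ s * V 0 s| ≤
      ∑ s, stateDist μ p π 0 s * |Vt 0 s - V 0 s| := by
    rw [← sum_sub_distrib]
    refine (abs_sum_le_sum_abs _ _).trans (le_of_eq ?_)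
    exact sum_congr rfl fun s _ => by
      rw [← mul_sub, abs_mul, abs_of_nonneg (hμ.1 s), stateDist_zero]
  refine hx0.trans ?_
  refine backward_recursion_le (fun j => ∑ s, stateDist μ p π j s * |Vt j s - V j s|) _ ?_ ?_ ?_
  · intro h
    refine sum_nonneg fun s _ => mul_nonneg (hρ _ _) (sum_nonneg fun a _ =>
      mul_nonneg ((hπ h s).1 a) ?_)
    have := hy h s a
    positivity
  · simp [hV, hVt, valueFn_last]
  · intro h
    have hH : (1 : ℝ) ≤ H := by exact_mod_cast (Nat.one_le_iff_ne_zero.2 h.pos.ne')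
    rw [sum_stateDist_succ_mul, mul_sum, ← sum_add_distrib]
    refine sum_le_sum fun s _ => ?_
    rw [mul_left_comm, ← mul_add]
    refine mul_le_mul_of_nonneg_left ?_ (hρ _ _)
    rw [hVt, hV, valueFn_castSucc, valueFn_castSucc, ← sum_sub_distrib, mul_sum,
      ← sum_add_distrib]
    refine (abs_sum_le_sum_abs _ _).trans (sum_le_sum fun a _ => ?_)
    rw [← mul_sub, abs_mul, abs_of_nonneg ((hπ h s).1 a), mul_left_comm, ← mul_add]
    refine mul_le_mul_of_nonneg_left ?_ ((hπ h s).1 a)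
    rw [add_sub_add_left_eq_sub]
    exact abs_transition_sub_le (hp h s a) (hpt h s a) (hy h s a) (hN h s a) hH
      (hVb h.succ) (hVtb h.succ) (hclose h s a)

/-- The kernels of a Bernstein confidence region are close to each other. -/
lemma abs_sub_le_of_bernstein {a b e y c : ℝ} (ha : 0 ≤ a) (he : 0 ≤ e) (hy : 0 ≤ y)
    (hc : c ≤ e * y) (h1 : |a - e| ≤ 2 * √c + 14 / 3 * y)
    (h2 : |b - e| ≤ 2 * √c + 14 / 3 * y) :
    |b - a| ≤ 6 * √(a * y) + 24 * y := by
  have hs : √c ≤ √(e * y) := Real.sqrt_le_sqrt hc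
  have h3 : |b - a| ≤ 4 * √(e * y) + 28 / 3 * y := by
    have := abs_sub_le b e a
    rw [abs_sub_comm e a] at this
    linarith
  have h4 : e ≤ 2 * a + 40 / 3 * y := by
    have h5 := (abs_le.1 h1).1
    have h6 : 2 * √(e * y) ≤ e / 2 + 2 * y := by
      have e1 : √(e * y) = √(e / 2) * √(2 * y) := by
        rw [← Real.sqrt_mul (by positivity)]; congr 1; ring
      have e2 := Real.sq_sqrt (show 0 ≤ e / 2 by positivity)
      have e3 := Real.sq_sqrt (show 0 ≤ 2 * y by positivity)
      rw [e1]; nlinarith [sq_nonneg (√(e / 2) - √(2 * y))]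
    linarith
  have h7 : 4 * √(e * y) ≤ 6 * √(a * y) + 44 / 3 * y := by
    have h8 : √(e * y) ≤ √((3 / 2 * √(a * y) + 11 / 3 * y) ^ 2) := by
      refine Real.sqrt_le_sqrt ?_
      have e1 := Real.sq_sqrt (show 0 ≤ a * y by positivity)
      have e2 : e * y ≤ (2 * a + 40 / 3 * y) * y := by gcongr
      have e3 : 0 ≤ √(a * y) * y := by positivity
      nlinarith
    rw [Real.sqrt_sq (by positivity)] at h8
    linarith
  linarith

end ValueDifference

/-! ### Estimation errors along the played policies -/

section EstimationError

variable {S A : Type*} [Fintype S] [Fintype A] [DecidableEq S] [DecidableEq A] {H : ℕ}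

lemma one_le_visits (traj : ℕ → Traj S A H) (k : ℕ) (h : Fin H) (s : S) (a : A) :
    1 ≤ visits traj k h s a := le_max_right _ _

lemma visits_pos (traj : ℕ → Traj S A H) (k : ℕ) (h : Fin H) (s : S) (a : A) :
    0 < visits traj k h s a := lt_of_lt_of_le one_pos (one_le_visits traj k h s a)

lemma sqrt_one_div_visits_le_one (traj : ℕ → Traj S A H) (k : ℕ) (h : Fin H) (s : S) (a : A) :
    √(1 / visits traj k h s a) ≤ 1 :=
  Real.sqrt_le_iff.2 ⟨zero_le_one, by
    rw [one_pow, div_le_one (visits_pos _ _ _ _ _)]; exact one_le_visits _ _ _ _ _⟩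

lemma empTrans_nonneg (traj : ℕ → Traj S A H) (k : ℕ) (h : Fin H) (s : S) (a : A) (s' : S) :
    0 ≤ empTrans traj k h s a s' :=
  div_nonneg (Nat.cast_nonneg _) (visits_pos traj k h s a).le

lemma card_support_le (p : Kern S A H) (h : Fin H) (s : S) (a : A) :
    #{s' : S | 0 < p h s a s'} ≤ maxSupport p := by
  classical
  unfold maxSupport
  convert Finset.le_sup (f := fun x : Fin H × S × A => #{s' : S | 0 < p x.1 x.2.1 x.2.2 s'})
    (mem_univ (h, s, a))

lemma one_le_maxSupport [Nonempty S] [Nonempty A] {p : Kern S A H} (hp : IsKernel p)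
    (hH : 1 ≤ H) : 1 ≤ maxSupport p := by
  obtain ⟨s⟩ := ‹Nonempty S›
  obtain ⟨a⟩ := ‹Nonempty A›
  refine le_trans ?_ (card_support_le p ⟨0, hH⟩ s a)
  rw [Nat.one_le_iff_ne_zero, Finset.card_ne_zero]
  by_contra hne
  have h0 : ∀ s', p ⟨0, hH⟩ s a s' ≤ 0 := fun s' => by
    by_contra h
    exact hne ⟨s', by simpa using h⟩
  have := sum_nonpos fun s' (_ : s' ∈ univ) => h0 s'
  rw [(hp _ s a).2] at this
  linarith

/-- The expected number of visits in the episodes `1, …, K`, each visit being discounted by the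
number of previous visits. -/
def visitMass (μ : S → ℝ) (p : Kern S A H) (traj : ℕ → Traj S A H) (π : ℕ → Table S A H)
    (K : ℕ) : ℝ :=
  ∑ k ∈ Icc 1 K, ∑ x : Fin H × S × A, occ μ p (π k) x / visits traj k x.1 x.2.1 x.2.2

/-- The Cauchy-Schwarz inequality for a sum with weights `w`. -/
lemma sum_mul_sqrt_le {ι : Type*} (I : Finset ι) {w u v : ι → ℝ} (hw : ∀ i ∈ I, 0 ≤ w i)
    (hu : ∀ i ∈ I, 0 ≤ u i) (hv : ∀ i ∈ I, 0 ≤ v i) :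
    ∑ i ∈ I, w i * √(u i * v i) ≤ √(∑ i ∈ I, w i * u i) * √(∑ i ∈ I, w i * v i) := by
  have h1 : ∀ i ∈ I, w i * √(u i * v i) = √(max (w i * u i) 0) * √(max (w i * v i) 0) := by
    intro i hi
    have h2 := mul_nonneg (hw i hi) (hu i hi)
    rw [max_eq_left h2, max_eq_left (mul_nonneg (hw i hi) (hv i hi)),
      ← Real.sqrt_mul h2, show w i * u i * (w i * v i) = (w i) ^ 2 * (u i * v i) by ring,
      Real.sqrt_mul (sq_nonneg _), Real.sqrt_sq (hw i hi)]
  rw [sum_congr rfl h1]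
  refine (Real.sum_sqrt_mul_sqrt_le I (fun i => le_max_right _ _)
    (fun i => le_max_right _ _)).trans (le_of_eq ?_)
  rw [sum_congr rfl fun i hi => max_eq_left (mul_nonneg (hw i hi) (hu i hi)),
    sum_congr rfl fun i hi => max_eq_left (mul_nonneg (hw i hi) (hv i hi))]

/-- The cumulative error made by evaluating the policies under kernels of the confidence sets
rather than under the true kernel. -/
lemma sum_abs_inner_occ_sub_le {μ : S → ℝ} (hμ : μ ∈ stdSimplex ℝ S) {p : Kern S A H} {L : ℝ}
    (hL : 0 ≤ L) {K : ℕ} {traj : ℕ → Traj S A H} {pt : ℕ → Kern S A H}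
    {π ℓ : ℕ → Table S A H} (hp : IsKernel p) (hpc : ∀ k ∈ Icc 1 K, p ∈ confSet L traj k)
    (hpt : ∀ k ∈ Icc 1 K, pt k ∈ confSet L traj k)
    (hπ : ∀ k ∈ Icc 1 K, IsPolicy (π k)) (hℓ : ∀ k ∈ Icc 1 K, ∀ h s a, |ℓ k h s a| ≤ 1) :
    ∑ k ∈ Icc 1 K, |⟪vec (ℓ k), occ μ (pt k) (π k)⟫_ℝ - ⟪vec (ℓ k), occ μ p (π k)⟫_ℝ| ≤
      18 * (√(maxSupport p * L * visitMass μ p traj π K) * √(2 * K * H ^ 2))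
        + 342 * Fintype.card S * H ^ 2 * (L * visitMass μ p traj π K) := by
  set N : ℝ := ((maxSupport p : ℕ) : ℝ) with hN
  set y : ℕ → Table S A H := fun k h s a => L / visits traj k h s a with hy
  have hy0 : ∀ k h s a, 0 ≤ y k h s a := fun k h s a => div_nonneg hL (visits_pos _ _ _ _ _).le
  set w : ℕ × (Fin H × S × A) → ℝ := fun i => occ μ p (π i.1) i.2 with hw
  set u : ℕ × (Fin H × S × A) → ℝ := fun i => N * y i.1 i.2.1 i.2.2.1 i.2.2.2 with hu
  set v : ℕ × (Fin H × S × A) → ℝ := fun i => distVar (p i.2.1 i.2.2.1 i.2.2.2)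
    (valueFn p (π i.1) (ℓ i.1) i.2.1.succ) with hv
  have hwn : ∀ i ∈ Icc 1 K ×ˢ univ, 0 ≤ w i := fun i hi =>
    occ_nonneg hμ.1 hp (hπ i.1 (mem_product.1 hi).1) i.2
  have hY : ∑ k ∈ Icc 1 K, ∑ x : Fin H × S × A, occ μ p (π k) x * y k x.1 x.2.1 x.2.2 =
      L * visitMass μ p traj π K := by
    rw [visitMass, mul_sum]
    refine sum_congr rfl fun k _ => ?_
    rw [mul_sum]
    exact sum_congr rfl fun x _ => by simp only [hy]; ring
  have hstep : ∀ k ∈ Icc 1 K,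
      |⟪vec (ℓ k), occ μ (pt k) (π k)⟫_ℝ - ⟪vec (ℓ k), occ μ p (π k)⟫_ℝ| ≤
      18 * ∑ x, w (k, x) * √(u (k, x) * v (k, x)) + 342 * Fintype.card S * H ^ 2 *
        ∑ x : Fin H × S × A, occ μ p (π k) x * y k x.1 x.2.1 x.2.2 := by
    intro k hk
    refine (abs_inner_occ_sub_le hμ hp (hpt k hk).1 (hπ k hk) (hℓ k hk) (y := y k) (N := N)
      (hy0 k) (fun h s a => Nat.cast_le.2 (card_support_le p h s a)) ?_).trans (le_of_eq ?_)
    · intro h s a s'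
      have he := empTrans_nonneg traj k h s a s'
      have hb : bonusP L traj k h s a s' =
          2 * √(empTrans traj k h s a s' * (1 - empTrans traj k h s a s') * L
            / visits traj k h s a) + 14 / 3 * y k h s a := by
        simp only [bonusP, hy]; ring
      refine abs_sub_le_of_bernstein (hp h s a |>.1 s') he (hy0 k h s a) ?_
        (hb ▸ (hpc k hk).2 h s a s') (hb ▸ (hpt k hk).2 h s a s')
      have h1 : empTrans traj k h s a s' * (1 - empTrans traj k h s a s') * L
          / visits traj k h s a = empTrans traj k h s a s' * y k h s a
            - empTrans traj k h s a s' ^ 2 * y k h s a := by simp only [hy]; ring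
      have h2 := mul_nonneg (sq_nonneg (empTrans traj k h s a s')) (hy0 k h s a)
      rw [h1]; linarith
    · rw [mul_sum, mul_sum, mul_sum, ← sum_add_distrib]
      exact sum_congr rfl fun x _ => by simp only [w, u, v]; ring
  refine (sum_le_sum hstep).trans ?_
  -- Cauchy-Schwarz over all episodes and triples, with the total variance bound per episode
  rw [sum_add_distrib, ← mul_sum, ← mul_sum, hY]
  have hun : ∀ i, 0 ≤ u i := fun i => mul_nonneg (Nat.cast_nonneg _) (hy0 _ _ _ _)
  have hvn : ∀ i, 0 ≤ v i := fun i => distVar_nonneg (hp _ _ _) _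
  have hcs := sum_mul_sqrt_le (Icc 1 K ×ˢ univ) hwn (fun i _ => hun i) (fun i _ => hvn i)
  rw [sum_product, sum_product, sum_product] at hcs
  have e1 : ∑ k ∈ Icc 1 K, ∑ x, w (k, x) * u (k, x) = N * L * visitMass μ p traj π K := by
    rw [mul_assoc, ← hY, mul_sum]
    refine sum_congr rfl fun k _ => ?_
    rw [mul_sum]
    exact sum_congr rfl fun x _ => by simp only [w, u]; ring
  have e2 : ∑ k ∈ Icc 1 K, ∑ x, w (k, x) * v (k, x) ≤ 2 * K * (H : ℝ) ^ 2 := by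
    calc _ ≤ ∑ k ∈ Icc 1 K, 2 * (H : ℝ) ^ 2 :=
          sum_le_sum fun k hk => sum_occ_distVar_le hμ hp (hπ k hk) (hℓ k hk)
      _ = _ := by simp; ring
  rw [e1] at hcs
  gcongr
  exact hcs.trans (by gcongr)

/-- The cumulative expected bonus `1 / √n`. -/
lemma sum_inner_bonus_le {μ : S → ℝ} (hμ : μ ∈ stdSimplex ℝ S) {p : Kern S A H} {K : ℕ}
    {traj : ℕ → Traj S A H} {π : ℕ → Table S A H} (hp : IsKernel p)
    (hπ : ∀ k ∈ Icc 1 K, IsPolicy (π k)) :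
    ∑ k ∈ Icc 1 K, ⟪vec (fun h s a => √(1 / visits traj k h s a)), occ μ p (π k)⟫_ℝ ≤
      √(visitMass μ p traj π K) * √(K * H) := by
  have hcs := sum_mul_sqrt_le (Icc 1 K ×ˢ (univ : Finset (Fin H × S × A)))
    (w := fun i => occ μ p (π i.1) i.2) (u := fun i => 1 / visits traj i.1 i.2.1 i.2.2.1 i.2.2.2)
    (v := fun _ => 1)
    (fun i hi => occ_nonneg hμ.1 hp (hπ i.1 (mem_product.1 hi).1) i.2)
    (fun i _ => div_nonneg zero_le_one (visits_pos _ _ _ _ _).le) (fun _ _ => zero_le_one)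
  rw [sum_product, sum_product, sum_product] at hcs
  simp only [mul_one] at hcs
  have e : ∑ k ∈ Icc 1 K, ∑ x, occ μ p (π k) x = K * H := by
    rw [sum_congr rfl fun k hk => sum_occ hμ hp (hπ k hk)]; simp
  rw [e] at hcs
  simp only [inner_eq_sum, vec, visitMass]
  simp only [mul_one_div] at hcs
  refine (le_of_eq ?_).trans hcs
  exact sum_congr rfl fun k _ => sum_congr rfl fun x _ => mul_comm _ _

end EstimationError

/-! ### Optimistic mirror descent -/

section MirrorDescent

variable {S A : Type*} [Fintype S] [Fintype A] [DecidableEq S] [DecidableEq A] {H : ℕ}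

lemma hasDerivAt_line {U : Occ S A H → ℝ} {b : Occ S A H} (hU : DifferentiableAt ℝ U b)
    (v : Occ S A H) : HasDerivAt (fun t : ℝ => U (b + t • v)) ⟪gradient U b, v⟫_ℝ 0 := by
  have h1 : HasFDerivAt U (InnerProductSpace.toDual ℝ _ (gradient U b)) (b + (0 : ℝ) • v) := by
    simpa using hU.hasGradientAt.hasFDerivAt
  have h2 : HasDerivAt (fun t : ℝ => b + t • v) v 0 := by
    simpa using ((hasDerivAt_id (0 : ℝ)).smul_const v).const_add b
  exact h1.comp_hasDerivAt (0 : ℝ) h2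

/-- A Bregman divergence dominates half of the squared distance. -/
lemma half_sq_le_bregman {X : Set (Occ S A H)} {U : Occ S A H → ℝ} (hU : StrongConvexOn X 1 U)
    {a b : Occ S A H} (ha : a ∈ X) (hb : b ∈ X) (hd : DifferentiableAt ℝ U b) :
    1 / 2 * ‖a - b‖ ^ 2 ≤ bregman U a b := by
  have hder := (hasDerivAt_line hd (a - b)).tendsto_slope_zero_right
  have hlim : Filter.Tendsto (fun t : ℝ => U a - U b - (1 - t) * (1 / 2 * ‖a - b‖ ^ 2))
      (nhdsWithin 0 (Set.Ioi 0)) (nhds (U a - U b - (1 - 0) * (1 / 2 * ‖a - b‖ ^ 2))) := by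
    refine Filter.Tendsto.mono_left (Continuous.tendsto ?_ 0) nhdsWithin_le_nhds
    fun_prop
  have hU2 := hU.2
  have hle := le_of_tendsto_of_tendsto hder hlim (by
    filter_upwards [Ioo_mem_nhdsGT (zero_lt_one' ℝ)] with t ht
    have h1 := hU2 ha hb ht.1.le (show 0 ≤ 1 - t by linarith [ht.2]) (by ring)
    have h2 : t • a + (1 - t) • b = b + t • (a - b) := by
      rw [sub_smul, one_smul, smul_sub]; abel
    rw [h2] at h1
    simp only [smul_eq_mul] at h1 ⊢
    rw [zero_add, zero_smul, add_zero, inv_mul_le_iff₀ ht.1]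
    nlinarith)
  rw [bregman]
  linarith

/-- The three-point inequality of a mirror step. -/
lemma IsMirrorStep.inner_le {U : Occ S A H → ℝ} {Q : Set (Occ S A H)} {η : ℝ}
    {g c x : Occ S A H} (hx : IsMirrorStep U Q η g c x) (hQ : Convex ℝ Q)
    (hd : DifferentiableAt ℝ U x) {y : Occ S A H} (hy : y ∈ Q) :
    η * ⟪g, x - y⟫_ℝ ≤ bregman U y c - bregman U y x - bregman U x c := by
  have h1 : HasDerivAt (fun t : ℝ => η * ⟪x + t • (y - x), g⟫_ℝ + bregman U (x + t • (y - x)) c)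
      (η * ⟪y - x, g⟫_ℝ + (⟪gradient U x, y - x⟫_ℝ - ⟪gradient U c, y - x⟫_ℝ)) 0 := by
    have h2 : HasDerivAt (fun t : ℝ => x + t • (y - x)) (y - x) 0 := by
      simpa using ((hasDerivAt_id (0 : ℝ)).smul_const (y - x)).const_add x
    have h3 := (h2.inner ℝ (hasDerivAt_const (0 : ℝ) g)).const_mul η
    have h4 := (hasDerivAt_const (0 : ℝ) (gradient U c)).inner ℝ (h2.sub_const c)
    have h5 := ((hasDerivAt_line hd (y - x)).sub_const (U c)).sub h4
    exact (h3.add h5).congr_deriv (by simp)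
  have hmin : 0 ≤ η * ⟪y - x, g⟫_ℝ + (⟪gradient U x, y - x⟫_ℝ - ⟪gradient U c, y - x⟫_ℝ) := by
    refine ge_of_tendsto h1.tendsto_slope_zero_right ?_
    filter_upwards [Ioo_mem_nhdsGT (zero_lt_one' ℝ)] with t ht
    have hmem : x + t • (y - x) ∈ Q := by
      have := hQ hy hx.1 (a := t) (b := 1 - t) ht.1.le (by linarith [ht.2]) (by ring)
      convert this using 1
      rw [sub_smul, one_smul, smul_sub]; abel
    have h2 := isMinOn_iff.1 hx.2 _ hmem
    rw [zero_add, zero_smul, add_zero, smul_eq_mul]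
    exact mul_nonneg (inv_nonneg.2 ht.1.le) (sub_nonneg.2 h2)
  simp only [bregman]
  rw [real_inner_comm] at hmin
  have e1 : ⟪g, x - y⟫_ℝ = -⟪g, y - x⟫_ℝ := by rw [← inner_neg_right, neg_sub]
  have e2 : ⟪gradient U c, y - c⟫_ℝ = ⟪gradient U c, y - x⟫_ℝ + ⟪gradient U c, x - c⟫_ℝ := by
    rw [← inner_add_right]; congr 1; abel
  rw [e1, e2]
  linarith

/-- **Regret of optimistic mirror descent** with adaptive step sizes, over candidate sets that may
change with time as long as they all contain the comparator `u`. The first gradient has to vanish,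
since the first iterate `q 1` need not be a mirror step. -/
lemma sum_inner_sub_le {X : Set (Occ S A H)} {U : Occ S A H → ℝ} (hU : StrongConvexOn X 1 U)
    (hd : ∀ x ∈ X, DifferentiableAt ℝ U x) {C : ℝ} (hC : 0 < C)
    (hb : ∀ a ∈ X, ∀ b ∈ X, bregman U a b ≤ C) {K : ℕ} {Q : ℕ → Set (Occ S A H)}
    (hQ : ∀ k ∈ Icc 1 K, Convex ℝ (Q k)) (hQX : ∀ k ∈ Icc 1 K, Q k ⊆ X)
    {q qh g : ℕ → Occ S A H} (hg1 : g 1 = 0)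
    (hqh : ∀ k ∈ Icc 1 K, IsMirrorStep U (Q k) (stepSize C g k) (g k) (qh k) (qh (k + 1)))
    (hq : ∀ k ∈ Ico 1 K, IsMirrorStep U (Q (k + 1)) (stepSize C g (k + 1)) (g k) (qh (k + 1))
      (q (k + 1)))
    {u : Occ S A H} (hu : ∀ k ∈ Icc 1 K, u ∈ Q k) (hK : 1 ≤ K) :
    ∑ k ∈ Icc 1 K, ⟪g k, q k - u⟫_ℝ ≤
      √C * (1 + 9 / 2 * √(∑ i ∈ Icc 1 K, ‖g i - g (i - 1)‖ ^ 2)) := by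
  set E : ℕ → ℝ := fun k => ∑ i ∈ Ico 1 k, ‖g i - g (i - 1)‖ ^ 2 with hE
  -- the inverse step sizes
  set z : ℕ → ℝ := fun k => max 1 (√(E k) + √(E (k - 1))) / √C with hz
  have hsC : 0 < √C := Real.sqrt_pos.2 hC
  have hE_succ : ∀ k, 1 ≤ k → E (k + 1) = E k + ‖g k - g (k - 1)‖ ^ 2 := fun k hk =>
    sum_Ico_succ_top hk _
  have hE_mono : Monotone E := fun i j hij =>
    sum_le_sum_of_subset_of_nonneg (Ico_subset_Ico_right hij) fun _ _ _ => sq_nonneg _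
  have hz_pos : ∀ k, 0 < z k := fun k => div_pos (lt_of_lt_of_le one_pos (le_max_left _ _)) hsC
  have hz_mono : ∀ k, z k ≤ z (k + 1) := fun k => by
    simp only [hz]
    have h1 := Real.sqrt_le_sqrt (hE_mono (Nat.le_succ k))
    have h2 := Real.sqrt_le_sqrt (hE_mono (show k - 1 ≤ k + 1 - 1 by omega))
    gcongr
  have hzη : ∀ k, z k * stepSize C g k = 1 := fun k => by
    have : max 1 (√(E k) + √(E (k - 1))) ≠ 0 := (lt_of_lt_of_le one_pos (le_max_left _ _)).ne'
    change max 1 (√(E k) + √(E (k - 1))) / √C * (√C / max 1 (√(E k) + √(E (k - 1)))) = 1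
    field_simp
  have huX : u ∈ X := hQX 1 (by simp [hK]) (hu 1 (by simp [hK]))
  have hqhX : ∀ k ∈ Icc 1 K, qh (k + 1) ∈ X := fun k hk => hQX k hk (hqh k hk).1
  have hdiff0 : ∀ a ∈ X, ∀ b ∈ X, 0 ≤ bregman U a b := fun a ha b hb =>
    le_trans (by positivity) (half_sq_le_bregman hU ha hb (hd b hb))
  -- the regret of one round
  have hstep : ∀ k, 2 ≤ k → k ≤ K → ⟪g k, q k - u⟫_ℝ ≤
      z k * (bregman U u (qh k) - bregman U u (qh (k + 1))) + C * (z (k + 1) - z k)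
        + √C / 2 * (√(E (k + 1)) - √(E k)) := by
    intro k hk2 hkK
    have hk : k ∈ Icc 1 K := mem_Icc.2 ⟨by omega, hkK⟩
    have hk' : k - 1 ∈ Ico 1 K := mem_Ico.2 ⟨by omega, by omega⟩
    have hk'' : k - 1 ∈ Icc 1 K := mem_Icc.2 ⟨by omega, by omega⟩
    have hqk := hq _ hk'
    have hqhk := hqhX _ hk''
    rw [Nat.sub_add_cancel (by omega : 1 ≤ k)] at hqk hqhk
    have hqX := hQX k hk hqk.1
    have hqh1 := hqhX k hk
    have a1 := hqk.inner_le (hQ k hk) (hd _ hqX) (hqh k hk).1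
    have a2 := (hqh k hk).inner_le (hQ k hk) (hd _ hqh1) (hu k hk)
    have a3 := half_sq_le_bregman hU hqh1 hqX (hd _ hqX)
    have a4 := hdiff0 _ hqX _ hqhk
    have a5 := hb _ hqh1 _ hqX
    set η := stepSize C g k
    set x := ‖qh (k + 1) - q k‖ with hx
    set m := ‖g k - g (k - 1)‖ with hm
    have hη : z k * η = 1 := hzη k
    have b1 : ⟪g k, q k - u⟫_ℝ = ⟪g (k - 1), q k - qh (k + 1)⟫_ℝ + ⟪g k, qh (k + 1) - u⟫_ℝ
        + ⟪g k - g (k - 1), q k - qh (k + 1)⟫_ℝ := by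
      rw [inner_sub_left]
      have : q k - u = (q k - qh (k + 1)) + (qh (k + 1) - u) := by abel
      rw [this, inner_add_right]; ring
    have b2 : ⟪g k - g (k - 1), q k - qh (k + 1)⟫_ℝ ≤ m * x := by
      rw [hx, norm_sub_rev (qh (k + 1))]
      exact real_inner_le_norm _ _
    have b3 : ⟪g (k - 1), q k - qh (k + 1)⟫_ℝ + ⟪g k, qh (k + 1) - u⟫_ℝ ≤
        z k * (bregman U u (qh k) - bregman U u (qh (k + 1)) - 1 / 2 * x ^ 2) := by
      have : η * (⟪g (k - 1), q k - qh (k + 1)⟫_ℝ + ⟪g k, qh (k + 1) - u⟫_ℝ) ≤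
        bregman U u (qh k) - bregman U u (qh (k + 1)) - 1 / 2 * x ^ 2 := by linarith
      have h2 := mul_le_mul_of_nonneg_left this (hz_pos k).le
      rwa [← mul_assoc, hη, one_mul] at h2
    -- the stability term is absorbed with the next step size
    have b4 : m * x ≤ √C / 2 * (√(E (k + 1)) - √(E k)) + z (k + 1) * (1 / 2 * x ^ 2) := by
      have c1 := hE_succ k (by omega)
      have c2 : √(E (k + 1)) ^ 2 = √(E k) ^ 2 + m ^ 2 := by
        rw [Real.sq_sqrt (show 0 ≤ E (k + 1) from sum_nonneg fun _ _ => sq_nonneg _),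
          Real.sq_sqrt (show 0 ≤ E k from sum_nonneg fun _ _ => sq_nonneg _), c1]
      have c3 : √(E (k + 1)) + √(E k) ≤ z (k + 1) * √C := by
        simp only [hz]
        rw [div_mul_cancel₀ _ hsC.ne']
        exact le_max_right _ _
      have c4 := Real.sqrt_le_sqrt (hE_mono (Nat.le_succ k))
      simp only [Nat.succ_eq_add_one] at c4
      have c5 : 0 ≤ √(E k) := Real.sqrt_nonneg _
      set P := √(E (k + 1))
      set R := √(E k)
      have c6 : m ^ 2 ≤ z (k + 1) * √C * (P - R) := by
        have : m ^ 2 = (P + R) * (P - R) := by linarith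
        rw [this]
        exact mul_le_mul_of_nonneg_right c3 (by linarith)
      have hzk := hz_pos (k + 1)
      have c7 : z (k + 1) * (m * x) ≤ z (k + 1) *
          (√C / 2 * (P - R) + z (k + 1) * (1 / 2 * x ^ 2)) := by
        nlinarith [sq_nonneg (m - z (k + 1) * x)]
      exact le_of_mul_le_mul_left c7 hzk
    have b5 : (z (k + 1) - z k) * (1 / 2 * x ^ 2) ≤ (z (k + 1) - z k) * C :=
      mul_le_mul_of_nonneg_left (by linarith) (by linarith [hz_mono k])
    rw [b1]
    linarith
  -- summation by parts; the divergences from `u` are at most `C` and the inverse step sizes increase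
  have hind : ∀ n, 1 ≤ n → n ≤ K → ∑ k ∈ Icc 1 n, ⟪g k, q k - u⟫_ℝ ≤
      (C - bregman U u (qh (n + 1))) * z (n + 1) + C * (z (n + 1) - z 2) + √C / 2 * √(E (n + 1)) := by
    intro n hn
    induction n, hn using Nat.le_induction with
    | base =>
      intro h1
      have h2 := hb u huX _ (hqhX 1 (by simp [hK]))
      simp only [Icc_self, sum_singleton, hg1, inner_zero_left]
      have := hz_pos 2
      have h3 : 0 ≤ C - bregman U u (qh (1 + 1)) := by linarith
      norm_num
      positivity
    | succ n hn ih =>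
      intro h1
      rw [sum_Icc_succ_top (by omega)]
      have h2 := ih (by omega)
      have h3 := hstep (n + 1) (by omega) h1
      have h4 := hb u huX _ (hqhX (n + 1) (by simp [h1]))
      have h5 := mul_le_mul_of_nonneg_left (hz_mono (n + 1)) (sub_nonneg.2 h4)
      linarith
  refine (hind K hK le_rfl).trans ?_
  have hEK : E (K + 1) = ∑ i ∈ Icc 1 K, ‖g i - g (i - 1)‖ ^ 2 := rfl
  rw [← hEK]
  have h1 := hdiff0 u huX _ (hqhX K (by simp [hK]))
  have h2 : 0 ≤ bregman U u (qh (K + 1)) * z (K + 1) := mul_nonneg h1 (hz_pos _).le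
  have h3 : C * z (K + 1) ≤ √C * (1 + 2 * √(E (K + 1))) := by
    have e : C * z (K + 1) = √C * max 1 (√(E (K + 1)) + √(E (K + 1 - 1))) := by
      simp only [hz]
      rw [mul_div_assoc', div_eq_iff hsC.ne']
      nth_rw 1 [← Real.mul_self_sqrt hC.le]
      ring
    rw [e]
    have h4 := Real.sqrt_le_sqrt (hE_mono (show K + 1 - 1 ≤ K + 1 by omega))
    have h5 := Real.sqrt_nonneg (E (K + 1))
    gcongr
    exact max_le (by linarith) (by linarith)
  have h6 : √C ≤ C * z 2 := by
    simp only [hz]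
    rw [mul_div_assoc', le_div_iff₀ hsC, Real.mul_self_sqrt hC.le]
    exact le_mul_of_one_le_right hC.le (le_max_left _ _)
  linarith

end MirrorDescent

/-! ### The primal-dual drift -/

section PrimalDual

variable {S A : Type*} [Fintype S] [Fintype A] [DecidableEq S] [DecidableEq A] {H : ℕ}

lemma deriv_potential (β lam : ℝ) :
    deriv (fun x => Real.exp (β * x) - 1) lam = β * Real.exp (β * lam) := by
  have h : HasDerivAt (fun x : ℝ => β * x) β lam := by
    simpa using (hasDerivAt_id lam).const_mul β
  rw [(h.exp.sub_const 1).deriv, mul_comm]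

/-- A generalized gradient of the surrogate is a subgradient of its convex part at the centre of
the quadratic term. -/
lemma IsGenGradient.surrogate_sub_le {α β lam : ℝ} {r d q g : Occ S A H}
    (hg : IsGenGradient (surrogate α β lam r d q) g q) (y : Occ S A H) :
    α * (⟪r, y - q⟫_ℝ + β * Real.exp (β * lam) * (max ⟪d, q⟫_ℝ 0 - max ⟪d, y⟫_ℝ 0)) ≤
      ⟪g, q - y⟫_ℝ := by
  have h := hg y
  simp only [surrogate, deriv_potential, sub_self, norm_zero] at h
  rw [← neg_sub y q, inner_neg_right, inner_sub_right r]
  linarith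

lemma IsGenGradient.norm_le {α β lam : ℝ} (hα : 0 ≤ α) (hβ : 0 ≤ β) {r d q g : Occ S A H}
    (hg : IsGenGradient (surrogate α β lam r d q) g q) :
    ‖g‖ ≤ α * (‖r‖ + β * Real.exp (β * lam) * ‖d‖) := by
  have h := hg.surrogate_sub_le (q + g)
  have e1 : q + g - q = g := by abel
  have e2 : q - (q + g) = -g := by abel
  rw [e1, e2, inner_neg_right, real_inner_self_eq_norm_sq, inner_add_right] at h
  have h1 := abs_le.1 (abs_real_inner_le_norm r g)
  have h2 := abs_le.1 (abs_real_inner_le_norm d g)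
  have h3 : max (⟪d, q⟫_ℝ + ⟪d, g⟫_ℝ) 0 ≤ max ⟪d, q⟫_ℝ 0 + ‖d‖ * ‖g‖ := by
    have h4 : 0 ≤ ‖d‖ * ‖g‖ := by positivity
    refine max_le ?_ ?_
    · linarith [le_max_left ⟪d, q⟫_ℝ 0, h2.2]
    · linarith [le_max_right ⟪d, q⟫_ℝ 0]
  have h5 : 0 ≤ β * Real.exp (β * lam) := by positivity
  have h6 : ‖g‖ ^ 2 ≤ α * (‖r‖ + β * Real.exp (β * lam) * ‖d‖) * ‖g‖ := by
    have h7 := mul_le_mul_of_nonneg_left h3 h5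
    have h8 : α * (-(‖r‖ * ‖g‖) - β * Real.exp (β * lam) * (‖d‖ * ‖g‖)) ≤
      α * (⟪r, g⟫_ℝ + β * Real.exp (β * lam) *
        (max ⟪d, q⟫_ℝ 0 - max (⟪d, q⟫_ℝ + ⟪d, g⟫_ℝ) 0)) := by
      refine mul_le_mul_of_nonneg_left ?_ hα
      linarith
    linarith
  by_contra hlt
  push Not at hlt
  have h9 : 0 ≤ α * (‖r‖ + β * Real.exp (β * lam) * ‖d‖) := by positivity
  nlinarith

lemma norm_le_mul_sqrt_dim {v : Occ S A H} {M : ℝ} (hM : 0 ≤ M) (hv : ∀ x, |v x| ≤ M) :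
    ‖v‖ ≤ M * √(dimSAH S A H) := by
  rw [EuclideanSpace.norm_eq]
  refine Real.sqrt_le_iff.2 ⟨by positivity, ?_⟩
  have hD : 0 ≤ dimSAH S A H := by unfold dimSAH; positivity
  rw [mul_pow, Real.sq_sqrt hD]
  calc ∑ x, ‖v x‖ ^ 2 ≤ ∑ _x : Fin H × S × A, M ^ 2 := by
        refine sum_le_sum fun x _ => ?_
        rw [Real.norm_eq_abs]
        exact pow_le_pow_left₀ (abs_nonneg _) (hv x) 2
    _ = M ^ 2 * dimSAH S A H := by
        simp [dimSAH]; ring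

lemma inner_mono {v w q : Occ S A H} (hq : ∀ x, 0 ≤ q x) (h : ∀ x, v x ≤ w x) :
    ⟪v, q⟫_ℝ ≤ ⟪w, q⟫_ℝ := by
  rw [inner_eq_sum, inner_eq_sum]
  exact sum_le_sum fun x _ => mul_le_mul_of_nonneg_right (h x) (hq x)

lemma candSet_subset_allOcc (μ : S → ℝ) (L : ℝ) (traj : ℕ → Traj S A H) (k : ℕ) :
    candSet μ L traj k ⊆ allOcc μ := by
  rintro _ ⟨π, p, hπ, hp, rfl⟩
  exact ⟨π, p, hπ, hp.1, rfl⟩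

lemma nonneg_of_mem_allOcc {μ : S → ℝ} (hμ : μ ∈ stdSimplex ℝ S) {q : Occ S A H}
    (hq : q ∈ allOcc μ) (x : Fin H × S × A) : 0 ≤ q x := by
  obtain ⟨π, p, hπ, hp, rfl⟩ := hq
  exact occ_nonneg hμ.1 hp hπ x

lemma abs_inner_le_of_mem_allOcc {μ : S → ℝ} (hμ : μ ∈ stdSimplex ℝ S) {q : Occ S A H}
    (hq : q ∈ allOcc μ) {v : Occ S A H} {M : ℝ} (hv : ∀ x, |v x| ≤ M) :
    |⟪v, q⟫_ℝ| ≤ M * H := by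
  have hn := nonneg_of_mem_allOcc hμ hq
  have hs : ∑ x, q x = H := by
    obtain ⟨π, p, hπ, hp, rfl⟩ := hq
    exact sum_occ hμ hp hπ
  rw [inner_eq_sum, ← hs, mul_sum]
  refine (abs_sum_le_sum_abs _ _).trans (sum_le_sum fun x _ => ?_)
  rw [abs_mul, abs_of_nonneg (hn x)]
  exact mul_le_mul_of_nonneg_right (hv x) (hn x)

lemma bregman_le_bregmanSup {μ : S → ℝ} {U : Occ S A H → ℝ} (hU : IsMirrorMap μ U)
    {a b : Occ S A H} (ha : a ∈ allOcc μ) (hb : b ∈ allOcc μ) :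
    bregman U a b ≤ bregmanSup μ U := le_csSup hU.2.2 ⟨a, ha, b, hb, rfl⟩

lemma bregmanSup_nonneg {μ : S → ℝ} {U : Occ S A H → ℝ} (hU : IsMirrorMap μ U)
    {a : Occ S A H} (ha : a ∈ allOcc μ) : 0 ≤ bregmanSup μ U := by
  have := bregman_le_bregmanSup hU ha ha
  simpa [bregman] using this

/-- If the Bregman diameter vanishes, there is only one occupancy measure. -/
lemma eq_of_bregmanSup_eq_zero {μ : S → ℝ} {U : Occ S A H → ℝ} (hU : IsMirrorMap μ U)
    (hC : bregmanSup μ U = 0) {a b : Occ S A H} (ha : a ∈ allOcc μ) (hb : b ∈ allOcc μ) :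
    a = b := by
  have h1 := half_sq_le_bregman hU.1 ha hb (hU.2.1 b hb)
  have h2 := bregman_le_bregmanSup hU ha hb
  have h3 : ‖a - b‖ = 0 := by
    have : 0 ≤ ‖a - b‖ := norm_nonneg _
    nlinarith
  exact sub_eq_zero.1 (norm_eq_zero.1 h3)

variable {μ : S → ℝ} {U : Occ S A H → ℝ} {K : ℕ} {δ : ℝ} {traj : ℕ → Traj S A H}
  {rt dt q qh g : ℕ → Occ S A H} {lam : ℕ → ℝ} {π : ℕ → Table S A H}

lemma alpha_nonneg : 0 ≤ alpha S A H K δ := by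
  unfold alpha dimSAH; positivity

lemma beta_nonneg : 0 ≤ beta μ U K := by
  unfold beta dimSAH; positivity

/-- The dual variable is the scaled sum of the positive parts of the estimated costs. -/
lemma IsRun.lam_eq (hrun : IsRun μ U K δ traj rt dt q qh g lam π) (hdt : dt 1 = 0) {n : ℕ}
    (hn : 1 ≤ n) (hnK : n ≤ K) :
    lam n = alpha S A H K δ * ∑ k ∈ Icc 1 n, max ⟪dt k, q k⟫_ℝ 0 := by
  induction n, hn using Nat.le_induction with
  | base => simp [hrun.lam_one, hdt]
  | succ n hn ih =>
    rw [hrun.lam_succ n (mem_Ico.2 ⟨hn, hnK⟩), sum_Icc_succ_top (by omega), ih (by omega)]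
    ring

lemma IsRun.lam_mono (hrun : IsRun μ U K δ traj rt dt q qh g lam π) (hdt : dt 1 = 0) {m n : ℕ}
    (hm : 1 ≤ m) (hmn : m ≤ n) (hnK : n ≤ K) : lam m ≤ lam n := by
  rw [hrun.lam_eq hdt hm (hmn.trans hnK), hrun.lam_eq hdt (hm.trans hmn) hnK]
  refine mul_le_mul_of_nonneg_left ?_ alpha_nonneg
  exact sum_le_sum_of_subset_of_nonneg (Icc_subset_Icc_right hmn) fun _ _ _ => le_max_right _ _

/-- The potential `exp (β λ) - 1` is dominated by the penalties occurring in the surrogates. -/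
lemma IsRun.exp_lam_sub_one_le (hrun : IsRun μ U K δ traj rt dt q qh g lam π) (hdt : dt 1 = 0)
    {n : ℕ} (hn : 1 ≤ n) (hnK : n ≤ K) :
    Real.exp (beta μ U K * lam n) - 1 ≤ ∑ k ∈ Icc 1 n, alpha S A H K δ *
      (beta μ U K * Real.exp (beta μ U K * lam k) * max ⟪dt k, q k⟫_ℝ 0) := by
  induction n, hn using Nat.le_induction with
  | base => simp [hrun.lam_one, hdt]
  | succ n hn ih =>
    rw [sum_Icc_succ_top (by omega)]
    have h1 := ih (by omega)
    have h2 := hrun.lam_succ n (mem_Ico.2 ⟨hn, hnK⟩)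
    set β := beta μ U K
    -- convexity of `exp`; the penalty of episode `n + 1` involves the updated dual variable
    have h3 : Real.exp (β * lam (n + 1)) - Real.exp (β * lam n) ≤
        Real.exp (β * lam (n + 1)) * (β * lam (n + 1) - β * lam n) := by
      have h4 := Real.add_one_le_exp (β * lam n - β * lam (n + 1))
      have h5 : Real.exp (β * lam n) =
          Real.exp (β * lam (n + 1)) * Real.exp (β * lam n - β * lam (n + 1)) := by
        rw [← Real.exp_add]; congr 1; ring
      rw [h5]
      nlinarith [Real.exp_pos (β * lam (n + 1))]
    have h6 : alpha S A H K δ * (β * Real.exp (β * lam (n + 1)) *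
        max ⟪dt (n + 1), q (n + 1)⟫_ℝ 0) =
        Real.exp (β * lam (n + 1)) * (β * lam (n + 1) - β * lam n) := by
      rw [h2]; ring
    linarith

lemma IsRun.q_mem (hrun : IsRun μ U K δ traj rt dt q qh g lam π) {k : ℕ} (hk : k ∈ Icc 1 K) :
    q k ∈ candSet μ (logTermP S A H K δ) traj k := by
  obtain ⟨h1, h2⟩ := mem_Icc.1 hk
  rcases h1.eq_or_lt with rfl | h3
  · exact hrun.q_one
  · have h4 := (hrun.q_succ (k - 1) (mem_Ico.2 ⟨by omega, by omega⟩)).1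
    rwa [Nat.sub_add_cancel h1] at h4

/-- **The drift-plus-regret inequality.** The regret of the surrogates controls both the regret
against a feasible occupancy measure `u` and the exponential potential of the dual variable. The
constant in `β` makes the potential absorb the contribution of the penalties to the gradients. -/
lemma IsRun.drift_le (hrun : IsRun μ U K δ traj rt dt q qh g lam π)
    (hμ : μ ∈ stdSimplex ℝ S) (hU : IsMirrorMap μ U) (hC : 0 < bregmanSup μ U)
    (hD : 0 < dimSAH S A H) (hK : 1 ≤ K)
    (hrt1 : rt 1 = 0) (hdt1 : dt 1 = 0)
    (hrt : ∀ k ∈ Icc 1 K, ∀ x, |rt k x| ≤ 2 * (1 + √(logTerm S A H K δ)))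
    (hdt : ∀ k ∈ Icc 1 K, ∀ x, |dt k x| ≤ 3 * (1 + √(logTerm S A H K δ)))
    {u : Occ S A H} (hu : ∀ k ∈ Icc 1 K, u ∈ candSet μ (logTermP S A H K δ) traj k)
    (hud : ∀ k ∈ Icc 1 K, ⟪dt k, u⟫_ℝ ≤ 0) :
    alpha S A H K δ * ∑ k ∈ Icc 1 K, ⟪rt k, u - q k⟫_ℝ
      + 1 / 4 * Real.exp (beta μ U K * lam K) ≤
      1 + √(bregmanSup μ U) * (1 + 9 * (√K / √(dimSAH S A H))) := by
  set α := alpha S A H K δ with hα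
  set β := beta μ U K with hβ
  set C := bregmanSup μ U with hCdef
  set D := dimSAH S A H with hDdef
  set l := √(logTerm S A H K δ) with hl
  have hl0 : 0 ≤ l := Real.sqrt_nonneg _
  have hα0 : 0 ≤ α := alpha_nonneg
  have hβ0 : 0 ≤ β := beta_nonneg
  have hsD : 0 < √D := Real.sqrt_pos.2 hD
  have hsC : 0 < √C := Real.sqrt_pos.2 hC
  have hK0 : (0 : ℝ) < K := by exact_mod_cast hK
  have hsK : 0 < √(K : ℝ) := Real.sqrt_pos.2 hK0
  have hαD : α * (2 * (1 + l)) * √D = 1 / √D := by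
    rw [hα, alpha, ← hl, ← hDdef]
    have : D = √D * √D := (Real.mul_self_sqrt hD.le).symm
    have hl1 : 1 + l ≠ 0 := by positivity
    field_simp
    exact (Real.sq_sqrt hD.le)
  have hβD : √C * √K * β / √D = 1 / (8 * √6) := by
    rw [hβ, beta, ← hCdef, ← hDdef, Real.sqrt_mul (by positivity), Real.sqrt_mul (by norm_num)]
    have : √6 ≠ 0 := by positivity
    field_simp
    rw [Real.sq_sqrt hD.le]
  set e := Real.exp (β * lam K) with he
  have he0 : 0 < e := Real.exp_pos _
  -- the rewards and costs of the first episode are zero, so that the first gradient vanishes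
  have hg1 : g 1 = 0 := by
    have h := (hrun.g_eq 1 (by simp [hK])).norm_le alpha_nonneg beta_nonneg
    rw [hrt1, hdt1] at h
    simpa using h
  have hgb : ∀ k ≤ K, ‖g k‖ ≤ (1 + 3 / 2 * (β * e)) / √D := by
    intro k hk
    rcases Nat.eq_zero_or_pos k with rfl | hpos
    · rw [hrun.g_zero, norm_zero]; positivity
    have hkm : k ∈ Icc 1 K := mem_Icc.2 ⟨hpos, hk⟩
    refine ((hrun.g_eq k hkm).norm_le alpha_nonneg beta_nonneg).trans ?_
    have h1 := norm_le_mul_sqrt_dim (by positivity) (hrt k hkm)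
    have h2 := norm_le_mul_sqrt_dim (by positivity) (hdt k hkm)
    have h3 : Real.exp (β * lam k) ≤ e :=
      Real.exp_le_exp.2 (mul_le_mul_of_nonneg_left (hrun.lam_mono hdt1 hpos hk le_rfl) hβ0)
    calc α * (‖rt k‖ + β * Real.exp (β * lam k) * ‖dt k‖)
        ≤ α * (2 * (1 + l) * √D + β * e * (3 * (1 + l) * √D)) := by gcongr
      _ = (α * (2 * (1 + l)) * √D) * (1 + 3 / 2 * (β * e)) := by ring
      _ = _ := by rw [hαD]; ring
  have hsum : √(∑ i ∈ Icc 1 K, ‖g i - g (i - 1)‖ ^ 2) ≤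
      2 * √K * ((1 + 3 / 2 * (β * e)) / √D) := by
    refine Real.sqrt_le_iff.2 ⟨by positivity, ?_⟩
    set G := (1 + 3 / 2 * (β * e)) / √D
    calc ∑ i ∈ Icc 1 K, ‖g i - g (i - 1)‖ ^ 2 ≤ ∑ i ∈ Icc 1 K, (2 * G) ^ 2 := by
          refine sum_le_sum fun i hi => pow_le_pow_left₀ (norm_nonneg _) ?_ 2
          have hiK := (mem_Icc.1 hi).2
          have := norm_sub_le (g i) (g (i - 1))
          linarith [hgb i hiK, hgb (i - 1) (by omega)]
      _ = (2 * √K * G) ^ 2 := by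
          rw [mul_pow (2 * √K), mul_pow 2 (√K), Real.sq_sqrt hK0.le]
          simp; ring
  have hmd := sum_inner_sub_le hU.1 hU.2.1 hC
    (fun a ha b hb => bregman_le_bregmanSup hU ha hb)
    (fun k _ => convex_candSet hμ.1 (logTermP S A H K δ) traj k)
    (fun k _ => candSet_subset_allOcc μ _ traj k) hg1 hrun.qh_succ hrun.q_succ hu hK
  have hlow : ∑ k ∈ Icc 1 K, α * (⟪rt k, u - q k⟫_ℝ +
      β * Real.exp (β * lam k) * max ⟪dt k, q k⟫_ℝ 0) ≤ ∑ k ∈ Icc 1 K, ⟪g k, q k - u⟫_ℝ := by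
    refine sum_le_sum fun k hk => ?_
    have h := (hrun.g_eq k hk).surrogate_sub_le u
    rwa [max_eq_right (hud k hk), sub_zero] at h
  have hpot := hrun.exp_lam_sub_one_le hdt1 hK le_rfl
  simp only [mul_add, sum_add_distrib] at hlow
  rw [← mul_sum] at hlow
  have hfin : √C * (1 + 9 / 2 * √(∑ i ∈ Icc 1 K, ‖g i - g (i - 1)‖ ^ 2)) ≤
      √C * (1 + 9 * (√K / √D)) + 3 / 4 * e := by
    calc _ ≤ √C * (1 + 9 / 2 * (2 * √K * ((1 + 3 / 2 * (β * e)) / √D))) := by gcongr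
      _ = √C * (1 + 9 * (√K / √D)) + 27 / 2 * (√C * √K * β / √D) * e := by
          field_simp; ring
      _ ≤ _ := by
          rw [hβD]
          have h6 : (9 / 4 : ℝ) ≤ √6 := Real.le_sqrt_of_sq_le (by norm_num)
          have : 27 / 2 * (1 / (8 * √6)) ≤ (3 / 4 : ℝ) := by
            rw [mul_one_div, div_le_iff₀ (by positivity)]; linarith
          gcongr
  linarith

end PrimalDual

/-! ### Bounds for runs with accurate estimates -/

section Deterministic

variable {S A : Type*} [Fintype S] [Fintype A] [DecidableEq S] [DecidableEq A] {H : ℕ}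

lemma occ_mem_allOcc {μ : S → ℝ} {p : Kern S A H} {π : Table S A H} (hp : IsKernel p)
    (hπ : IsPolicy π) : occ μ p π ∈ allOcc μ := ⟨π, p, hπ, hp, rfl⟩

lemma abs_value_le {μ : S → ℝ} (hμ : μ ∈ stdSimplex ℝ S) {p : Kern S A H} {π ℓ : Table S A H}
    (hp : IsKernel p) (hπ : IsPolicy π) (hℓ : ∀ h s a, |ℓ h s a| ≤ 1) :
    |value μ p π ℓ| ≤ H := by
  rw [value_eq_inner]
  simpa using abs_inner_le_of_mem_allOcc hμ (occ_mem_allOcc hp hπ) (v := vec ℓ) (M := 1)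
    fun x => hℓ _ _ _

lemma value_nonneg {μ : S → ℝ} (hμ : μ ∈ stdSimplex ℝ S) {p : Kern S A H} {π ℓ : Table S A H}
    (hp : IsKernel p) (hπ : IsPolicy π) (hℓ : ∀ h s a, 0 ≤ ℓ h s a) :
    0 ≤ value μ p π ℓ := by
  rw [value_eq_inner, inner_eq_sum]
  exact sum_nonneg fun x _ => mul_nonneg (hℓ _ _ _) (occ_nonneg hμ.1 hp hπ x)

variable [Nonempty S] [Nonempty A] {K : ℕ} {δ : ℝ}

lemma one_le_dimSAH (hH : 1 ≤ H) : 1 ≤ dimSAH S A H := by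
  have h1 : (1 : ℝ) ≤ Fintype.card S := by exact_mod_cast Fintype.card_pos
  have h2 : (1 : ℝ) ≤ Fintype.card A := by exact_mod_cast Fintype.card_pos
  have h3 : (1 : ℝ) ≤ H := by exact_mod_cast hH
  unfold dimSAH
  exact one_le_mul_of_one_le_of_one_le (one_le_mul_of_one_le_of_one_le h1 h2) h3

lemma cast_le_dimSAH : (H : ℝ) ≤ dimSAH S A H := by
  have h1 : (1 : ℝ) ≤ Fintype.card S := by exact_mod_cast Fintype.card_pos
  have h2 : (1 : ℝ) ≤ Fintype.card A := by exact_mod_cast Fintype.card_pos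
  unfold dimSAH
  exact le_mul_of_one_le_left (by positivity) (one_le_mul_of_one_le_of_one_le h1 h2)

lemma logTerm_eq : logTerm S A H K δ = Real.log (12 * (dimSAH S A H * K) / δ) := by
  unfold logTerm dimSAH; congr 2; ring

lemma logTermP_eq : logTermP S A H K δ = Real.log (6 * (dimSAH S A H * K) / δ) := by
  unfold logTermP dimSAH; congr 2; ring

lemma one_le_dim_mul (hH : 1 ≤ H) (hK : 1 ≤ K) : 1 ≤ dimSAH S A H * K :=
  one_le_mul_of_one_le_of_one_le (one_le_dimSAH hH) (by exact_mod_cast hK)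

lemma exp_logTerm (hH : 1 ≤ H) (hK : 1 ≤ K) (hδ : 0 < δ) :
    Real.exp (logTerm S A H K δ) = 12 * (dimSAH S A H * K) / δ := by
  have := one_le_dim_mul (S := S) (A := A) hH hK
  rw [logTerm_eq, Real.exp_log (by positivity)]

lemma exp_logTermP (hH : 1 ≤ H) (hK : 1 ≤ K) (hδ : 0 < δ) :
    Real.exp (logTermP S A H K δ) = 6 * (dimSAH S A H * K) / δ := by
  have := one_le_dim_mul (S := S) (A := A) hH hK
  rw [logTermP_eq, Real.exp_log (by positivity)]

lemma le_div_delta (hδ : 0 < δ) (hδ1 : δ < 1) {x : ℝ} (hx : 0 ≤ x) : x ≤ x / δ := by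
  rw [le_div_iff₀ hδ]; nlinarith

lemma one_add_log_le_logTerm (hH : 1 ≤ H) (hK : 1 ≤ K) (hδ : 0 < δ) (hδ1 : δ < 1) :
    1 + Real.log K ≤ logTerm S A H K δ := by
  have h0 := one_le_dimSAH (S := S) (A := A) hH
  have hK' : (1 : ℝ) ≤ K := by exact_mod_cast hK
  rw [← Real.exp_le_exp, exp_logTerm hH hK hδ, Real.exp_add, Real.exp_log (by linarith)]
  refine le_trans ?_ (le_div_delta hδ hδ1 (by positivity))
  nlinarith [Real.exp_one_lt_three, mul_le_mul_of_nonneg_right h0 (by linarith : (0 : ℝ) ≤ K)]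

lemma one_le_logTerm (hH : 1 ≤ H) (hK : 1 ≤ K) (hδ : 0 < δ) (hδ1 : δ < 1) :
    1 ≤ logTerm S A H K δ := by
  have h1 := one_add_log_le_logTerm (S := S) (A := A) hH hK hδ hδ1
  have h2 : 0 ≤ Real.log (K : ℝ) := Real.log_natCast_nonneg K
  linarith

lemma one_le_logTermP (hH : 1 ≤ H) (hK : 1 ≤ K) (hδ : 0 < δ) (hδ1 : δ < 1) :
    1 ≤ logTermP S A H K δ := by
  have h0 := one_le_dim_mul (S := S) (A := A) hH hK
  rw [← Real.exp_le_exp, exp_logTermP hH hK hδ]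
  refine le_trans ?_ (le_div_delta hδ hδ1 (by positivity))
  linarith [Real.exp_one_lt_three]

lemma logTermP_le_logTerm (hH : 1 ≤ H) (hK : 1 ≤ K) (hδ : 0 < δ) :
    logTermP S A H K δ ≤ logTerm S A H K δ := by
  have h0 := one_le_dim_mul (S := S) (A := A) hH hK
  rw [← Real.exp_le_exp, exp_logTermP hH hK hδ, exp_logTerm hH hK hδ]
  gcongr
  norm_num

variable {μ : S → ℝ} {p : Kern S A H} {U : Occ S A H → ℝ} {traj : ℕ → Traj S A H}
  {rt dt q qh g : ℕ → Occ S A H} {lam : ℕ → ℝ} {π : ℕ → Table S A H}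

/-- The played policies realize the iterates under kernels of the confidence sets. -/
lemma IsRun.exists_kernel (hrun : IsRun μ U K δ traj rt dt q qh g lam π) {k : ℕ}
    (hk : k ∈ Icc 1 K) :
    ∃ pt ∈ confSet (logTermP S A H K δ) traj k, q k = occ μ pt (π k) := by
  obtain ⟨π', pt, hπ', hpt, hq⟩ := hrun.q_mem hk
  refine ⟨pt, hpt, ?_⟩
  rw [hq]
  refine (occ_eq_of_policy_eq hpt.1 (hrun.isPolicy k hk) hπ' fun h s a hne => ?_).symm
  rw [← hq] at hne ⊢
  exact hrun.policy_eq k hk h s a hne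

/-- The two leading terms of the rate, without the mirror-descent term. -/
def estRate (p : Kern S A H) (K : ℕ) : ℝ :=
  √(maxSupport p * Fintype.card S * Fintype.card A * H ^ 3 * K)
    + (Fintype.card S : ℝ) ^ 2 * Fintype.card A * H ^ 3

lemma mul_cast_le_sqrt (hp : IsKernel p) (hH : 1 ≤ H) {x : ℝ}
    (hx : x ^ 2 ≤ dimSAH S A H * H ^ 2 * K) :
    x ≤ √(maxSupport p * Fintype.card S * Fintype.card A * H ^ 3 * K) := by
  refine Real.le_sqrt_of_sq_le (hx.trans ?_)
  have h1 : (1 : ℝ) ≤ maxSupport p := by exact_mod_cast one_le_maxSupport hp hH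
  have h2 : (0 : ℝ) ≤ dimSAH S A H * H ^ 2 * K := by unfold dimSAH; positivity
  calc dimSAH S A H * H ^ 2 * K ≤ maxSupport p * (dimSAH S A H * H ^ 2 * K) :=
        le_mul_of_one_le_left h2 h1
    _ = _ := by unfold dimSAH; ring

/-- On the event of accurate estimation, evaluating the played policies under the estimated
kernels costs at most the rate, for any bounded tables. -/
lemma IsRun.estimation_le (hrun : IsRun μ U K δ traj rt dt q qh g lam π)
    (hμ : μ ∈ stdSimplex ℝ S) (hp : IsKernel p) (hH : 1 ≤ H) (hK : 1 ≤ K) (hδ : 0 < δ)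
    (hδ1 : δ < 1) (hconf : ∀ k ∈ Icc 1 K, p ∈ confSet (logTermP S A H K δ) traj k)
    (hvisit : visitMass μ p traj π K ≤ 6 * logTerm S A H K δ * dimSAH S A H)
    {ℓ : ℕ → Table S A H} (hℓ : ∀ k ∈ Icc 1 K, ∀ h s a, |ℓ k h s a| ≤ 1) :
    ∑ k ∈ Icc 1 K, |⟪vec (ℓ k), q k⟫_ℝ - ⟪vec (ℓ k), occ μ p (π k)⟫_ℝ| ≤
      2052 * logTerm S A H K δ ^ 2 * estRate p K := by
  have hex : ∀ k, ∃ pt : Kern S A H, k ∈ Icc 1 K →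
      pt ∈ confSet (logTermP S A H K δ) traj k ∧ q k = occ μ pt (π k) := fun k => by
    by_cases hk : k ∈ Icc 1 K
    · obtain ⟨pt, h1, h2⟩ := hrun.exists_kernel hk
      exact ⟨pt, fun _ => ⟨h1, h2⟩⟩
    · exact ⟨p, fun h => absurd h hk⟩
  choose pt hpt using hex
  have hL := one_le_logTerm (S := S) (A := A) hH hK hδ hδ1
  have hLp := logTermP_le_logTerm (S := S) (A := A) hH hK hδ
  have hLp1 := one_le_logTermP (S := S) (A := A) hH hK hδ hδ1
  have hmain := sum_abs_inner_occ_sub_le hμ (by linarith) hp hconf (fun k hk => (hpt k hk).1)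
    hrun.isPolicy hℓ
  rw [sum_congr rfl fun k hk => by rw [← (hpt k hk).2]] at hmain
  refine hmain.trans ?_
  set L := logTerm S A H K δ
  set Lp := logTermP S A H K δ
  set T := visitMass μ p traj π K
  have hLT : Lp * T ≤ 6 * L ^ 2 * dimSAH S A H := by
    have hD : 0 ≤ dimSAH S A H := by linarith [one_le_dimSAH (S := S) (A := A) hH]
    calc Lp * T ≤ Lp * (6 * L * dimSAH S A H) := by gcongr
      _ ≤ L * (6 * L * dimSAH S A H) := by gcongr
      _ = _ := by ring
  have h1 : √(maxSupport p * Lp * T) * √(2 * K * H ^ 2) ≤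
      4 * L * √(maxSupport p * Fintype.card S * Fintype.card A * H ^ 3 * K) := by
    rw [← Real.sqrt_mul' _ (by positivity)]
    refine Real.sqrt_le_iff.2 ⟨by positivity, ?_⟩
    rw [mul_pow, Real.sq_sqrt (by positivity)]
    calc maxSupport p * Lp * T * (2 * K * H ^ 2)
        = maxSupport p * (2 * K * H ^ 2) * (Lp * T) := by ring
      _ ≤ maxSupport p * (2 * K * H ^ 2) * (6 * L ^ 2 * dimSAH S A H) := by gcongr
      _ = 12 * L ^ 2 * (maxSupport p * Fintype.card S * Fintype.card A * H ^ 3 * K) := by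
          unfold dimSAH; ring
      _ ≤ (4 * L) ^ 2 * (maxSupport p * Fintype.card S * Fintype.card A * H ^ 3 * K) := by
          refine mul_le_mul_of_nonneg_right ?_ (by positivity)
          nlinarith
  have h2 : 342 * (Fintype.card S : ℝ) * H ^ 2 * (Lp * T) ≤
      2052 * L ^ 2 * ((Fintype.card S : ℝ) ^ 2 * Fintype.card A * H ^ 3) := by
    calc _ ≤ 342 * (Fintype.card S : ℝ) * H ^ 2 * (6 * L ^ 2 * dimSAH S A H) := by gcongr
      _ = _ := by unfold dimSAH; ring
  have h3 : 0 ≤ √(maxSupport p * Fintype.card S * Fintype.card A * H ^ 3 * K) :=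
    Real.sqrt_nonneg _
  have h4 : 72 * L ≤ 2052 * L ^ 2 := by nlinarith
  have h5 := mul_le_mul_of_nonneg_right h4 h3
  unfold estRate
  linarith

/-- The bonuses `1 / √n`, evaluated at the iterates, add up to at most the rate. -/
lemma IsRun.bonus_le (hrun : IsRun μ U K δ traj rt dt q qh g lam π)
    (hμ : μ ∈ stdSimplex ℝ S) (hp : IsKernel p) (hH : 1 ≤ H) (hK : 1 ≤ K) (hδ : 0 < δ)
    (hδ1 : δ < 1) (hconf : ∀ k ∈ Icc 1 K, p ∈ confSet (logTermP S A H K δ) traj k)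
    (hvisit : visitMass μ p traj π K ≤ 6 * logTerm S A H K δ * dimSAH S A H) :
    ∑ k ∈ Icc 1 K, ⟪vec (fun h s a => √(1 / visits traj k h s a)), q k⟫_ℝ ≤
      2055 * logTerm S A H K δ ^ 2 * estRate p K := by
  have hest := hrun.estimation_le hμ hp hH hK hδ hδ1 hconf hvisit
    (ℓ := fun k h s a => √(1 / visits traj k h s a)) (fun k _ h s a => by
      rw [abs_of_nonneg (Real.sqrt_nonneg _)]
      exact sqrt_one_div_visits_le_one _ _ _ _ _)
  have hocc := sum_inner_bonus_le hμ (traj := traj) hp hrun.isPolicy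
  have hL := one_le_logTerm (S := S) (A := A) hH hK hδ hδ1
  set L := logTerm S A H K δ
  set T := visitMass μ p traj π K
  have h1 : √T * √(K * H) ≤ 3 * L *
      √(maxSupport p * Fintype.card S * Fintype.card A * H ^ 3 * K) := by
    have h2 : √T * √(K * H) / (3 * L) ≤
        √(maxSupport p * Fintype.card S * Fintype.card A * H ^ 3 * K) := by
      refine mul_cast_le_sqrt hp hH ?_
      have hH' : (1 : ℝ) ≤ H := by exact_mod_cast hH
      have hD : 0 ≤ dimSAH S A H := by linarith [one_le_dimSAH (S := S) (A := A) hH]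
      rw [← Real.sqrt_mul' _ (by positivity), div_pow, div_le_iff₀ (by positivity)]
      have h5 : T * (K * H) ≤ 6 * L * dimSAH S A H * (K * H) := by gcongr
      have h6 : 6 * L * dimSAH S A H * (K * H) ≤ dimSAH S A H * H ^ 2 * K * (3 * L) ^ 2 := by
        have h7 : 6 * L * H ≤ H ^ 2 * (3 * L) ^ 2 := by
          have : L * H ≤ (L * H) ^ 2 := by nlinarith [mul_le_mul hL hH' zero_le_one (by linarith)]
          nlinarith
        calc _ = dimSAH S A H * K * (6 * L * H) := by ring
          _ ≤ dimSAH S A H * K * (H ^ 2 * (3 * L) ^ 2) := by gcongr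
          _ = _ := by ring
      by_cases h8 : 0 ≤ T * (K * H)
      · rw [Real.sq_sqrt h8]; linarith
      · rw [Real.sqrt_eq_zero_of_nonpos (by linarith), zero_pow two_ne_zero]; positivity
    rw [div_le_iff₀ (by positivity)] at h2
    linarith
  have h3 : 3 * L * √(maxSupport p * Fintype.card S * Fintype.card A * H ^ 3 * K) ≤
      3 * L ^ 2 * estRate p K := by
    have h4 : L ≤ L ^ 2 := by nlinarith
    have h5 : 0 ≤ (Fintype.card S : ℝ) ^ 2 * Fintype.card A * H ^ 3 := by positivity
    have h6 := Real.sqrt_nonneg (maxSupport p * Fintype.card S * Fintype.card A * H ^ 3 * K)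
    unfold estRate
    gcongr
    linarith
  have h7 : ∑ k ∈ Icc 1 K, ⟪vec (fun h s a => √(1 / visits traj k h s a)), q k⟫_ℝ ≤
      ∑ k ∈ Icc 1 K, ⟪vec (fun h s a => √(1 / visits traj k h s a)), occ μ p (π k)⟫_ℝ +
      ∑ k ∈ Icc 1 K, |⟪vec (fun h s a => √(1 / visits traj k h s a)), q k⟫_ℝ
        - ⟪vec (fun h s a => √(1 / visits traj k h s a)), occ μ p (π k)⟫_ℝ| := by
    rw [← sum_add_distrib]
    exact sum_le_sum fun k _ => by
      linarith [le_abs_self (⟪vec (fun h s a => √(1 / visits traj k h s a)), q k⟫_ℝ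
        - ⟪vec (fun h s a => √(1 / visits traj k h s a)), occ μ p (π k)⟫_ℝ)]
  linarith

/-- Accurate estimation, for one realization of the interaction: the true kernel lies
in the confidence sets, the expected visits are controlled by the actual ones, the rewards `rt`
overestimate the mean rewards `rbar`, and the costs `dt` underestimate the relevant costs `dd`, both
up to bonuses. Nothing is estimated before the first episode. -/
structure IsAccurate (μ : S → ℝ) (p : Kern S A H) (K : ℕ) (δ : ℝ) (traj : ℕ → Traj S A H)
    (rt dt : ℕ → Occ S A H) (π : ℕ → Table S A H) (rbar : Table S A H)
    (dd : ℕ → Table S A H) : Prop where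
  conf : ∀ k ∈ Icc 1 K, p ∈ confSet (logTermP S A H K δ) traj k
  visit : visitMass μ p traj π K ≤ 6 * logTerm S A H K δ * dimSAH S A H
  rbar_mem : ∀ h s a, rbar h s a ∈ Set.Icc (0 : ℝ) 1
  dd_mem : ∀ k ∈ Icc 1 K, ∀ h s a, dd k h s a ∈ Set.Icc (-1 : ℝ) 1
  rt_one : rt 1 = 0
  dt_one : dt 1 = 0
  rt_le : ∀ k ∈ Icc 2 K, ∀ h s a, rbar h s a ≤ rt k (h, s, a) ∧
    rt k (h, s, a) ≤ rbar h s a + 2 * √(logTerm S A H K δ / visits traj k h s a)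
  dt_le : ∀ k ∈ Icc 2 K, ∀ h s a, dt k (h, s, a) ≤ dd k h s a ∧
    dd k h s a ≤ dt k (h, s, a) + 2 * √(2 * logTerm S A H K δ / visits traj k h s a)

lemma eq_one_or_mem_Icc {k K : ℕ} (hk : k ∈ Icc 1 K) : k = 1 ∨ k ∈ Icc 2 K := by
  simp only [mem_Icc] at hk ⊢; omega

lemma sqrt_logTerm_div (hL : 0 ≤ logTerm S A H K δ) (k : ℕ) (h : Fin H) (s : S) (a : A) :
    √(logTerm S A H K δ / visits traj k h s a) =
      √(logTerm S A H K δ) * √(1 / visits traj k h s a) := by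
  rw [← Real.sqrt_mul hL, mul_one_div]

lemma sqrt_two_mul_logTerm_div (hL : 0 ≤ logTerm S A H K δ) (k : ℕ) (h : Fin H) (s : S) (a : A) :
    √(2 * logTerm S A H K δ / visits traj k h s a) ≤
      3 / 2 * √(logTerm S A H K δ) * √(1 / visits traj k h s a) := by
  rw [mul_div_assoc, Real.sqrt_mul (by norm_num), sqrt_logTerm_div hL, mul_assoc]
  gcongr
  exact Real.sqrt_le_iff.2 ⟨by norm_num, by norm_num⟩

variable {rbar : Table S A H} {dd : ℕ → Table S A H} {πs : Table S A H}

lemma IsAccurate.rt_mem (hacc : IsAccurate μ p K δ traj rt dt π rbar dd)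
    (hL : 1 ≤ logTerm S A H K δ) {k : ℕ} (hk : k ∈ Icc 1 K) (x : Fin H × S × A) :
    0 ≤ rt k x ∧ rt k x ≤ 2 * (1 + √(logTerm S A H K δ)) := by
  obtain ⟨h, s, a⟩ := x
  have hl := Real.sqrt_nonneg (logTerm S A H K δ)
  rcases eq_one_or_mem_Icc hk with rfl | hk2
  · rw [hacc.rt_one]; simp; linarith
  · have h1 := hacc.rt_le k hk2 h s a
    have h2 := hacc.rbar_mem h s a
    rw [sqrt_logTerm_div (by linarith)] at h1
    have h3 := mul_le_mul_of_nonneg_left (sqrt_one_div_visits_le_one traj k h s a) hl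
    exact ⟨by linarith [h2.1], by linarith [h2.2]⟩

lemma IsAccurate.abs_rt_le (hacc : IsAccurate μ p K δ traj rt dt π rbar dd)
    (hL : 1 ≤ logTerm S A H K δ) {k : ℕ} (hk : k ∈ Icc 1 K) (x : Fin H × S × A) :
    |rt k x| ≤ 2 * (1 + √(logTerm S A H K δ)) := by
  rw [abs_of_nonneg (hacc.rt_mem hL hk x).1]
  exact (hacc.rt_mem hL hk x).2

lemma IsAccurate.abs_dt_le (hacc : IsAccurate μ p K δ traj rt dt π rbar dd)
    (hL : 1 ≤ logTerm S A H K δ) {k : ℕ} (hk : k ∈ Icc 1 K) (x : Fin H × S × A) :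
    |dt k x| ≤ 3 * (1 + √(logTerm S A H K δ)) := by
  obtain ⟨h, s, a⟩ := x
  have hl := Real.sqrt_nonneg (logTerm S A H K δ)
  rcases eq_one_or_mem_Icc hk with rfl | hk2
  · rw [hacc.dt_one]; simp; linarith
  · have h1 := hacc.dt_le k hk2 h s a
    have h2 := hacc.dd_mem k hk h s a
    have h4 := sqrt_two_mul_logTerm_div (traj := traj) (zero_le_one.trans hL) k h s a
    have h3 := mul_le_mul_of_nonneg_left (sqrt_one_div_visits_le_one traj k h s a)
      (by linarith : 0 ≤ 3 / 2 * √(logTerm S A H K δ))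
    exact abs_le.2 ⟨by linarith [h2.1], by linarith [h2.2]⟩

lemma IsAccurate.abs_rbar_le (hacc : IsAccurate μ p K δ traj rt dt π rbar dd) (h : Fin H) (s : S)
    (a : A) : |rbar h s a| ≤ 1 :=
  abs_le.2 ⟨by linarith [(hacc.rbar_mem h s a).1], (hacc.rbar_mem h s a).2⟩

lemma IsAccurate.abs_dd_le (hacc : IsAccurate μ p K δ traj rt dt π rbar dd) {k : ℕ}
    (hk : k ∈ Icc 1 K) (h : Fin H) (s : S) (a : A) : |dd k h s a| ≤ 1 :=
  abs_le.2 (hacc.dd_mem k hk h s a)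

lemma IsAccurate.inner_dt_nonpos (hacc : IsAccurate μ p K δ traj rt dt π rbar dd)
    (hμ : μ ∈ stdSimplex ℝ S) (hp : IsKernel p) (hπs : IsPolicy πs)
    (hfeas : ∀ k ∈ Icc 1 K, value μ p πs (dd k) ≤ 0) {k : ℕ} (hk : k ∈ Icc 1 K) :
    ⟪dt k, occ μ p πs⟫_ℝ ≤ 0 := by
  rcases eq_one_or_mem_Icc hk with rfl | hk2
  · rw [hacc.dt_one]; simp
  · refine le_trans ?_ (hfeas k hk)
    rw [value_eq_inner]
    exact inner_mono (occ_nonneg hμ.1 hp hπs) fun x => (hacc.dt_le k hk2 _ _ _).1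

lemma alpha_mul_eq_one (hH : 1 ≤ H) :
    alpha S A H K δ * (2 * (1 + √(logTerm S A H K δ)) * dimSAH S A H) = 1 := by
  have h1 := one_le_dimSAH (S := S) (A := A) hH
  have h2 : 1 + √(logTerm S A H K δ) ≠ 0 := by positivity
  have h3 : dimSAH S A H ≠ 0 := by positivity
  rw [alpha]
  field_simp

lemma sqrt_logTerm_le (hL : 1 ≤ logTerm S A H K δ) : √(logTerm S A H K δ) ≤ logTerm S A H K δ :=
  Real.sqrt_le_iff.2 ⟨by linarith, by nlinarith⟩

/-- The regret of the iterates for the estimated rewards, when there are enough episodes. -/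
lemma IsRun.sum_reward_le (hrun : IsRun μ U K δ traj rt dt q qh g lam π)
    (hμ : μ ∈ stdSimplex ℝ S) (hp : IsKernel p) (hU : IsMirrorMap μ U) (hH : 1 ≤ H) (hK : 1 ≤ K)
    (hL : 1 ≤ logTerm S A H K δ) (hacc : IsAccurate μ p K δ traj rt dt π rbar dd)
    (hπs : IsPolicy πs) (hfeas : ∀ k ∈ Icc 1 K, value μ p πs (dd k) ≤ 0)
    (hC : 0 < bregmanSup μ U) (hKD : dimSAH S A H ≤ K) :
    ∑ k ∈ Icc 1 K, ⟪rt k, occ μ p πs - q k⟫_ℝ ≤ 4 * logTerm S A H K δ *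
      (dimSAH S A H + 10 * (√(bregmanSup μ U) * √(dimSAH S A H * K))) := by
  have hD1 := one_le_dimSAH (S := S) (A := A) hH
  have h1 := hrun.drift_le hμ hU hC (by linarith) hK hacc.rt_one hacc.dt_one
    (fun k hk => hacc.abs_rt_le hL hk) (fun k hk => hacc.abs_dt_le hL hk)
    (fun k hk => ⟨πs, p, hπs, hacc.conf k hk, rfl⟩)
    (fun k hk => hacc.inner_dt_nonpos hμ hp hπs hfeas hk)
  have hα := alpha_mul_eq_one (S := S) (A := A) (K := K) (δ := δ) hH
  have hlL := sqrt_logTerm_le hL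
  have hexp := Real.exp_pos (beta μ U K * lam K)
  set X := ∑ k ∈ Icc 1 K, ⟪rt k, occ μ p πs - q k⟫_ℝ
  set l := √(logTerm S A H K δ)
  have hl0 : 0 ≤ l := Real.sqrt_nonneg _
  set D := dimSAH S A H
  set C := bregmanSup μ U
  have hsC : 0 < √C := Real.sqrt_pos.2 hC
  have h2 : X ≤ 2 * (1 + l) * D * (1 + √C * (1 + 9 * (√K / √D))) := by
    have h3 := mul_le_mul_of_nonneg_left (show alpha S A H K δ * X ≤
      1 + √C * (1 + 9 * (√K / √D)) by linarith) (show 0 ≤ 2 * (1 + l) * D by positivity)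
    have h4 : 2 * (1 + l) * D * (alpha S A H K δ * X) = X := by
      calc _ = alpha S A H K δ * (2 * (1 + l) * D) * X := by ring
        _ = X := by rw [hα, one_mul]
    rwa [h4] at h3
  have h5 : D * (1 + √C * (1 + 9 * (√K / √D))) ≤ D + 10 * (√C * √(D * K)) := by
    have h6 : √(D * K) = √D * √K := Real.sqrt_mul (by linarith) _
    have h7 : D * (√K / √D) = √D * √K := by
      have h8 : √D ≠ 0 := (Real.sqrt_pos.2 (by linarith)).ne'
      field_simp
      rw [Real.sq_sqrt (by linarith)]
    -- here `D ≤ K` turns the factor `D` of `1 / α` into `√(D K)`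
    have h9 : D ≤ √D * √K := by
      rw [← h6]
      exact Real.le_sqrt_of_sq_le (by nlinarith)
    rw [h6]
    have h10 := mul_le_mul_of_nonneg_left h9 hsC.le
    calc _ = D + √C * D + 9 * (√C * (D * (√K / √D))) := by ring
      _ ≤ _ := by rw [h7]; linarith
  have h12 : 0 ≤ D + 10 * (√C * √(D * K)) := by positivity
  calc X ≤ 2 * (1 + l) * (D * (1 + √C * (1 + 9 * (√K / √D)))) := by linarith
    _ ≤ 2 * (1 + l) * (D + 10 * (√C * √(D * K))) := by gcongr
    _ ≤ 4 * logTerm S A H K δ * (D + 10 * (√C * √(D * K))) :=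
        mul_le_mul_of_nonneg_right (by linarith) h12

/-- The estimated violation of the iterates, when the Bregman diameter is not so large that the
bound is trivial: the dual variable is logarithmic in the size of the problem. -/
lemma IsRun.sum_cost_le (hrun : IsRun μ U K δ traj rt dt q qh g lam π)
    (hμ : μ ∈ stdSimplex ℝ S) (hp : IsKernel p) (hU : IsMirrorMap μ U) (hH : 1 ≤ H) (hK : 1 ≤ K)
    (hδ : 0 < δ) (hδ1 : δ < 1) (hacc : IsAccurate μ p K δ traj rt dt π rbar dd)
    (hπs : IsPolicy πs) (hfeas : ∀ k ∈ Icc 1 K, value μ p πs (dd k) ≤ 0)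
    (hC : 0 < bregmanSup μ U) (hsmall : √(bregmanSup μ U) ≤ K * H) :
    ∑ k ∈ Icc 1 K, max ⟪dt k, q k⟫_ℝ 0 ≤
      160 * logTerm S A H K δ ^ 2 * (√(bregmanSup μ U) * √(dimSAH S A H * K)) := by
  have hL := one_le_logTerm (S := S) (A := A) hH hK hδ hδ1
  have hD1 := one_le_dimSAH (S := S) (A := A) hH
  have hHD := cast_le_dimSAH (S := S) (A := A) (H := H)
  have hH1 : (1 : ℝ) ≤ H := by exact_mod_cast hH
  have hK1 : (1 : ℝ) ≤ K := by exact_mod_cast hK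
  have hdrift := hrun.drift_le hμ hU hC (by linarith) hK hacc.rt_one hacc.dt_one
    (fun k hk => hacc.abs_rt_le hL hk) (fun k hk => hacc.abs_dt_le hL hk)
    (fun k hk => ⟨πs, p, hπs, hacc.conf k hk, rfl⟩)
    (fun k hk => hacc.inner_dt_nonpos hμ hp hπs hfeas hk)
  have hlam := hrun.lam_eq hacc.dt_one hK le_rfl
  have hα := alpha_mul_eq_one (S := S) (A := A) (K := K) (δ := δ) hH
  have hα0 : 0 ≤ alpha S A H K δ := alpha_nonneg
  have hlL := sqrt_logTerm_le hL
  have hexpL := exp_logTerm (S := S) (A := A) hH hK hδ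
  -- the reward regret can be negative, but only linearly in `K`
  have hreward : -(K : ℝ) ≤ alpha S A H K δ * ∑ k ∈ Icc 1 K, ⟪rt k, occ μ p πs - q k⟫_ℝ := by
    rw [mul_sum]
    have h2 : ∀ k ∈ Icc 1 K, -1 ≤ alpha S A H K δ * ⟪rt k, occ μ p πs - q k⟫_ℝ := by
      intro k hk
      have h3 : 0 ≤ ⟪rt k, occ μ p πs⟫_ℝ := by
        rw [inner_eq_sum]
        exact sum_nonneg fun x _ =>
          mul_nonneg (hacc.rt_mem hL hk x).1 (occ_nonneg hμ.1 hp hπs x)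
      have h4 := (abs_le.1 (abs_inner_le_of_mem_allOcc hμ
        (candSet_subset_allOcc _ _ _ _ (hrun.q_mem hk)) (hacc.abs_rt_le hL hk))).2
      have h5 : alpha S A H K δ * (2 * (1 + √(logTerm S A H K δ)) * H) ≤ 1 :=
        le_trans (by gcongr) hα.le
      rw [inner_sub_right]
      have h6 := mul_le_mul_of_nonneg_left h4 hα0
      have h7 := mul_nonneg hα0 h3
      linarith
    calc -(K : ℝ) = ∑ k ∈ Icc 1 K, (-1 : ℝ) := by simp
      _ ≤ _ := sum_le_sum h2
  set X := ∑ k ∈ Icc 1 K, max ⟪dt k, q k⟫_ℝ 0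
  set L := logTerm S A H K δ
  set l := √L
  set D := dimSAH S A H with hD
  set C := bregmanSup μ U with hCdef
  set β := beta μ U K with hβ
  have hsC : 0 < √C := Real.sqrt_pos.2 hC
  have hl0 : 0 ≤ l := Real.sqrt_nonneg _
  -- the potential is polynomial in `H K`, hence at most `exp (2 L)`
  have hexp : Real.exp (β * lam K) ≤ Real.exp (2 * L) := by
    have h8 : √K / √D ≤ K := by
      have h9 : √(K : ℝ) ≤ K := Real.sqrt_le_iff.2 ⟨by linarith, by nlinarith⟩
      exact (div_le_self (Real.sqrt_nonneg _) (Real.one_le_sqrt.2 hD1)).trans h9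
    have h10 : √C * (1 + 9 * (√K / √D)) ≤ K * H * (1 + 9 * K) := by gcongr
    have h12 : 4 * (1 + K + K * H * (1 + 9 * K) : ℝ) ≤ (12 * (H * K)) ^ 2 := by
      have h13 : (1 : ℝ) ≤ K * H := one_le_mul_of_one_le_of_one_le hK1 hH1
      have h14 : (K : ℝ) ≤ K * H := le_mul_of_one_le_right (by linarith) hH1
      have h15 : (K : ℝ) * H ≤ (K * H) * (K * H) := le_mul_of_one_le_right (by linarith) h13
      have h16 : (K : ℝ) * H * K ≤ (K * H) * (K * H) := by gcongr
      nlinarith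
    have h17 : (12 * (H * K) : ℝ) ≤ 12 * (D * K) / δ := by
      refine le_trans ?_ (le_div_delta hδ hδ1 (by positivity))
      gcongr
    calc Real.exp (β * lam K) ≤ 4 * (1 + K + K * H * (1 + 9 * K)) := by linarith
      _ ≤ _ := h12
      _ ≤ (12 * (D * K) / δ) ^ 2 := pow_le_pow_left₀ (by positivity) h17 2
      _ = _ := by rw [← hexpL, ← Real.exp_nat_mul]; norm_num
  have hβl : β * (alpha S A H K δ * X) ≤ 2 * L := by
    rw [← hlam]; exact Real.exp_le_exp.1 hexp
  have hβval : β * (8 * √C * √(6 * D * K)) = D := by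
    rw [hβ, beta, ← hD, ← hCdef]
    have : √(6 * D * K) ≠ 0 := (Real.sqrt_pos.2 (by positivity)).ne'
    field_simp
  have h1 : X * D =
      β * (alpha S A H K δ * X) * (2 * (1 + l) * D) * (8 * √C * √(6 * D * K)) := by
    calc X * D = X * (alpha S A H K δ * (2 * (1 + l) * D)) * (β * (8 * √C * √(6 * D * K))) := by
          rw [hα, hβval, mul_one]
      _ = _ := by ring
  have h2 : X ≤ 2 * L * (2 * (1 + l)) * (8 * √C * √(6 * D * K)) := by
    have h3 : X * D ≤ 2 * L * (2 * (1 + l) * D) * (8 * √C * √(6 * D * K)) := by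
      rw [h1]; gcongr
    refine le_of_mul_le_mul_right ?_ (show 0 < D by linarith)
    linarith
  have h4 : √(6 * D * K) ≤ 5 / 2 * √(D * K) := by
    rw [mul_assoc, Real.sqrt_mul (by norm_num)]
    gcongr
    exact Real.sqrt_le_iff.2 ⟨by norm_num, by norm_num⟩
  have h5 : 2 * (1 + l) ≤ 4 * L := by linarith
  calc X ≤ 2 * L * (2 * (1 + l)) * (8 * √C * √(6 * D * K)) := h2
    _ ≤ 2 * L * (4 * L) * (8 * √C * (5 / 2 * √(D * K))) := by gcongr
    _ = _ := by ring

lemma cast_le_estRate (hH : 1 ≤ H) : (H : ℝ) ≤ estRate p K := by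
  have hH1 : (1 : ℝ) ≤ H := by exact_mod_cast hH
  have hS1 : (1 : ℝ) ≤ Fintype.card S := by exact_mod_cast Fintype.card_pos
  have hA1 : (1 : ℝ) ≤ Fintype.card A := by exact_mod_cast Fintype.card_pos
  have h2 : (1 : ℝ) ≤ (Fintype.card S : ℝ) ^ 2 * Fintype.card A :=
    one_le_mul_of_one_le_of_one_le (one_le_pow₀ hS1) hA1
  have h3 : (H : ℝ) ≤ H ^ 3 := le_self_pow₀ hH1 (by norm_num)
  have h4 := Real.sqrt_nonneg (maxSupport p * Fintype.card S * Fintype.card A * H ^ 3 * K)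
  unfold estRate
  nlinarith

lemma estRate_nonneg : 0 ≤ estRate p K := by unfold estRate; positivity

lemma inner_bonus_nonneg (hμ : μ ∈ stdSimplex ℝ S)
    (hrun : IsRun μ U K δ traj rt dt q qh g lam π) {k : ℕ} (hk : k ∈ Icc 1 K) :
    0 ≤ ⟪vec (fun h s a => √(1 / visits traj k h s a)), q k⟫_ℝ := by
  rw [inner_eq_sum]
  exact sum_nonneg fun x _ => mul_nonneg (Real.sqrt_nonneg _)
    (nonneg_of_mem_allOcc hμ (candSet_subset_allOcc _ _ _ _ (hrun.q_mem hk)) x)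

/-- The contribution of bonuses, scaled by `√L`. -/
lemma IsRun.sqrt_mul_bonus_le (hrun : IsRun μ U K δ traj rt dt q qh g lam π)
    (hμ : μ ∈ stdSimplex ℝ S) (hp : IsKernel p) (hH : 1 ≤ H) (hK : 1 ≤ K) (hδ : 0 < δ)
    (hδ1 : δ < 1) (hacc : IsAccurate μ p K δ traj rt dt π rbar dd) :
    √(logTerm S A H K δ) * ∑ k ∈ Icc 1 K, ⟪vec (fun h s a => √(1 / visits traj k h s a)), q k⟫_ℝ
      ≤ 2055 * logTerm S A H K δ ^ 3 * estRate p K := by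
  have hL := one_le_logTerm (S := S) (A := A) hH hK hδ hδ1
  have hE : 0 ≤ estRate p K := estRate_nonneg
  calc _ ≤ √(logTerm S A H K δ) * (2055 * logTerm S A H K δ ^ 2 * estRate p K) := by
        gcongr
        exact hrun.bonus_le hμ hp hH hK hδ hδ1 hacc.conf hacc.visit
    _ ≤ logTerm S A H K δ * (2055 * logTerm S A H K δ ^ 2 * estRate p K) :=
        mul_le_mul_of_nonneg_right (sqrt_logTerm_le hL) (by positivity)
    _ = _ := by ring

/-- **Regret on the event of accurate estimation**, against any policy `πs` that is feasible for
all the costs. -/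
theorem IsRun.regret_le (hrun : IsRun μ U K δ traj rt dt q qh g lam π)
    (hμ : μ ∈ stdSimplex ℝ S) (hp : IsKernel p) (hU : IsMirrorMap μ U) (hH : 1 ≤ H) (hK : 1 ≤ K)
    (hδ : 0 < δ) (hδ1 : δ < 1) (hacc : IsAccurate μ p K δ traj rt dt π rbar dd)
    (hπs : IsPolicy πs) (hfeas : ∀ k ∈ Icc 1 K, value μ p πs (dd k) ≤ 0) :
    regret μ p rbar πs π K ≤
      10000 * logTerm S A H K δ ^ 3 * (rate μ p U K + dimSAH S A H) := by
  have hL := one_le_logTerm (S := S) (A := A) hH hK hδ hδ1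
  have hD1 := one_le_dimSAH (S := S) (A := A) hH
  have hπ := hrun.isPolicy
  have huX : occ μ p πs ∈ allOcc μ := occ_mem_allOcc hp hπs
  have hrate : rate μ p U K =
    estRate p K + √(bregmanSup μ U) * √(dimSAH S A H * K) := rfl
  have hE0 : 0 ≤ estRate p K := estRate_nonneg
  have hHE := cast_le_estRate (p := p) (K := K) hH
  have hL3 : 1 ≤ logTerm S A H K δ ^ 3 := one_le_pow₀ hL
  have hreg_term : ∀ k ∈ Icc 1 K, value μ p πs rbar - value μ p (π k) rbar ≤ H := by
    intro k hk
    have h1 := abs_le.1 (abs_value_le hμ hp hπs hacc.abs_rbar_le)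
    have h2 := value_nonneg hμ hp (hπ k hk) fun h s a => (hacc.rbar_mem h s a).1
    linarith
  rw [hrate]
  rcases (bregmanSup_nonneg hU huX).eq_or_lt with hC | hC
  · -- a vanishing Bregman diameter leaves no choice to the learner
    have h1 : regret μ p rbar πs π K = 0 := by
      refine sum_eq_zero fun k hk => ?_
      rw [value_eq_inner, value_eq_inner, eq_of_bregmanSup_eq_zero hU hC.symm
        (occ_mem_allOcc hp (hπ k hk)) huX, sub_self]
    rw [h1]
    positivity
  rcases lt_or_ge (K : ℝ) (dimSAH S A H) with hKD | hKD
  · -- with few episodes, the trivial bound suffices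
    have h0 : regret μ p rbar πs π K ≤ K * H := by
      refine (sum_le_sum hreg_term).trans ?_
      simp
    have h2 : (K * H : ℝ) ≤ √(maxSupport p * Fintype.card S * Fintype.card A * H ^ 3 * K) := by
      refine mul_cast_le_sqrt hp hH ?_
      calc ((K : ℝ) * H) ^ 2 = K * (H ^ 2 * K) := by ring
        _ ≤ dimSAH S A H * (H ^ 2 * K) := by gcongr
        _ = _ := by ring
    have h3 : 0 ≤ (Fintype.card S : ℝ) ^ 2 * Fintype.card A * H ^ 3 := by positivity
    have h1 : (K * H : ℝ) ≤ estRate p K := by unfold estRate; linarith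
    have h4 : estRate p K ≤ logTerm S A H K δ ^ 3 * estRate p K := le_mul_of_one_le_left hE0 hL3
    have h5 : 0 ≤ logTerm S A H K δ ^ 3 * (√(bregmanSup μ U) * √(dimSAH S A H * K)) := by
      positivity
    have h6 : 0 ≤ logTerm S A H K δ ^ 3 * dimSAH S A H := by positivity
    linarith
  -- the first episode is bounded trivially, since nothing has been estimated before it
  have hterm : ∀ k ∈ Icc 1 K, value μ p πs rbar - value μ p (π k) rbar ≤
      (if k = 1 then (H : ℝ) else 0) + ⟪rt k, occ μ p πs - q k⟫_ℝ
      + 2 * √(logTerm S A H K δ) * ⟪vec (fun h s a => √(1 / visits traj k h s a)), q k⟫_ℝ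
      + |⟪vec rbar, q k⟫_ℝ - ⟪vec rbar, occ μ p (π k)⟫_ℝ| := by
    intro k hk
    have hw := inner_bonus_nonneg hμ hrun hk
    have hab := abs_nonneg (⟪vec rbar, q k⟫_ℝ - ⟪vec rbar, occ μ p (π k)⟫_ℝ)
    rcases eq_one_or_mem_Icc hk with rfl | hk2
    · have := hreg_term 1 hk
      rw [hacc.rt_one, inner_zero_left, if_pos rfl]
      have h2 : 0 ≤ 2 * √(logTerm S A H K δ) *
        ⟪vec (fun h s a => √(1 / visits traj 1 h s a)), q 1⟫_ℝ := by positivity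
      linarith
    · rw [if_neg (by have := (mem_Icc.1 hk2).1; omega), value_eq_inner, value_eq_inner]
      have h1 : ⟪vec rbar, occ μ p πs⟫_ℝ ≤ ⟪rt k, occ μ p πs⟫_ℝ :=
        inner_mono (nonneg_of_mem_allOcc hμ huX) fun x => (hacc.rt_le k hk2 _ _ _).1
      have h2 : ⟪rt k, q k⟫_ℝ ≤ ⟪vec rbar + (2 * √(logTerm S A H K δ)) •
          vec (fun h s a => √(1 / visits traj k h s a)), q k⟫_ℝ := by
        refine inner_mono (nonneg_of_mem_allOcc hμ
          (candSet_subset_allOcc _ _ _ _ (hrun.q_mem hk))) fun x => ?_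
        have h3 := (hacc.rt_le k hk2 x.1 x.2.1 x.2.2).2
        rw [sqrt_logTerm_div (by linarith), ← mul_assoc] at h3
        exact h3
      rw [inner_add_left, inner_smul_left] at h2
      simp only [conj_trivial] at h2
      rw [inner_sub_right]
      linarith [le_abs_self (⟪vec rbar, q k⟫_ℝ - ⟪vec rbar, occ μ p (π k)⟫_ℝ)]
  have hsum := sum_le_sum hterm
  have hfirst : ∑ k ∈ Icc 1 K, (if k = 1 then (H : ℝ) else 0) = H := by
    rw [sum_ite_eq' (Icc 1 K) 1]; simp [hK]
  rw [sum_add_distrib, sum_add_distrib, sum_add_distrib, hfirst, ← mul_sum] at hsum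
  have hest := hrun.estimation_le hμ hp hH hK hδ hδ1 hacc.conf hacc.visit (ℓ := fun _ => rbar)
    (fun _ _ => hacc.abs_rbar_le)
  have hbonus := hrun.sqrt_mul_bonus_le hμ hp hH hK hδ hδ1 hacc
  have hmd := hrun.sum_reward_le hμ hp hU hH hK hL hacc hπs hfeas hC hKD
  change ∑ k ∈ Icc 1 K, (value μ p πs rbar - value μ p (π k) rbar) ≤ _
  set L := logTerm S A H K δ
  set R := √(bregmanSup μ U) * √(dimSAH S A H * K)
  have hR : 0 ≤ R := by positivity
  have hLL3 : L ≤ L ^ 3 := le_self_pow₀ hL (by norm_num)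
  have hL23 : L ^ 2 ≤ L ^ 3 := pow_le_pow_right₀ hL (by norm_num)
  have hmd' : 4 * L * (dimSAH S A H + 10 * R) ≤ 4 * L ^ 3 * (dimSAH S A H + 10 * R) := by gcongr
  have hEs : L ^ 2 * estRate p K ≤ L ^ 3 * estRate p K := by gcongr
  have hH3 : (H : ℝ) ≤ L ^ 3 * estRate p K := hHE.trans (le_mul_of_one_le_left hE0 hL3)
  have h13 : 0 ≤ L ^ 3 * R := by positivity
  have h14 : 0 ≤ L ^ 3 * dimSAH S A H := by positivity
  linarith

/-- **Violation on the event of accurate estimation.** -/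
theorem IsRun.violation_le (hrun : IsRun μ U K δ traj rt dt q qh g lam π)
    (hμ : μ ∈ stdSimplex ℝ S) (hp : IsKernel p) (hU : IsMirrorMap μ U) (hH : 1 ≤ H) (hK : 1 ≤ K)
    (hδ : 0 < δ) (hδ1 : δ < 1) (hacc : IsAccurate μ p K δ traj rt dt π rbar dd)
    (hπs : IsPolicy πs) (hfeas : ∀ k ∈ Icc 1 K, value μ p πs (dd k) ≤ 0) :
    violation μ p dd π K ≤ 10000 * logTerm S A H K δ ^ 3 * rate μ p U K := by
  have hL := one_le_logTerm (S := S) (A := A) hH hK hδ hδ1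
  have hD1 := one_le_dimSAH (S := S) (A := A) hH
  have hK1 : (1 : ℝ) ≤ K := by exact_mod_cast hK
  have hπ := hrun.isPolicy
  have huX : occ μ p πs ∈ allOcc μ := occ_mem_allOcc hp hπs
  have hrate : rate μ p U K =
    estRate p K + √(bregmanSup μ U) * √(dimSAH S A H * K) := rfl
  have hE0 : 0 ≤ estRate p K := estRate_nonneg
  have hHE := cast_le_estRate (p := p) (K := K) hH
  have hL3 : 1 ≤ logTerm S A H K δ ^ 3 := one_le_pow₀ hL
  have hR : 0 ≤ √(bregmanSup μ U) * √(dimSAH S A H * K) := by positivity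
  have hviol_term : ∀ k ∈ Icc 1 K, max (value μ p (π k) (dd k)) 0 ≤ H := by
    intro k hk
    have h1 := abs_le.1 (abs_value_le hμ hp (hπ k hk) (hacc.abs_dd_le hk))
    exact max_le h1.2 (by positivity)
  rw [hrate]
  rcases (bregmanSup_nonneg hU huX).eq_or_lt with hC | hC
  · -- the learner's occupancy measure is the feasible one
    have h2 : violation μ p dd π K = 0 := by
      refine sum_eq_zero fun k hk => ?_
      have := hfeas k hk
      rw [value_eq_inner] at this
      rw [value_eq_inner, eq_of_bregmanSup_eq_zero hU hC.symm
        (occ_mem_allOcc hp (hπ k hk)) huX]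
      exact max_eq_right this
    rw [h2]
    positivity
  rcases le_or_gt ((K : ℝ) * H) (√(bregmanSup μ U)) with hbig | hsmall
  · -- a large Bregman diameter makes the bound trivial
    have h0 : violation μ p dd π K ≤ K * H := by
      refine (sum_le_sum hviol_term).trans ?_
      simp
    have h1 : √(bregmanSup μ U) ≤ √(bregmanSup μ U) * √(dimSAH S A H * K) := by
      refine le_mul_of_one_le_right (Real.sqrt_nonneg _) (Real.one_le_sqrt.2 ?_)
      exact one_le_mul_of_one_le_of_one_le hD1 hK1
    have h2 := le_mul_of_one_le_left hR hL3
    have h3 : 0 ≤ logTerm S A H K δ ^ 3 * estRate p K := by positivity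
    linarith
  have hterm : ∀ k ∈ Icc 1 K, max (value μ p (π k) (dd k)) 0 ≤
      (if k = 1 then (H : ℝ) else 0) + max ⟪dt k, q k⟫_ℝ 0
      + 3 * √(logTerm S A H K δ) * ⟪vec (fun h s a => √(1 / visits traj k h s a)), q k⟫_ℝ
      + |⟪vec (dd k), q k⟫_ℝ - ⟪vec (dd k), occ μ p (π k)⟫_ℝ| := by
    intro k hk
    have hw := inner_bonus_nonneg hμ hrun hk
    have hab := abs_nonneg (⟪vec (dd k), q k⟫_ℝ - ⟪vec (dd k), occ μ p (π k)⟫_ℝ)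
    have h2 : 0 ≤ 3 * √(logTerm S A H K δ) *
      ⟪vec (fun h s a => √(1 / visits traj k h s a)), q k⟫_ℝ := by positivity
    have h3 := le_max_right ⟪dt k, q k⟫_ℝ 0
    rcases eq_one_or_mem_Icc hk with rfl | hk2
    · have := hviol_term 1 hk
      rw [if_pos rfl]
      linarith
    · rw [if_neg (by have := (mem_Icc.1 hk2).1; omega)]
      refine max_le ?_ (by linarith)
      rw [value_eq_inner]
      have h4 : ⟪vec (dd k), q k⟫_ℝ ≤ ⟪dt k + (3 * √(logTerm S A H K δ)) •
          vec (fun h s a => √(1 / visits traj k h s a)), q k⟫_ℝ := by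
        refine inner_mono (nonneg_of_mem_allOcc hμ
          (candSet_subset_allOcc _ _ _ _ (hrun.q_mem hk))) fun x => ?_
        have h5 := (hacc.dt_le k hk2 x.1 x.2.1 x.2.2).2
        have h6 := sqrt_two_mul_logTerm_div (traj := traj) (zero_le_one.trans hL) k x.1 x.2.1 x.2.2
        refine h5.trans (show _ ≤ dt k x + 3 * √(logTerm S A H K δ) *
          √(1 / visits traj k x.1 x.2.1 x.2.2) from ?_)
        exact add_le_add_right (by linarith) _
      rw [inner_add_left, inner_smul_left] at h4
      simp only [conj_trivial] at h4
      linarith [le_max_left ⟪dt k, q k⟫_ℝ 0,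
        neg_abs_le (⟪vec (dd k), q k⟫_ℝ - ⟪vec (dd k), occ μ p (π k)⟫_ℝ)]
  have hsum := sum_le_sum hterm
  have hfirst : ∑ k ∈ Icc 1 K, (if k = 1 then (H : ℝ) else 0) = H := by
    rw [sum_ite_eq' (Icc 1 K) 1]; simp [hK]
  rw [sum_add_distrib, sum_add_distrib, sum_add_distrib, hfirst, ← mul_sum] at hsum
  have hest := hrun.estimation_le hμ hp hH hK hδ hδ1 hacc.conf hacc.visit
    (fun k hk => hacc.abs_dd_le hk)
  have hbonus := hrun.sqrt_mul_bonus_le hμ hp hH hK hδ hδ1 hacc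
  have hX := hrun.sum_cost_le hμ hp hU hH hK hδ hδ1 hacc hπs hfeas hC hsmall.le
  change ∑ k ∈ Icc 1 K, max (value μ p (π k) (dd k)) 0 ≤ _
  set L := logTerm S A H K δ
  set R := √(bregmanSup μ U) * √(dimSAH S A H * K)
  have hL23 : L ^ 2 ≤ L ^ 3 := pow_le_pow_right₀ hL (by norm_num)
  have hEs : L ^ 2 * estRate p K ≤ L ^ 3 * estRate p K := by gcongr
  have hH3 : (H : ℝ) ≤ L ^ 3 * estRate p K := hHE.trans (le_mul_of_one_le_left hE0 hL3)
  have h13 : L ^ 2 * R ≤ L ^ 3 * R := by gcongr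
  have h14 : 0 ≤ L ^ 3 * R := by positivity
  linarith

end Deterministic

/-! ### Exponential supermartingales along the interaction -/

section Supermartingale

variable {S A : Type*} [Fintype S] [Fintype A] [DecidableEq S] [DecidableEq A] {H : ℕ}
  {Ω X : Type*} [mΩ : MeasurableSpace Ω] [MeasurableSpace X]
  {P : Measure Ω} [IsProbabilityMeasure P] {𝓕 : Filtration ℕ mΩ}
  {μ : S → ℝ} {p : Kern S A H} {ν : Measure X} [IsProbabilityMeasure ν] {K : ℕ}
  {traj : ℕ → Ω → Traj S A H} {x : ℕ → Ω → X} {π : ℕ → Ω → Table S A H}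

lemma measurable_trajProb (μ : S → ℝ) (p : Kern S A H) (τ : Traj S A H) :
    Measurable fun π : Table S A H => trajProb μ p π τ := by
  unfold trajProb
  fun_prop

lemma measurable_occ (μ : S → ℝ) (p : Kern S A H) (y : Fin H × S × A) :
    Measurable fun π : Table S A H => occ μ p π y := by
  have : ∀ τ : Traj S A H, Measurable fun π : Table S A H =>
      if τ.1 y.1.castSucc = y.2.1 ∧ τ.2 y.1 = y.2.2 then trajProb μ p π τ else 0 := by
    intro τ
    split_ifs
    · exact measurable_trajProb μ p τ
    · exact measurable_const
  exact Finset.measurable_sum _ fun τ _ => this τ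

/-- Integrals over the event that the next trajectory is `τ` factorize. -/
lemma IsInteraction.setLIntegral_eq (hI : IsInteraction P 𝓕 μ p ν K traj x π) {k : ℕ} (hk : k < K)
    (τ : Traj S A H) {Z : Ω → ENNReal} (hZ : Measurable[𝓕 k] Z) {f : X → ENNReal}
    (hf : Measurable f) :
    ∫⁻ ω in {ω | traj (k + 1) ω = τ}, Z ω * f (x (k + 1) ω) ∂P =
      (∫⁻ ω, ENNReal.ofReal (trajProb μ p (π (k + 1) ω) τ) * Z ω ∂P) * ∫⁻ y, f y ∂ν := by
  set T := {ω | traj (k + 1) ω = τ} with hT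
  have hTm : MeasurableSet T := 𝓕.le (k + 1) _ (hI.traj_meas k hk τ)
  have hxm : Measurable (x (k + 1)) := (hI.x_meas k hk).mono (𝓕.le _) le_rfl
  have hZm : Measurable Z := hZ.mono (𝓕.le _) le_rfl
  have hdm : Measurable fun ω => ENNReal.ofReal (trajProb μ p (π (k + 1) ω) τ) :=
    ((measurable_trajProb μ p τ).comp ((hI.policy_meas k hk).mono (𝓕.le _) le_rfl)).ennreal_ofReal
  set dens : Ω → ENNReal := fun ω => ENNReal.ofReal (trajProb μ p (π (k + 1) ω) τ)
  -- the law of the past on the event, for a given set of samples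
  have h1 : ∀ B, MeasurableSet B → ∫⁻ ω in T ∩ x (k + 1) ⁻¹' B, Z ω ∂P =
      (∫⁻ ω, dens ω * Z ω ∂P) * ν B := by
    intro B hB
    have hm : (P.restrict (T ∩ x (k + 1) ⁻¹' B)).trim (𝓕.le k) =
        (ν B • P.withDensity dens).trim (𝓕.le k) := by
      refine @Measure.ext _ (𝓕 k) _ _ fun E hE => ?_
      have hE' := 𝓕.le k E hE
      rw [trim_measurableSet_eq _ hE, trim_measurableSet_eq _ hE, Measure.restrict_apply hE',
        Measure.smul_apply, withDensity_apply _ hE', smul_eq_mul, mul_comm, ← Set.inter_assoc]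
      exact hI.law k hk E hE τ B hB
    rw [← lintegral_trim (𝓕.le k) hZ, hm, lintegral_trim (𝓕.le k) hZ, lintegral_smul_measure,
      smul_eq_mul, mul_comm, lintegral_withDensity_eq_lintegral_mul _ hdm hZm]
    rfl
  have h2 : ((P.restrict T).withDensity Z).map (x (k + 1)) = (∫⁻ ω, dens ω * Z ω ∂P) • ν := by
    refine Measure.ext fun B hB => ?_
    rw [Measure.map_apply hxm hB, withDensity_apply _ (hxm hB),
      Measure.restrict_restrict (hxm hB), Set.inter_comm, h1 B hB, Measure.smul_apply, smul_eq_mul]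
  rw [← smul_eq_mul (∫⁻ ω, dens ω * Z ω ∂P), ← lintegral_smul_measure, ← h2, lintegral_map hf hxm,
    lintegral_withDensity_eq_lintegral_mul _ hZm (g := fun ω => f (x (k + 1) ω)) (hf.comp hxm)]
  rfl

/-- Multiplying by `Y` does not increase integrals of functions of the past `m`: this expresses
that the conditional expectation of `Y` given `m` is at most `1`. -/
def IsSubfactor (P : Measure Ω) (m : MeasurableSpace Ω) (Y : Ω → ENNReal) : Prop :=
  ∀ W, Measurable[m] W → ∫⁻ ω, W ω * Y ω ∂P ≤ ∫⁻ ω, W ω ∂P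

lemma eq_sum_indicator_traj (F : Traj S A H → Ω → ENNReal) (k : ℕ) :
    (fun ω => F (traj k ω) ω) = fun ω => ∑ τ, {ω | traj k ω = τ}.indicator (F τ) ω := by
  classical
  ext ω
  simp only [Set.indicator_apply, Set.mem_ofPred_eq]
  rw [sum_ite_eq]
  simp

lemma IsInteraction.measurable_comp_traj (hI : IsInteraction P 𝓕 μ p ν K traj x π) {k : ℕ}
    (hk : k < K) {F : Traj S A H → Ω → ENNReal} (hF : ∀ τ, Measurable[𝓕 (k + 1)] (F τ)) :
    Measurable[𝓕 (k + 1)] fun ω => F (traj (k + 1) ω) ω := by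
  rw [eq_sum_indicator_traj]
  exact @Finset.measurable_sum _ _ _ _ _ _ (𝓕 (k + 1)) _ _
    fun τ _ => (hF τ).indicator (hI.traj_meas k hk τ)

/-- A criterion for a function of the next trajectory and sample to be a subfactor: the trajectory
is averaged with its law given the past, the sample independently with its law `ν`. -/
lemma IsInteraction.isSubfactor (hI : IsInteraction P 𝓕 μ p ν K traj x π) {k : ℕ} (hk : k < K)
    {u : Traj S A H → Ω → ENNReal} (hu : ∀ τ, Measurable[𝓕 k] (u τ))
    {f : Traj S A H → X → ENNReal} (hf : ∀ τ, Measurable (f τ))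
    (hle : ∀ ω, ∑ τ, ENNReal.ofReal (trajProb μ p (π (k + 1) ω) τ) * (u τ ω * ∫⁻ y, f τ y ∂ν) ≤ 1) :
    IsSubfactor P (𝓕 k) fun ω =>
      u (traj (k + 1) ω) ω * f (traj (k + 1) ω) (x (k + 1) ω) := by
  intro W hW
  have hxm : Measurable (x (k + 1)) := (hI.x_meas k hk).mono (𝓕.le _) le_rfl
  have hWm : Measurable W := hW.mono (𝓕.le _) le_rfl
  have hum : ∀ τ, Measurable (u τ) := fun τ => (hu τ).mono (𝓕.le _) le_rfl
  have hdm : ∀ τ, Measurable fun ω => ENNReal.ofReal (trajProb μ p (π (k + 1) ω) τ) := fun τ =>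
    ((measurable_trajProb μ p τ).comp ((hI.policy_meas k hk).mono (𝓕.le _) le_rfl)).ennreal_ofReal
  have hTm : ∀ τ, MeasurableSet {ω | traj (k + 1) ω = τ} := fun τ =>
    𝓕.le (k + 1) _ (hI.traj_meas k hk τ)
  have e := eq_sum_indicator_traj (traj := traj)
    (fun τ ω => W ω * (u τ ω * f τ (x (k + 1) ω))) (k + 1)
  rw [e, lintegral_finsetSum]
  · have h1 : ∀ τ, ∫⁻ ω, {ω | traj (k + 1) ω = τ}.indicator
        (fun ω => W ω * (u τ ω * f τ (x (k + 1) ω))) ω ∂P =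
        ∫⁻ ω, W ω * (ENNReal.ofReal (trajProb μ p (π (k + 1) ω) τ) *
          (u τ ω * ∫⁻ y, f τ y ∂ν)) ∂P := by
      intro τ
      rw [lintegral_indicator (hTm τ)]
      simp only [← mul_assoc]
      rw [hI.setLIntegral_eq hk τ (Z := fun ω => W ω * u τ ω) (hW.mul (hu τ)) (hf τ),
        ← lintegral_mul_const (f := fun ω => ENNReal.ofReal (trajProb μ p (π (k + 1) ω) τ) *
          (W ω * u τ ω)) _ ((hdm τ).mul (hWm.mul (hum τ)))]
      refine lintegral_congr fun ω => ?_
      ring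
    simp only [h1]
    rw [← lintegral_finsetSum]
    · refine lintegral_mono fun ω => ?_
      rw [← mul_sum]
      exact mul_le_of_le_one_right' (hle ω)
    · intro τ _
      exact hWm.mul ((hdm τ).mul ((hum τ).mul_const _))
  · intro τ _
    exact (hWm.mul ((hum τ).mul ((hf τ).comp hxm))).indicator (hTm τ)

lemma IsSubfactor.ite {k : ℕ} {Y : Ω → ENNReal} (hY : IsSubfactor P (𝓕 k) Y) (hYm : Measurable Y)
    {I : Set Ω} [DecidablePred (· ∈ I)] (hI : MeasurableSet[𝓕 k] I) :
    IsSubfactor P (𝓕 k) fun ω => if ω ∈ I then Y ω else 1 := by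
  intro W hW
  have hWm : Measurable W := hW.mono (𝓕.le k) le_rfl
  have hIm : MeasurableSet I := 𝓕.le k _ hI
  have h1 := hY (I.indicator W) (hW.indicator hI)
  have e1 : ∀ ω, W ω * (if ω ∈ I then Y ω else 1) = I.indicator W ω * Y ω + Iᶜ.indicator W ω := by
    intro ω
    by_cases h : ω ∈ I <;> simp [h]
  have e2 : ∀ ω, W ω = I.indicator W ω + Iᶜ.indicator W ω := by
    intro ω
    by_cases h : ω ∈ I <;> simp [h]
  calc _ = ∫⁻ ω, I.indicator W ω * Y ω ∂P + ∫⁻ ω, Iᶜ.indicator W ω ∂P := by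
        simp only [e1]
        exact lintegral_add_left ((hWm.indicator hIm).mul hYm) _
    _ ≤ ∫⁻ ω, I.indicator W ω ∂P + ∫⁻ ω, Iᶜ.indicator W ω ∂P := by gcongr
    _ = ∫⁻ ω, W ω ∂P := by
        rw [← lintegral_add_left (hWm.indicator hIm)]
        exact lintegral_congr fun ω => (e2 ω).symm

/-- **Exponential tail bound** for a product of factors of conditional expectation at most `1`. -/
lemma measure_le_prod_le {Y : ℕ → Ω → ENNReal}
    (hYm : ∀ k < K, Measurable[𝓕 (k + 1)] (Y (k + 1)))
    (hY : ∀ k < K, IsSubfactor P (𝓕 k) (Y (k + 1))) (t : ℝ) :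
    P {ω | ENNReal.ofReal (Real.exp t) ≤ ∏ j ∈ Icc 1 K, Y j ω} ≤
      ENNReal.ofReal (Real.exp (-t)) := by
  have hmeas : ∀ n ≤ K, Measurable[𝓕 n] fun ω => ∏ j ∈ Icc 1 n, Y j ω := by
    intro n hn
    refine @Finset.measurable_prod _ _ _ _ _ _ (𝓕 n) _ _ fun j hj => ?_
    obtain ⟨h1, h2⟩ := mem_Icc.1 hj
    have := hYm (j - 1) (by omega)
    rw [Nat.sub_add_cancel h1] at this
    exact this.mono (𝓕.mono h2) le_rfl
  have hint : ∀ n ≤ K, ∫⁻ ω, ∏ j ∈ Icc 1 n, Y j ω ∂P ≤ 1 := by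
    intro n
    induction n with
    | zero => intro _; simp
    | succ n ih =>
      intro hn
      have h1 : ∀ ω, ∏ j ∈ Icc 1 (n + 1), Y j ω = (∏ j ∈ Icc 1 n, Y j ω) * Y (n + 1) ω :=
        fun ω => prod_Icc_succ_top (by omega) _
      simp only [h1]
      exact (hY n hn _ (hmeas n (by omega))).trans (ih (by omega))
  have h0 : ENNReal.ofReal (Real.exp t) ≠ 0 := by simp [Real.exp_pos]
  refine (meas_ge_le_lintegral_div ((hmeas K le_rfl).mono (𝓕.le K) le_rfl).aemeasurable h0
    ENNReal.ofReal_ne_top).trans ?_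
  rw [Real.exp_neg, ENNReal.ofReal_inv_of_pos (Real.exp_pos t), ← one_div]
  exact ENNReal.div_le_div_right (hint K le_rfl) _

lemma IsInteraction.measurableSet_traj (hI : IsInteraction P 𝓕 μ p ν K traj x π) {j : ℕ}
    (h1 : 1 ≤ j) (hj : j ≤ K) (R : Traj S A H → Prop) :
    MeasurableSet[𝓕 j] {ω | R (traj j ω)} := by
  classical
  have e : {ω | R (traj j ω)} = ⋃ τ ∈ {τ : Traj S A H | R τ}, {ω | traj j ω = τ} := by
    ext ω; simp
  rw [e]
  have := hI.traj_meas (j - 1) (by omega)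
  rw [Nat.sub_add_cancel h1] at this
  exact @MeasurableSet.biUnion _ _ (𝓕 j) _ _ (Set.to_countable _) fun τ _ => this τ

lemma IsInteraction.measurable_card_visitSet (hI : IsInteraction P 𝓕 μ p ν K traj x π) {k : ℕ}
    (hk : k ≤ K) (h : Fin H) (s : S) (a : A) :
    Measurable[𝓕 k] fun ω => #(visitSet (fun j => traj j ω) (k + 1) h s a) := by
  have e : (fun ω => #(visitSet (fun j => traj j ω) (k + 1) h s a)) = fun ω =>
      ∑ j ∈ Ico 1 (k + 1), if (traj j ω).1 h.castSucc = s ∧ (traj j ω).2 h = a then 1 else 0 := by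
    ext ω
    rw [visitSet, card_filter]
  rw [e]
  refine @Finset.measurable_sum _ _ _ _ _ _ (𝓕 k) _ _ fun j hj => ?_
  obtain ⟨h1, h2⟩ := mem_Ico.1 hj
  refine Measurable.ite (m := 𝓕 k) ?_ (@measurable_const _ _ _ (𝓕 k) _)
    (@measurable_const _ _ _ (𝓕 k) _)
  exact 𝓕.mono (by omega : j ≤ k) _
    (hI.measurableSet_traj h1 (by omega) fun τ => τ.1 h.castSucc = s ∧ τ.2 h = a)

lemma IsInteraction.measurable_visits (hI : IsInteraction P 𝓕 μ p ν K traj x π) {k : ℕ}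
    (hk : k ≤ K) (h : Fin H) (s : S) (a : A) :
    Measurable[𝓕 k] fun ω => visits (fun j => traj j ω) (k + 1) h s a := by
  have h1 : Measurable fun n : ℕ => max (n : ℝ) 1 := measurable_from_top
  exact h1.comp (hI.measurable_card_visitSet hk h s a)

lemma visitSet_mono (traj : ℕ → Traj S A H) {i j : ℕ} (hij : i ≤ j) (h : Fin H) (s : S) (a : A) :
    visitSet traj i h s a ⊆ visitSet traj j h s a :=
  filter_subset_filter _ (Ico_subset_Ico_right hij)

lemma card_visitSet_succ (traj : ℕ → Traj S A H) {k : ℕ} (hk : 1 ≤ k) (h : Fin H) (s : S)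
    (a : A) : #(visitSet traj (k + 1) h s a) = #(visitSet traj k h s a) +
      if (traj k).1 h.castSucc = s ∧ (traj k).2 h = a then 1 else 0 := by
  simp only [visitSet, card_filter]
  exact sum_Ico_succ_top hk _

/-- The first `n` visits, described without reference to the later episodes. -/
lemma filter_card_visitSet_lt (traj : ℕ → Traj S A H) {k K : ℕ} (hk : k ∈ Icc 1 K) (h : Fin H)
    (s : S) (a : A) :
    {j ∈ Icc 1 K | #(visitSet traj j h s a) < #(visitSet traj k h s a) ∧
      (traj j).1 h.castSucc = s ∧ (traj j).2 h = a} = visitSet traj k h s a := by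
  obtain ⟨hk1, hkK⟩ := mem_Icc.1 hk
  ext j
  simp only [mem_filter, mem_Icc]
  constructor
  · rintro ⟨⟨h1, h2⟩, h3, h4⟩
    have : j < k := by
      by_contra hge
      exact absurd (card_le_card (visitSet_mono traj (not_lt.1 hge) h s a)) (by omega)
    simp only [visitSet, mem_filter, mem_Ico]
    exact ⟨⟨h1, this⟩, h4⟩
  · intro hj
    have hj' := hj
    simp only [visitSet, mem_filter, mem_Ico] at hj'
    obtain ⟨⟨h1, h2⟩, h3⟩ := hj'
    refine ⟨⟨h1, by omega⟩, ?_, h3⟩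
    have h4 := card_visitSet_succ traj h1 h s a
    rw [if_pos h3] at h4
    have h5 := card_le_card (visitSet_mono traj (show j + 1 ≤ k from h2) h s a)
    omega

/-- **Concentration at visited triples.** A function `φ` of the next state and the sample whose
exponential moment is at most `1` is summed over the first `n` visits to `(h, s, a)`. Since the sum
is frozen after `n` visits, the bound holds for all episodes simultaneously. -/
lemma IsInteraction.measure_sum_visitSet_le (hI : IsInteraction P 𝓕 μ p ν K traj x π)
    (hμ : μ ∈ stdSimplex ℝ S) (hp : IsKernel p) (hπ : ∀ k ∈ Icc 1 K, ∀ ω, IsPolicy (π k ω))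
    (h : Fin H) (s : S) (a : A) {φ : S → X → ℝ} (hφ : ∀ s', Measurable (φ s')) {G : S → ℝ}
    (hG0 : ∀ s', 0 ≤ G s')
    (hG : ∀ s', ∫⁻ y, ENNReal.ofReal (Real.exp (φ s' y)) ∂ν ≤ ENNReal.ofReal (G s'))
    (hG1 : ∑ s', p h s a s' * G s' ≤ 1) (n : ℕ) (t : ℝ) :
    P {ω | ∃ k ∈ Icc 1 K, #(visitSet (fun j => traj j ω) k h s a) = n ∧
      t ≤ ∑ j ∈ visitSet (fun j => traj j ω) k h s a, φ ((traj j ω).1 h.succ) (x j ω)} ≤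
      ENNReal.ofReal (Real.exp (-t)) := by
  set V : Traj S A H → Prop := fun τ => τ.1 h.castSucc = s ∧ τ.2 h = a with hV
  set f : Traj S A H → X → ENNReal := fun τ y =>
    if V τ then ENNReal.ofReal (Real.exp (φ (τ.1 h.succ) y)) else 1 with hf
  have hfm : ∀ τ, Measurable (f τ) := fun τ => by
    simp only [hf]
    split_ifs
    · exact (Real.measurable_exp.comp (hφ _)).ennreal_ofReal
    · exact measurable_const
  -- only the first `n` visits are counted: whether episode `j` may count is known before it
  set I : ℕ → Set Ω := fun j => {ω | #(visitSet (fun j => traj j ω) j h s a) < n} with hIdef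
  set Y : ℕ → Ω → ENNReal := fun j ω =>
    if #(visitSet (fun j => traj j ω) j h s a) < n then f (traj j ω) (x j ω) else 1 with hY
  have hIm : ∀ k < K, MeasurableSet[𝓕 k] (I (k + 1)) := fun k hk =>
    (hI.measurable_card_visitSet hk.le h s a) (measurableSet_Iio (a := n))
  have hfY : ∀ k < K, Measurable[𝓕 (k + 1)] fun ω => f (traj (k + 1) ω) (x (k + 1) ω) :=
    fun k hk => hI.measurable_comp_traj hk (F := fun τ ω => f τ (x (k + 1) ω))
      fun τ => (hfm τ).comp (hI.x_meas k hk)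
  have hYm : ∀ k < K, Measurable[𝓕 (k + 1)] (Y (k + 1)) := fun k hk =>
    Measurable.ite (m := 𝓕 (k + 1)) (𝓕.mono (Nat.le_succ k) _ (hIm k hk)) (hfY k hk)
      (@measurable_const _ _ _ (𝓕 (k + 1)) _)
  have hsub : ∀ k < K, IsSubfactor P (𝓕 k) (Y (k + 1)) := by
    intro k hk
    have hπk := fun ω => hπ (k + 1) (mem_Icc.2 ⟨by omega, by omega⟩) ω
    have h1 := hI.isSubfactor hk (u := fun _ _ => 1) (fun _ => measurable_const) hfm (by
      intro ω
      have hint : ∀ τ, ∫⁻ y, f τ y ∂ν ≤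
          ENNReal.ofReal (if V τ then G (τ.1 h.succ) else 1) := by
        intro τ
        simp only [hf]
        split_ifs
        · exact hG _
        · simp
      have htp := trajProb_nonneg hμ.1 hp (hπk ω)
      have hnn : ∀ τ : Traj S A H, 0 ≤ if V τ then G (τ.1 h.succ) else 1 := fun τ => by
        split_ifs
        · exact hG0 _
        · exact zero_le_one
      calc _ ≤ ∑ τ, ENNReal.ofReal (trajProb μ p (π (k + 1) ω) τ *
            (if V τ then G (τ.1 h.succ) else 1)) := by
            refine sum_le_sum fun τ _ => ?_
            rw [one_mul, ENNReal.ofReal_mul (htp τ)]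
            gcongr
            exact hint τ
        _ = ENNReal.ofReal (∑ τ, trajProb μ p (π (k + 1) ω) τ *
            (if V τ then G (τ.1 h.succ) else 1)) :=
            (ENNReal.ofReal_sum_of_nonneg fun τ _ => mul_nonneg (htp τ) (hnn τ)).symm
        _ ≤ 1 := by
            rw [ENNReal.ofReal_le_one]
            have h2 := sum_trajProb_step μ hp (hπk ω) h
              (fun s₁ a₁ s' => if s₁ = s ∧ a₁ = a then G s' else 1)
            rw [h2]
            have h3 : ∀ s₁ a₁, ∑ s', stateDist μ p (π (k + 1) ω) h.castSucc s₁ *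
                π (k + 1) ω h s₁ a₁ * p h s₁ a₁ s' * (if s₁ = s ∧ a₁ = a then G s' else 1) ≤
                stateDist μ p (π (k + 1) ω) h.castSucc s₁ * π (k + 1) ω h s₁ a₁ := by
              intro s₁ a₁
              have h4 : 0 ≤ stateDist μ p (π (k + 1) ω) h.castSucc s₁ * π (k + 1) ω h s₁ a₁ :=
                mul_nonneg (stateDist_nonneg hμ.1 hp (hπk ω) _ _) ((hπk ω _ _).1 _)
              simp only [mul_assoc _ (p h s₁ a₁ _), ← mul_sum]
              refine mul_le_of_le_one_right h4 ?_
              split_ifs with h5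
              · obtain ⟨rfl, rfl⟩ := h5
                exact hG1
              · simp [(hp h s₁ a₁).2]
            calc _ ≤ ∑ s₁, ∑ a₁, stateDist μ p (π (k + 1) ω) h.castSucc s₁ *
                  π (k + 1) ω h s₁ a₁ := sum_le_sum fun s₁ _ => sum_le_sum fun a₁ _ => h3 s₁ a₁
              _ = 1 := by
                  simp only [← mul_sum, (hπk ω h _).2, mul_one]
                  exact sum_stateDist hμ hp (hπk ω) _)
    simp only [one_mul] at h1
    exact h1.ite ((hfY k hk).mono (𝓕.le _) le_rfl) (I := I (k + 1)) (hIm k hk)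
  refine (measure_mono ?_).trans (measure_le_prod_le hYm hsub t)
  rintro ω ⟨k, hk, hn, ht⟩
  have hprod : ∏ j ∈ Icc 1 K, Y j ω = ENNReal.ofReal (Real.exp
      (∑ j ∈ visitSet (fun j => traj j ω) k h s a, φ ((traj j ω).1 h.succ) (x j ω))) := by
    rw [Real.exp_sum, ENNReal.ofReal_prod_of_nonneg fun j _ => (Real.exp_pos _).le]
    rw [← filter_card_visitSet_lt (fun j => traj j ω) hk h s a, hn, prod_filter]
    refine prod_congr rfl fun j _ => ?_
    simp only [hY, hf, hV]
    by_cases h1 : #(visitSet (fun j => traj j ω) j h s a) < n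
    · simp [h1]
    · simp [h1]
  change _ ≤ ∏ j ∈ Icc 1 K, Y j ω
  rw [hprod]
  exact ENNReal.ofReal_le_ofReal (Real.exp_le_exp.2 ht)

end Supermartingale

/-! ### Bernstein and Hoeffding bounds at visited triples -/

section Concentration

/-- The difference of the two sides is convex with a critical point at `0`. -/
lemma two_mul_exp_le (z : ℝ) : 2 * (1 - z / 3) * (Real.exp z - 1 - z) ≤ z ^ 2 := by
  set F : ℝ → ℝ := fun z => z ^ 2 - 2 * (1 - z / 3) * (Real.exp z - 1 - z) with hF
  set F' : ℝ → ℝ := fun z => 2 * z - (-(2 / 3) * (Real.exp z - 1 - z) +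
    2 * (1 - z / 3) * (Real.exp z - 1)) with hF'
  have h1 : ∀ z, HasDerivAt (fun z : ℝ => 2 * (1 - z / 3)) (-(2 / 3)) z := fun z =>
    ((((hasDerivAt_id z).div_const 3).const_sub 1).const_mul 2).congr_deriv (by norm_num)
  have h2 : ∀ z, HasDerivAt (fun z : ℝ => Real.exp z - 1 - z) (Real.exp z - 1) z := fun z =>
    ((Real.hasDerivAt_exp z).sub_const 1).sub (hasDerivAt_id z)
  have d1 : ∀ z, HasDerivAt F (F' z) z := fun z => by
    have h3 : HasDerivAt (fun z : ℝ => z ^ 2) (2 * z) z := by simpa using hasDerivAt_pow 2 z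
    exact h3.sub ((h1 z).mul (h2 z))
  have d2 : ∀ z, HasDerivAt F' (2 / 3 * (1 + Real.exp z * (z - 1))) z := fun z => by
    have h3 : HasDerivAt (fun z : ℝ => 2 * z) 2 z := by
      simpa using (hasDerivAt_id z).const_mul 2
    have h4 : HasDerivAt (fun z : ℝ => Real.exp z - 1) (Real.exp z) z :=
      (Real.hasDerivAt_exp z).sub_const 1
    refine (h3.sub (((h2 z).const_mul (-(2 / 3))).add ((h1 z).mul h4))).congr_deriv ?_
    ring
  have hmono : Monotone F' := monotone_of_hasDerivAt_nonneg d2 fun z => by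
    have h1 : 1 - z ≤ Real.exp (-z) := by linarith [Real.add_one_le_exp (-z)]
    have h2 : Real.exp z * Real.exp (-z) = 1 := by rw [← Real.exp_add]; simp
    have h3 := mul_le_mul_of_nonneg_left h1 (Real.exp_pos z).le
    simp only [Pi.zero_apply]
    nlinarith
  have hF0 : F 0 = 0 := by simp [hF]
  have hF'0 : F' 0 = 0 := by simp [hF']
  have hdiff : Differentiable ℝ F := fun z => (d1 z).differentiableAt
  have key : 0 ≤ F z := by
    rcases le_total 0 z with hz | hz
    · have : MonotoneOn F (Set.Ici 0) := monotoneOn_of_deriv_nonneg (convex_Ici 0)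
        hdiff.continuous.continuousOn hdiff.differentiableOn fun y hy => by
          rw [(d1 y).deriv, ← hF'0]
          exact hmono (interior_subset hy)
      rw [← hF0]
      exact this Set.self_mem_Ici hz hz
    · have : AntitoneOn F (Set.Iic 0) := antitoneOn_of_deriv_nonpos (convex_Iic 0)
        hdiff.continuous.continuousOn hdiff.differentiableOn fun y hy => by
          rw [(d1 y).deriv, ← hF'0]
          exact hmono (Set.mem_Iic.1 (interior_subset hy))
      rw [← hF0]
      exact this (Set.mem_Iic.2 hz) Set.self_mem_Iic hz
  simp only [hF] at key
  linarith

lemma exp_le_one_add_add {z c : ℝ} (hzc : z ≤ c) (hc : c < 3) :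
    Real.exp z ≤ 1 + z + z ^ 2 / (2 * (1 - c / 3)) := by
  have h1 : 0 < 2 * (1 - c / 3) := by linarith
  have h2 : 0 ≤ Real.exp z - 1 - z := by linarith [Real.add_one_le_exp z]
  have h3 : Real.exp z - 1 - z ≤ z ^ 2 / (2 * (1 - c / 3)) := by
    rw [le_div_iff₀ h1, mul_comm]
    exact (mul_le_mul_of_nonneg_right (by linarith) h2).trans (two_mul_exp_le z)
  linarith

/-- **Bernstein's bound** on the moment generating function of a centred random variable `Z ≤ b`
on a finite probability space. -/
lemma sum_mul_exp_le {ι : Type*} [Fintype ι] {w : ι → ℝ} (hw : w ∈ stdSimplex ℝ ι) {Z : ι → ℝ}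
    (hZ : ∑ i, w i * Z i = 0) {b θ : ℝ} (hb : ∀ i, Z i ≤ b) (hθ : 0 ≤ θ) (hbθ : b * θ < 3) :
    ∑ i, w i * Real.exp (θ * Z i) ≤
      Real.exp ((∑ i, w i * Z i ^ 2) * θ ^ 2 / (2 * (1 - b * θ / 3))) := by
  have h1 : ∀ i, Real.exp (θ * Z i) ≤ 1 + θ * Z i + (θ * Z i) ^ 2 / (2 * (1 - b * θ / 3)) :=
    fun i => exp_le_one_add_add (by nlinarith [hb i]) hbθ
  calc ∑ i, w i * Real.exp (θ * Z i)
      ≤ ∑ i, w i * (1 + θ * Z i + (θ * Z i) ^ 2 / (2 * (1 - b * θ / 3))) :=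
        sum_le_sum fun i _ => mul_le_mul_of_nonneg_left (h1 i) (hw.1 i)
    _ = ∑ i, w i + θ * ∑ i, w i * Z i +
        (∑ i, w i * Z i ^ 2) * θ ^ 2 / (2 * (1 - b * θ / 3)) := by
        rw [mul_sum, sum_mul, sum_div, ← sum_add_distrib, ← sum_add_distrib]
        exact sum_congr rfl fun i _ => by ring
    _ ≤ _ := by
        rw [hw.2, hZ, mul_zero, add_zero]
        linarith [Real.add_one_le_exp
          ((∑ i, w i * Z i ^ 2) * θ ^ 2 / (2 * (1 - b * θ / 3)))]

/-- Solves the quadratic inequality that turns a deviation bound with the true variance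
`p (1 - p)` into one with the empirical variance. -/
lemma sub_le_of_sub_le_sqrt {p ph y : ℝ} (hp0 : 0 ≤ p) (hp1 : p ≤ 1) (hph1 : ph ≤ 1)
    (hph0 : 0 ≤ ph) (hy : 0 ≤ y)
    (h : ph - p ≤ √(2 * (p * (1 - p) + y / 3) * y) + (1 - p) * y / 3) :
    ph - p ≤ √(2 * y * (ph * (1 - ph))) + 7 / 3 * y := by
  rcases le_or_gt (ph - p) ((1 - p) * y / 3) with h1 | h1
  · have : (1 - p) * y ≤ 1 * y := mul_le_mul_of_nonneg_right (by linarith) hy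
    have := Real.sqrt_nonneg (2 * y * (ph * (1 - ph)))
    linarith
  set D := ph - p with hD
  have hD0 : 0 < D := lt_of_le_of_lt (by
    have := mul_nonneg (sub_nonneg.2 hp1) hy
    linarith) h1
  have hV : 0 ≤ p * (1 - p) := mul_nonneg hp0 (by linarith)
  have h2 : (D - (1 - p) * y / 3) ^ 2 ≤ 2 * (p * (1 - p) + y / 3) * y := by
    have h0 : 0 ≤ 2 * (p * (1 - p) + y / 3) * y := by positivity
    rw [← Real.sq_sqrt h0]
    exact pow_le_pow_left₀ (by linarith) (by linarith) 2
  have h3 : p * (1 - p) + (1 - p) * D / 3 ≤ ph * (1 - ph) + D := by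
    have e : ph = p + D := by rw [hD]; ring
    rw [e] at hph1 ⊢
    nlinarith
  have h4 : (D - y) ^ 2 ≤ 2 * y * (ph * (1 - ph)) + 5 / 3 * y ^ 2 := by
    nlinarith [sq_nonneg ((1 - p) * y)]
  have h5 : D - y ≤ √(2 * y * (ph * (1 - ph)) + (4 / 3 * y) ^ 2) :=
    Real.le_sqrt_of_sq_le (h4.trans (by nlinarith [sq_nonneg y]))
  have h6 : √(2 * y * (ph * (1 - ph)) + (4 / 3 * y) ^ 2) ≤
      √(2 * y * (ph * (1 - ph))) + 4 / 3 * y := by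
    have h7 : 0 ≤ 2 * y * (ph * (1 - ph)) :=
      mul_nonneg (by linarith) (mul_nonneg hph0 (by linarith))
    have h8 := Real.sqrt_nonneg (2 * y * (ph * (1 - ph)))
    refine Real.sqrt_le_iff.2 ⟨by linarith, ?_⟩
    nlinarith [Real.sq_sqrt h7, mul_nonneg h8 hy]
  linarith

variable {S A : Type*} [Fintype S] [Fintype A] [DecidableEq S] [DecidableEq A] {H : ℕ}
  {Ω X : Type*} [mΩ : MeasurableSpace Ω] [MeasurableSpace X]
  {P : Measure Ω} [IsProbabilityMeasure P] {𝓕 : Filtration ℕ mΩ}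
  {μ : S → ℝ} {p : Kern S A H} {ν : Measure X} [IsProbabilityMeasure ν] {K : ℕ}
  {traj : ℕ → Ω → Traj S A H} {x : ℕ → Ω → X} {π : ℕ → Ω → Table S A H}

/-- One-sided empirical Bernstein bound for the probability of moving to a set `B` of states. With
singletons and their complements for `B`, it yields both signs. -/
lemma IsInteraction.measure_transition_le (hI : IsInteraction P 𝓕 μ p ν K traj x π)
    (hμ : μ ∈ stdSimplex ℝ S) (hp : IsKernel p) (hπ : ∀ k ∈ Icc 1 K, ∀ ω, IsPolicy (π k ω))
    (h : Fin H) (s : S) (a : A) (B : Finset S) {n : ℕ} (hn : 1 ≤ n) {L : ℝ} (hL : 0 < L) :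
    P {ω | ∃ k ∈ Icc 1 K, #(visitSet (fun j => traj j ω) k h s a) = n ∧
      ¬ ((#{j ∈ visitSet (fun j => traj j ω) k h s a | (traj j ω).1 h.succ ∈ B} : ℝ) / n
        - ∑ s' ∈ B, p h s a s' ≤
        √(2 * (2 * L / n) *
          ((#{j ∈ visitSet (fun j => traj j ω) k h s a | (traj j ω).1 h.succ ∈ B} : ℝ) / n *
          (1 - (#{j ∈ visitSet (fun j => traj j ω) k h s a | (traj j ω).1 h.succ ∈ B} : ℝ) / n)))
        + 7 / 3 * (2 * L / n))} ≤
      ENNReal.ofReal (Real.exp (-(2 * L))) := by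
  have hn0 : (0 : ℝ) < n := by exact_mod_cast hn
  set pB := ∑ s' ∈ B, p h s a s' with hpB
  have hpB0 : 0 ≤ pB := sum_nonneg fun s' _ => (hp h s a).1 s'
  have hpB1 : pB ≤ 1 := by
    rw [← (hp h s a).2]
    exact sum_le_sum_of_subset_of_nonneg (subset_univ B) fun s' _ _ => (hp h s a).1 s'
  set y := 2 * L / n with hy
  have hy0 : 0 < y := by positivity
  set V := pB * (1 - pB) with hV
  have hV0 : 0 ≤ V := mul_nonneg hpB0 (by linarith)
  -- the variance is enlarged to stay positive; the exponent `θ` is optimized for `V'`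
  set V' := V + y / 3 with hV'
  have hV'0 : 0 < V' := by positivity
  -- the value of `u` that minimizes `y / u + V' u / 2`
  set u := √(2 * y / V') with hu
  have hu0 : 0 < u := Real.sqrt_pos.2 (by positivity)
  have hu2 : V' * u ^ 2 = 2 * y := by
    rw [hu, Real.sq_sqrt (by positivity)]
    field_simp
  set b := 1 - pB with hb
  have hb0 : 0 ≤ b := by linarith
  have hD0 : 0 < 1 + b * u / 3 := by positivity
  set θ := u / (1 + b * u / 3) with hθ
  have hθ0 : 0 < θ := by positivity
  have hθu : θ * (1 + b * u / 3) = u := by rw [hθ]; field_simp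
  have hbθ : 1 - b * θ / 3 = 1 / (1 + b * u / 3) := by rw [hθ]; field_simp; ring
  set Z : S → ℝ := fun s' => (if s' ∈ B then 1 else 0) - pB with hZ
  have hZ0 : ∑ s', p h s a s' * Z s' = 0 := by
    simp only [hZ, mul_sub, sum_sub_distrib, mul_ite, mul_one, mul_zero, ← sum_mul, (hp h s a).2]
    rw [sum_ite_mem, univ_inter]
    simp [hpB]
  have hZ2 : ∑ s', p h s a s' * Z s' ^ 2 = V := by
    have e : ∀ s', p h s a s' * Z s' ^ 2 =
        (if s' ∈ B then p h s a s' else 0) * (1 - 2 * pB) + p h s a s' * pB ^ 2 := by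
      intro s'
      simp only [hZ]
      split_ifs <;> ring
    simp only [e, sum_add_distrib, ← sum_mul, (hp h s a).2]
    rw [sum_ite_mem, univ_inter, ← hpB, hV]
    ring
  have hZb : ∀ s', Z s' ≤ b := by
    intro s'
    simp only [hZ, hb]
    split_ifs <;> linarith
  have hmgf := sum_mul_exp_le (hp h s a) hZ0 hZb hθ0.le (by
    have : 0 < 1 / (1 + b * u / 3) := by positivity
    linarith)
  rw [hZ2, hbθ] at hmgf
  have eψ : V * θ ^ 2 / (2 * (1 / (1 + b * u / 3))) = V * θ * u / 2 := by
    calc _ = V * θ * (θ * (1 + b * u / 3)) / 2 := by field_simp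
      _ = _ := by rw [hθu]
  rw [eψ] at hmgf
  refine (measure_mono ?_).trans (hI.measure_sum_visitSet_le hμ hp hπ h s a
    (φ := fun s' _ => θ * Z s' - V * θ * u / 2) (fun s' => measurable_const)
    (G := fun s' => Real.exp (θ * Z s' - V * θ * u / 2)) (fun s' => (Real.exp_pos _).le)
    (fun s' => by simp) ?_ n (2 * L))
  · rintro ω ⟨k, hk, hcard, hbad⟩
    refine ⟨k, hk, hcard, ?_⟩
    by_contra hlt
    refine hbad ?_
    set N := #{j ∈ visitSet (fun j => traj j ω) k h s a | (traj j ω).1 h.succ ∈ B} with hN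
    have hNn : N ≤ n := by rw [← hcard]; exact card_filter_le _ _
    have hNn' : (N : ℝ) ≤ n := by exact_mod_cast hNn
    refine sub_le_of_sub_le_sqrt hpB0 hpB1 (by rw [div_le_one hn0]; exact hNn') (by positivity)
      hy0.le ?_
    have hsum : ∑ j ∈ visitSet (fun j => traj j ω) k h s a,
        (θ * Z ((traj j ω).1 h.succ) - V * θ * u / 2) = n * (θ * (N / n - pB - V * u / 2)) := by
      simp only [sum_sub_distrib, ← mul_sum, hZ, sum_const, hcard, nsmul_eq_mul]
      rw [sum_boole, ← hN]
      field_simp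
    rw [hsum, not_le] at hlt
    have hroot : √(2 * V' * y) = y / u + V' * u / 2 := by
      have e : 2 * V' * y = (V' * u) ^ 2 := by
        calc 2 * V' * y = V' * (2 * y) := by ring
          _ = V' * (V' * u ^ 2) := by rw [hu2]
          _ = _ := by ring
      rw [e, Real.sqrt_sq (by positivity)]
      field_simp
      linarith
    have h2L : 2 * L = n * y := by rw [hy]; field_simp
    rw [h2L] at hlt
    have h1 : θ * (N / n - pB - V * u / 2) < y := lt_of_mul_lt_mul_left hlt hn0.le
    have h2 : N / n - pB - V * u / 2 < y / u + b * y / 3 := by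
      have e : y = θ * (y / u + b * y / 3) := by
        rw [hθ]; field_simp
      rw [e] at h1
      exact lt_of_mul_lt_mul_left h1 hθ0.le
    have h3 : V * u ≤ V' * u := mul_le_mul_of_nonneg_right (by linarith) hu0.le
    rw [hroot]
    linarith
  · simp only [Real.exp_sub, mul_div_assoc']
    rw [← sum_div, div_le_one (Real.exp_pos _)]
    exact hmgf

/-- One-sided Hoeffding bound for the empirical mean of an entry of the samples. -/
lemma IsInteraction.measure_sample_le (hI : IsInteraction P 𝓕 μ p ν K traj x π)
    (hμ : μ ∈ stdSimplex ℝ S) (hp : IsKernel p) (hπ : ∀ k ∈ Icc 1 K, ∀ ω, IsPolicy (π k ω))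
    (h : Fin H) (s : S) (a : A) {c : X → ℝ} (hc : Measurable c) {l u : ℝ} (hlu : l < u)
    (hb : ∀ᵐ y ∂ν, c y ∈ Set.Icc l u) (n : ℕ) {ε : ℝ}
    (hε : 0 ≤ ε) :
    P {ω | ∃ k ∈ Icc 1 K, #(visitSet (fun j => traj j ω) k h s a) = n ∧
      n * ε ≤ ∑ j ∈ visitSet (fun j => traj j ω) k h s a, (c (x j ω) - ∫ y, c y ∂ν)} ≤
      ENNReal.ofReal (Real.exp (-(2 * n * ε ^ 2 / (u - l) ^ 2))) := by
  set R := u - l with hR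
  have hR0 : 0 < R := by linarith
  -- the optimal exponent: it maximizes `θ ε - θ ^ 2 R ^ 2 / 8`
  set θ := 4 * ε / R ^ 2 with hθ
  set m := ∫ y, c y ∂ν with hm
  have hsg := ProbabilityTheory.hasSubgaussianMGF_of_mem_Icc hc.aemeasurable hb
  have hint : ∫⁻ y, ENNReal.ofReal (Real.exp (θ * (c y - m) - θ ^ 2 * R ^ 2 / 8)) ∂ν ≤
      ENNReal.ofReal 1 := by
    have h1 : Integrable (fun y => Real.exp (θ * (c y - m) - θ ^ 2 * R ^ 2 / 8)) ν := by
      simp only [Real.exp_sub]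
      exact (hsg.integrable_exp_mul θ).div_const _
    rw [← ofReal_integral_eq_lintegral_ofReal h1 (ae_of_all _ fun y => (Real.exp_pos _).le)]
    refine ENNReal.ofReal_le_ofReal ?_
    simp only [Real.exp_sub]
    rw [integral_div, div_le_one (Real.exp_pos _)]
    refine (hsg.mgf_le θ).trans (le_of_eq ?_)
    congr 1
    push_cast
    rw [Real.norm_eq_abs, abs_of_pos hR0]
    ring
  refine (measure_mono ?_).trans (hI.measure_sum_visitSet_le hμ hp hπ h s a
    (φ := fun _ y => θ * (c y - m) - θ ^ 2 * R ^ 2 / 8) (fun s' => by fun_prop)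
    (G := fun _ => 1) (fun _ => zero_le_one) (fun _ => hint) (by simp [(hp h s a).2]) n
    (2 * n * ε ^ 2 / R ^ 2))
  rintro ω ⟨k, hk, hcard, hle⟩
  refine ⟨k, hk, hcard, ?_⟩
  rw [sum_sub_distrib, ← mul_sum, sum_const, hcard, nsmul_eq_mul]
  have hθ0 : 0 ≤ θ := by positivity
  have h1 := mul_le_mul_of_nonneg_left hle hθ0
  have e : 2 * n * ε ^ 2 / R ^ 2 = θ * (n * ε) - n * (θ ^ 2 * R ^ 2 / 8) := by
    rw [hθ]
    field_simp
    ring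
  linarith

end Concentration

/-! ### Uniform concentration -/

section GoodEvent

variable {S A : Type*} [Fintype S] [Fintype A] [DecidableEq S] [DecidableEq A] {H : ℕ}
  {Ω X : Type*} [mΩ : MeasurableSpace Ω] [MeasurableSpace X]
  {P : Measure Ω} [IsProbabilityMeasure P] {𝓕 : Filtration ℕ mΩ}
  {μ : S → ℝ} {p : Kern S A H} {ν : Measure X} [IsProbabilityMeasure ν] {K : ℕ}
  {traj : ℕ → Ω → Traj S A H} {x : ℕ → Ω → X} {π : ℕ → Ω → Table S A H}

lemma sum_visit_div_visits_le (traj : ℕ → Traj S A H) (h : Fin H) (s : S) (a : A) (m : ℕ) :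
    ∑ k ∈ Icc 1 m, (if (traj k).1 h.castSucc = s ∧ (traj k).2 h = a then 1 else 0) /
      visits traj k h s a ≤ 2 * (harmonic #(visitSet traj (m + 1) h s a) : ℝ) := by
  induction m with
  | zero => simp [visitSet]
  | succ m ih =>
    rw [sum_Icc_succ_top (by omega), card_visitSet_succ traj (by omega : 1 ≤ m + 1)]
    split_ifs with hv
    · rw [harmonic_succ]
      push_cast
      have h1 : 1 / visits traj (m + 1) h s a ≤
          2 * ((#(visitSet traj (m + 1) h s a) : ℝ) + 1)⁻¹ := by
        unfold visits
        rw [← div_eq_mul_inv, div_le_div_iff₀ (by positivity) (by positivity)]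
        rcases le_total ((#(visitSet traj (m + 1) h s a) : ℝ)) 1 with h2 | h2
        · rw [max_eq_right h2]; linarith
        · rw [max_eq_left h2]; linarith
      linarith
    · simpa using ih

lemma sum_visit_div_visits_le_log (traj : ℕ → Traj S A H) (h : Fin H) (s : S) (a : A) (K : ℕ) :
    ∑ k ∈ Icc 1 K, (if (traj k).1 h.castSucc = s ∧ (traj k).2 h = a then 1 else 0) /
      visits traj k h s a ≤ 2 * (1 + Real.log K) := by
  refine (sum_visit_div_visits_le traj h s a K).trans ?_
  have h1 : #(visitSet traj (K + 1) h s a) ≤ K := by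
    refine (card_filter_le _ _).trans ?_
    simp
  have h2 := harmonic_le_one_add_log #(visitSet traj (K + 1) h s a)
  have h3 : Real.log #(visitSet traj (K + 1) h s a) ≤ Real.log K := by
    rcases Nat.eq_zero_or_pos #(visitSet traj (K + 1) h s a) with h0 | h0
    · rw [h0]; simp [Real.log_natCast_nonneg]
    · exact Real.log_le_log (by exact_mod_cast h0) (by exact_mod_cast h1)
  linarith

/-- The exponential moment behind the comparison of expected with actual visits: `q` is the
probability of a visit, which counts with weight `w`. -/
lemma exp_mul_le_one {w q : ℝ} (hw0 : 0 ≤ w) (hw1 : w ≤ 1) (hq : 0 ≤ q) :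
    Real.exp (w * q / 2) * (1 - q + q * Real.exp (-w)) ≤ 1 := by
  have h1 : Real.exp (-w) ≤ 1 - w / 2 := by
    rw [Real.exp_neg]
    refine (inv_anti₀ (by linarith) (Real.add_one_le_exp w)).trans ?_
    rw [inv_le_iff_one_le_mul₀ (by linarith)]
    nlinarith
  have h2 : 1 - q + q * Real.exp (-w) ≤ Real.exp (-(w * q / 2)) := by
    nlinarith [Real.add_one_le_exp (-(w * q / 2)), mul_le_mul_of_nonneg_left h1 hq]
  calc _ ≤ Real.exp (w * q / 2) * Real.exp (-(w * q / 2)) :=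
        mul_le_mul_of_nonneg_left h2 (Real.exp_pos _).le
    _ = 1 := by rw [← Real.exp_add]; simp

/-- The expected number of visits, weighted by the inverse visit counts, is at most of the order of
its empirical counterpart, which is a harmonic sum. -/
lemma IsInteraction.measure_sum_occ_div_visits_le (hI : IsInteraction P 𝓕 μ p ν K traj x π)
    (hμ : μ ∈ stdSimplex ℝ S) (hp : IsKernel p) (hπ : ∀ k ∈ Icc 1 K, ∀ ω, IsPolicy (π k ω))
    (h : Fin H) (s : S) (a : A) (t : ℝ) :
    P {ω | 4 * (1 + Real.log K) + 2 * t ≤ ∑ k ∈ Icc 1 K,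
      occ μ p (π k ω) (h, s, a) / visits (fun j => traj j ω) k h s a} ≤
      ENNReal.ofReal (Real.exp (-t)) := by
  classical
  set V : Traj S A H → Prop := fun τ => τ.1 h.castSucc = s ∧ τ.2 h = a with hV
  set w : ℕ → Ω → ℝ := fun k ω => 1 / visits (fun j => traj j ω) k h s a with hw
  set Q : ℕ → Ω → ℝ := fun k ω => occ μ p (π k ω) (h, s, a) with hQ
  have hw0 : ∀ k ω, 0 ≤ w k ω := fun k ω => (one_div_pos.2 (visits_pos _ _ _ _ _)).le
  have hw1 : ∀ k ω, w k ω ≤ 1 := fun k ω => by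
    simp only [hw]
    rw [div_le_one (visits_pos _ _ _ _ _)]
    exact one_le_visits _ _ _ _ _
  set u : ℕ → Traj S A H → Ω → ENNReal := fun k τ ω => ENNReal.ofReal (Real.exp
    (w k ω * Q k ω / 2 - if V τ then w k ω else 0)) with hu
  have hum : ∀ k < K, ∀ τ, Measurable[𝓕 k] (u (k + 1) τ) := by
    intro k hk τ
    have h1 : Measurable[𝓕 k] (w (k + 1)) :=
      (measurable_id.const_div (1 : ℝ)).comp (hI.measurable_visits hk.le h s a)
    have h2 : Measurable[𝓕 k] (Q (k + 1)) :=
      (measurable_occ μ p (h, s, a)).comp (hI.policy_meas k hk)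
    set G : ℝ × ℝ → ENNReal := fun z => ENNReal.ofReal (Real.exp
      (z.1 * z.2 / 2 - if V τ then z.1 else 0)) with hG
    have h3 : Measurable G := by
      simp only [hG]
      split_ifs <;> fun_prop
    have e : u (k + 1) τ = fun ω => G (w (k + 1) ω, Q (k + 1) ω) := rfl
    rw [e]
    exact h3.comp (h1.prodMk h2)
  set Y : ℕ → Ω → ENNReal := fun k ω => u k (traj k ω) ω with hY
  have hYm : ∀ k < K, Measurable[𝓕 (k + 1)] (Y (k + 1)) := fun k hk =>
    hI.measurable_comp_traj hk fun τ => (hum k hk τ).mono (𝓕.mono (Nat.le_succ k)) le_rfl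
  have hsub : ∀ k < K, IsSubfactor P (𝓕 k) (Y (k + 1)) := by
    intro k hk
    have hπk := fun ω => hπ (k + 1) (mem_Icc.2 ⟨by omega, by omega⟩) ω
    have h1 := hI.isSubfactor hk (hum k hk) (f := fun _ _ => 1) (fun _ => measurable_const) (by
      intro ω
      have htp := trajProb_nonneg hμ.1 hp (hπk ω)
      have hsum : ∑ τ, trajProb μ p (π (k + 1) ω) τ = 1 := by
        rw [sum_trajProb_init μ hp (hπk ω), hμ.2]
      have hq : Q (k + 1) ω =
          ∑ τ, if V τ then trajProb μ p (π (k + 1) ω) τ else 0 := rfl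
      have hq0 : 0 ≤ Q (k + 1) ω := occ_nonneg hμ.1 hp (hπk ω) _
      calc _ = ENNReal.ofReal (∑ τ, trajProb μ p (π (k + 1) ω) τ * Real.exp
            (w (k + 1) ω * Q (k + 1) ω / 2 - if V τ then w (k + 1) ω else 0)) := by
            rw [ENNReal.ofReal_sum_of_nonneg fun τ _ => mul_nonneg (htp τ) (Real.exp_pos _).le]
            refine sum_congr rfl fun τ _ => ?_
            rw [ENNReal.ofReal_mul (htp τ)]
            simp [hu]
        _ = ENNReal.ofReal (Real.exp (w (k + 1) ω * Q (k + 1) ω / 2) *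
            (1 - Q (k + 1) ω + Q (k + 1) ω * Real.exp (-w (k + 1) ω))) := by
            congr 1
            have e : ∀ τ, trajProb μ p (π (k + 1) ω) τ * Real.exp
                (w (k + 1) ω * Q (k + 1) ω / 2 - if V τ then w (k + 1) ω else 0) =
                Real.exp (w (k + 1) ω * Q (k + 1) ω / 2) * (trajProb μ p (π (k + 1) ω) τ +
                  (if V τ then trajProb μ p (π (k + 1) ω) τ else 0) *
                    (Real.exp (-w (k + 1) ω) - 1)) := by
              intro τ
              rw [sub_eq_add_neg, Real.exp_add]
              split_ifs
              · ring
              · simp; ring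
            simp only [e]
            rw [← mul_sum, sum_add_distrib, hsum, ← sum_mul, ← hq]
            ring
        _ ≤ 1 := by
            rw [ENNReal.ofReal_le_one]
            exact exp_mul_le_one (hw0 _ _) (hw1 _ _) hq0)
    simpa only [mul_one] using h1
  refine (measure_mono ?_).trans (measure_le_prod_le hYm hsub t)
  intro ω hω
  have hprod : ∏ j ∈ Icc 1 K, Y j ω = ENNReal.ofReal (Real.exp
      (∑ k ∈ Icc 1 K, (w k ω * Q k ω / 2 - if V (traj k ω) then w k ω else 0))) := by
    rw [Real.exp_sum, ENNReal.ofReal_prod_of_nonneg fun j _ => (Real.exp_pos _).le]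
  change _ ≤ ∏ j ∈ Icc 1 K, Y j ω
  rw [hprod]
  refine ENNReal.ofReal_le_ofReal (Real.exp_le_exp.2 ?_)
  have h1 := sum_visit_div_visits_le_log (fun j => traj j ω) h s a K
  have e1 : ∑ k ∈ Icc 1 K, (if V (traj k ω) then w k ω else 0) ≤ 2 * (1 + Real.log K) := by
    refine le_trans (le_of_eq (sum_congr rfl fun k _ => ?_)) h1
    simp only [hV, hw]
    split_ifs <;> simp
  have e2 : ∑ k ∈ Icc 1 K, w k ω * Q k ω / 2 = (∑ k ∈ Icc 1 K,
      occ μ p (π k ω) (h, s, a) / visits (fun j => traj j ω) k h s a) / 2 := by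
    rw [sum_div]
    refine sum_congr rfl fun k _ => ?_
    simp only [hw, hQ]
    ring
  have h2 : 4 * (1 + Real.log K) + 2 * t ≤ ∑ k ∈ Icc 1 K,
      occ μ p (π k ω) (h, s, a) / visits (fun j => traj j ω) k h s a := hω
  rw [sum_sub_distrib, e2]
  linarith

lemma measure_exists_le {ι : Type*} [Fintype ι] {E : ι → Set Ω} {c : ℝ}
    (hE : ∀ i, P (E i) ≤ ENNReal.ofReal c) :
    P {ω | ∃ i, ω ∈ E i} ≤ ENNReal.ofReal (Fintype.card ι * c) := by
  have e : {ω | ∃ i, ω ∈ E i} = ⋃ i, E i := by ext ω; simp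
  rw [e]
  refine (measure_iUnion_fintype_le P E).trans ((sum_le_sum fun i _ => hE i).trans ?_)
  rw [sum_const, card_univ, nsmul_eq_mul, ENNReal.ofReal_mul (by positivity),
    ENNReal.ofReal_natCast]

lemma card_visitSet_lt (traj : ℕ → Traj S A H) {k : ℕ} (hk : k ∈ Icc 1 K) (h : Fin H) (s : S)
    (a : A) : #(visitSet traj k h s a) < K := by
  have h1 : #(visitSet traj k h s a) ≤ k - 1 := (card_filter_le _ _).trans (by simp)
  have := mem_Icc.1 hk
  omega

lemma visits_eq_card {traj : ℕ → Traj S A H} {k : ℕ} {h : Fin H} {s : S} {a : A}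
    (h1 : 1 ≤ #(visitSet traj k h s a)) :
    visits traj k h s a = #(visitSet traj k h s a) :=
  max_eq_left (by exact_mod_cast h1)

lemma card_index (S A : Type*) [Fintype S] [Fintype A] (H : ℕ) :
    (Fintype.card (Fin H × S × A) : ℝ) = dimSAH S A H := by
  unfold dimSAH
  simp
  ring

/-- With high probability, all empirical means are within a Hoeffding bonus of the true means. -/
lemma IsInteraction.measure_empMean_le (hI : IsInteraction P 𝓕 μ p ν K traj x π)
    (hμ : μ ∈ stdSimplex ℝ S) (hp : IsKernel p) (hπ : ∀ k ∈ Icc 1 K, ∀ ω, IsPolicy (π k ω))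
    {c : X → Table S A H} (hc : ∀ h s a, Measurable fun y => c y h s a) {l u κ L : ℝ}
    (hlu : l < u) (hκ : (u - l) ^ 2 ≤ 2 * κ) (hL : 0 ≤ L)
    (hb : ∀ h s a, ∀ᵐ y ∂ν, c y h s a ∈ Set.Icc l u)
    (hm : ∀ h s a, |∫ y, c y h s a ∂ν| ≤ √(κ * L)) :
    P {ω | ¬ ∀ k ∈ Icc 1 K, ∀ h s a,
      |empMean (fun j => traj j ω) (fun j => c (x j ω)) k h s a - ∫ y, c y h s a ∂ν| ≤
        √(κ * L / visits (fun j => traj j ω) k h s a)} ≤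
      ENNReal.ofReal (2 * (dimSAH S A H * K * Real.exp (-L))) := by
  have hR : 0 < (u - l) ^ 2 := by have := sub_pos.2 hlu; positivity
  have hκ0 : 0 < κ := by linarith
  -- the deviation upwards (`true`) or downwards (`false`) at visit number `i.2 + 1`
  set E : Bool → (Fin H × S × A) × Fin K → Set Ω := fun b i =>
    {ω | ∃ k ∈ Icc 1 K, #(visitSet (fun j => traj j ω) k i.1.1 i.1.2.1 i.1.2.2) = i.2 + 1 ∧
      ((i.2 + 1 : ℕ) : ℝ) * √(κ * L / (i.2 + 1 : ℕ)) ≤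
        ∑ j ∈ visitSet (fun j => traj j ω) k i.1.1 i.1.2.1 i.1.2.2,
          ((bif b then c (x j ω) i.1.1 i.1.2.1 i.1.2.2 else -c (x j ω) i.1.1 i.1.2.1 i.1.2.2) -
            ∫ y, (bif b then c y i.1.1 i.1.2.1 i.1.2.2 else -c y i.1.1 i.1.2.1 i.1.2.2) ∂ν)}
    with hEdef
  have hexp : ∀ n : ℕ, Real.exp (-(2 * ((n + 1 : ℕ) : ℝ) * √(κ * L / (n + 1 : ℕ)) ^ 2 /
      (u - l) ^ 2)) ≤ Real.exp (-L) := by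
    intro n
    refine Real.exp_le_exp.2 (neg_le_neg ?_)
    rw [Real.sq_sqrt (by positivity), le_div_iff₀ hR]
    have e : 2 * ((n + 1 : ℕ) : ℝ) * (κ * L / (n + 1 : ℕ)) = L * (2 * κ) := by
      field_simp
    rw [e]
    exact mul_le_mul_of_nonneg_left hκ hL
  have hE : ∀ b i, P (E b i) ≤ ENNReal.ofReal (Real.exp (-L)) := by
    rintro b ⟨⟨h, s, a⟩, n⟩
    cases b
    · refine (hI.measure_sample_le hμ hp hπ h s a (hc h s a).neg (neg_lt_neg hlu) ?_ (n + 1)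
        (Real.sqrt_nonneg (κ * L / (n + 1 : ℕ)))).trans (ENNReal.ofReal_le_ofReal ?_)
      · filter_upwards [hb h s a] with y hy
        exact ⟨neg_le_neg hy.2, neg_le_neg hy.1⟩
      · rw [show -l - -u = u - l by ring]
        exact hexp n
    · exact (hI.measure_sample_le hμ hp hπ h s a (hc h s a) hlu (hb h s a) (n + 1)
        (Real.sqrt_nonneg (κ * L / (n + 1 : ℕ)))).trans (ENNReal.ofReal_le_ofReal (hexp n))
  have hcard : (Fintype.card (Bool × (Fin H × S × A) × Fin K) : ℝ) * Real.exp (-L) =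
      2 * (dimSAH S A H * K * Real.exp (-L)) := by
    rw [Fintype.card_prod, Fintype.card_prod (Fin H × S × A), Fintype.card_bool, Fintype.card_fin]
    push_cast
    rw [card_index]
    ring
  rw [← hcard]
  refine (measure_mono ?_).trans (measure_exists_le (E := fun i => E i.1 i.2)
    fun i => hE i.1 i.2)
  intro ω hω
  by_contra hgood
  simp only [Set.mem_ofPred_eq, not_exists] at hgood
  refine hω fun k hk h s a => ?_
  rcases Nat.eq_zero_or_pos #(visitSet (fun j => traj j ω) k h s a) with h0 | h0
  · -- without a visit, the empirical mean is `0` and the bonus exceeds the mean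
    have hv : visits (fun j => traj j ω) k h s a = 1 := by simp [visits, h0]
    rw [empMean, hv, card_eq_zero.1 h0, sum_empty, zero_div, zero_sub, abs_neg, div_one]
    exact hm h s a
  · have hlt := card_visitSet_lt (fun j => traj j ω) hk h s a
    set V := visitSet (fun j => traj j ω) k h s a with hVdef
    have hn : (0 : ℝ) < #V := by exact_mod_cast h0
    have h1 := fun b => hgood (b, (h, s, a), ⟨#V - 1, by omega⟩)
    simp only [hEdef, Set.mem_ofPred_eq, not_exists, not_and, not_le, Nat.sub_add_cancel h0] at h1
    have h2 := h1 true k hk rfl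
    have h3 := h1 false k hk rfl
    simp only [cond_true, cond_false, integral_neg, ← hVdef] at h2 h3
    rw [empMean, visits_eq_card h0, ← hVdef]
    set m := ∫ y, c y h s a ∂ν
    have e : (∑ j ∈ V, c (x j ω) h s a) / #V - m = (∑ j ∈ V, (c (x j ω) h s a - m)) / #V := by
      rw [sum_sub_distrib, sum_const, nsmul_eq_mul]
      field_simp
    have e2 : ∑ j ∈ V, (-c (x j ω) h s a - -m) = -∑ j ∈ V, (c (x j ω) h s a - m) := by
      rw [← sum_neg_distrib]
      exact sum_congr rfl fun j _ => by ring
    rw [e2] at h3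
    rw [e, abs_div, abs_of_pos hn, div_le_iff₀ hn, mul_comm]
    exact abs_le.2 ⟨by linarith, h2.le⟩

/-- With high probability, the true kernel lies in all confidence sets. -/
lemma IsInteraction.measure_confSet_le (hI : IsInteraction P 𝓕 μ p ν K traj x π)
    (hμ : μ ∈ stdSimplex ℝ S) (hp : IsKernel p) (hπ : ∀ k ∈ Icc 1 K, ∀ ω, IsPolicy (π k ω))
    {L : ℝ} (hL : 1 ≤ L) :
    P {ω | ¬ ∀ k ∈ Icc 1 K, p ∈ confSet L (fun j => traj j ω) k} ≤
      ENNReal.ofReal (2 * (dimSAH S A H * Fintype.card S * K * Real.exp (-(2 * L)))) := by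
  set B : Bool → S → Finset S := fun b s' => bif b then {s'} else {s'}ᶜ with hB
  set E : Bool × (Fin H × S × A) × S × Fin K → Set Ω := fun i =>
    {ω | ∃ k ∈ Icc 1 K, #(visitSet (fun j => traj j ω) k i.2.1.1 i.2.1.2.1 i.2.1.2.2) =
        i.2.2.2 + 1 ∧
      ¬ ((#{j ∈ visitSet (fun j => traj j ω) k i.2.1.1 i.2.1.2.1 i.2.1.2.2 |
          (traj j ω).1 i.2.1.1.succ ∈ B i.1 i.2.2.1} : ℝ) / (i.2.2.2 + 1 : ℕ)
        - ∑ s' ∈ B i.1 i.2.2.1, p i.2.1.1 i.2.1.2.1 i.2.1.2.2 s' ≤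
        √(2 * (2 * L / (i.2.2.2 + 1 : ℕ)) *
          ((#{j ∈ visitSet (fun j => traj j ω) k i.2.1.1 i.2.1.2.1 i.2.1.2.2 |
            (traj j ω).1 i.2.1.1.succ ∈ B i.1 i.2.2.1} : ℝ) / (i.2.2.2 + 1 : ℕ) *
          (1 - (#{j ∈ visitSet (fun j => traj j ω) k i.2.1.1 i.2.1.2.1 i.2.1.2.2 |
            (traj j ω).1 i.2.1.1.succ ∈ B i.1 i.2.2.1} : ℝ) / (i.2.2.2 + 1 : ℕ))))
        + 7 / 3 * (2 * L / (i.2.2.2 + 1 : ℕ)))} with hEdef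
  have hE : ∀ i, P (E i) ≤ ENNReal.ofReal (Real.exp (-(2 * L))) := fun i =>
    hI.measure_transition_le hμ hp hπ i.2.1.1 i.2.1.2.1 i.2.1.2.2 (B i.1 i.2.2.1)
      (Nat.le_add_left 1 i.2.2.2) (by linarith)
  have hcard : (Fintype.card (Bool × (Fin H × S × A) × S × Fin K) : ℝ) * Real.exp (-(2 * L)) =
      2 * (dimSAH S A H * Fintype.card S * K * Real.exp (-(2 * L))) := by
    rw [Fintype.card_prod, Fintype.card_prod (Fin H × S × A), Fintype.card_prod S,
      Fintype.card_bool, Fintype.card_fin]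
    push_cast
    rw [card_index]
    ring
  rw [← hcard]
  refine (measure_mono ?_).trans (measure_exists_le hE)
  intro ω hω
  by_contra hgood
  simp only [Set.mem_ofPred_eq, not_exists] at hgood
  refine hω fun k hk => ⟨hp, fun h s a s' => ?_⟩
  rcases Nat.eq_zero_or_pos #(visitSet (fun j => traj j ω) k h s a) with h0 | h0
  · -- without a visit, the empirical probability is `0` and the bonus exceeds `1`
    have hv : visits (fun j => traj j ω) k h s a = 1 := by simp [visits, h0]
    have he : empTrans (fun j => traj j ω) k h s a s' = 0 := by
      rw [empTrans, card_eq_zero.1 h0]; simp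
    have hle : p h s a s' ≤ 1 := by
      rw [← (hp h s a).2]
      exact single_le_sum (fun i _ => (hp h s a).1 i) (mem_univ s')
    rw [bonusP, he, hv, sub_zero, abs_of_nonneg ((hp h s a).1 s')]
    simp
    linarith
  · have hlt := card_visitSet_lt (fun j => traj j ω) hk h s a
    set V := visitSet (fun j => traj j ω) k h s a with hVdef
    have hn : (0 : ℝ) < #V := by exact_mod_cast h0
    have h1 := fun b => hgood (b, (h, s, a), s', ⟨#V - 1, by omega⟩)
    simp only [hEdef, Set.mem_ofPred_eq, not_exists, not_and, not_not,
      Nat.sub_add_cancel h0] at h1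
    have h2 := h1 true k hk rfl
    have h3 := h1 false k hk rfl
    simp only [hB, cond_true, cond_false, mem_singleton, mem_compl, sum_singleton,
      ← hVdef] at h2 h3
    have e1 : (#{j ∈ V | (traj j ω).1 h.succ = s'} : ℝ) / #V =
        empTrans (fun j => traj j ω) k h s a s' := by
      rw [empTrans, visits_eq_card h0]
    have e2 : (#{j ∈ V | ¬ (traj j ω).1 h.succ = s'} : ℝ) / #V =
        1 - empTrans (fun j => traj j ω) k h s a s' := by
      have := card_filter_add_card_filter_not (s := V) fun j => (traj j ω).1 h.succ = s'
      rw [← e1, ← this]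
      have h5 : (#V : ℝ) ≠ 0 := hn.ne'
      rw [← this] at h5
      push_cast at h5 ⊢
      field_simp
      ring
    have e3 : ∑ i ∈ {s'}ᶜ, p h s a i = 1 - p h s a s' := by
      have := sum_compl_add_sum {s'} (p h s a)
      rw [(hp h s a).2, sum_singleton] at this
      linarith
    rw [e1] at h2
    rw [e2, e3, sub_sub_cancel, mul_comm (1 - _)] at h3
    have e4 : √(2 * (2 * L / #V) * (empTrans (fun j => traj j ω) k h s a s' *
        (1 - empTrans (fun j => traj j ω) k h s a s'))) + 7 / 3 * (2 * L / #V) =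
        bonusP L (fun j => traj j ω) k h s a s' := by
      rw [bonusP, visits_eq_card h0, ← hVdef]
      have : ∀ z : ℝ, √(2 * (2 * L / #V) * z) = 2 * √(z * L / #V) := fun z => by
        rw [show 2 * (2 * L / #V) * z = 2 ^ 2 * (z * L / #V) by ring,
          Real.sqrt_mul (by norm_num), Real.sqrt_sq (by norm_num)]
      rw [this]
      ring
    rw [e4] at h2 h3
    exact abs_le.2 ⟨by linarith, by linarith⟩

end GoodEvent

/-! ### Accuracy with high probability -/

section HighProbability

variable {S A : Type*} [Fintype S] [Fintype A] [DecidableEq S] [DecidableEq A] [Nonempty S]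
  [Nonempty A] {H : ℕ}
  {Ω X : Type*} [mΩ : MeasurableSpace Ω] [MeasurableSpace X]
  {P : Measure Ω} [IsProbabilityMeasure P] {𝓕 : Filtration ℕ mΩ}
  {μ : S → ℝ} {p : Kern S A H} {ν : Measure X} [IsProbabilityMeasure ν] {K : ℕ} {δ : ℝ}
  {traj : ℕ → Ω → Traj S A H} {x : ℕ → Ω → X} {π : ℕ → Ω → Table S A H}

lemma exp_neg_logTerm (hH : 1 ≤ H) (hK : 1 ≤ K) (hδ : 0 < δ) :
    dimSAH S A H * K * Real.exp (-logTerm S A H K δ) = δ / 12 := by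
  have h1 := one_le_dim_mul (S := S) (A := A) hH hK
  have h2 : 0 < dimSAH S A H * K := by linarith
  have h3 := (zero_lt_one.trans_le (one_le_dimSAH (S := S) (A := A) hH)).ne'
  rw [Real.exp_neg, exp_logTerm hH hK hδ]
  field_simp

lemma exp_neg_logTermP (hH : 1 ≤ H) (hK : 1 ≤ K) (hδ : 0 < δ) :
    dimSAH S A H * K * Real.exp (-logTermP S A H K δ) = δ / 6 := by
  have h1 := one_le_dim_mul (S := S) (A := A) hH hK
  have h2 : 0 < dimSAH S A H * K := by linarith
  have h3 := (zero_lt_one.trans_le (one_le_dimSAH (S := S) (A := A) hH)).ne'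
  rw [Real.exp_neg, exp_logTermP hH hK hδ]
  field_simp

lemma card_le_dimSAH (hH : 1 ≤ H) : (Fintype.card S : ℝ) ≤ dimSAH S A H := by
  have h2 : (1 : ℝ) ≤ Fintype.card A := by exact_mod_cast Fintype.card_pos
  have h3 : (1 : ℝ) ≤ H := by exact_mod_cast hH
  unfold dimSAH
  rw [mul_assoc]
  exact le_mul_of_one_le_right (by positivity) (one_le_mul_of_one_le_of_one_le h2 h3)

lemma IsInteraction.measure_not_visitMass_le (hI : IsInteraction P 𝓕 μ p ν K traj x π)
    (hμ : μ ∈ stdSimplex ℝ S) (hp : IsKernel p) (hπ : ∀ k ∈ Icc 1 K, ∀ ω, IsPolicy (π k ω))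
    (hH : 1 ≤ H) (hK : 1 ≤ K) (hδ : 0 < δ) (hδ1 : δ < 1) :
    P {ω | ¬ visitMass μ p (fun j => traj j ω) (fun j => π j ω) K ≤
      6 * logTerm S A H K δ * dimSAH S A H} ≤ ENNReal.ofReal (δ / 2) := by
  set L := logTerm S A H K δ with hL
  have hlog := one_add_log_le_logTerm (S := S) (A := A) hH hK hδ hδ1
  refine (measure_mono ?_).trans ((measure_exists_le
    (E := fun y : Fin H × S × A => {ω | 4 * (1 + Real.log K) + 2 * L ≤ ∑ k ∈ Icc 1 K,
      occ μ p (π k ω) (y.1, y.2.1, y.2.2) / visits (fun j => traj j ω) k y.1 y.2.1 y.2.2})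
    fun y => hI.measure_sum_occ_div_visits_le hμ hp hπ y.1 y.2.1 y.2.2 L).trans
      (ENNReal.ofReal_le_ofReal ?_))
  · intro ω hω
    by_contra hgood
    simp only [Set.mem_ofPred_eq, not_exists, not_le] at hgood
    refine hω ?_
    rw [visitMass, sum_comm]
    have h1 : ∀ y : Fin H × S × A, ∑ k ∈ Icc 1 K,
        occ μ p (π k ω) y / visits (fun j => traj j ω) k y.1 y.2.1 y.2.2 ≤ 6 * L := fun y =>
      (hgood y).le.trans (by linarith)
    refine (sum_le_sum fun y _ => h1 y).trans (le_of_eq ?_)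
    rw [sum_const, card_univ, nsmul_eq_mul, card_index]
    ring
  · rw [card_index]
    have h1 := exp_neg_logTerm (S := S) (A := A) hH hK hδ
    have h2 : 0 ≤ dimSAH S A H * Real.exp (-L) :=
      mul_nonneg (zero_le_one.trans (one_le_dimSAH hH)) (Real.exp_pos _).le
    have h3 : dimSAH S A H * Real.exp (-L) ≤ dimSAH S A H * Real.exp (-L) * K :=
      le_mul_of_one_le_right h2 (by exact_mod_cast hK)
    have h4 : dimSAH S A H * Real.exp (-L) * K = δ / 12 := by rw [← h1]; ring
    linarith

lemma IsInteraction.measure_not_confSet_le (hI : IsInteraction P 𝓕 μ p ν K traj x π)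
    (hμ : μ ∈ stdSimplex ℝ S) (hp : IsKernel p) (hπ : ∀ k ∈ Icc 1 K, ∀ ω, IsPolicy (π k ω))
    (hH : 1 ≤ H) (hK : 1 ≤ K) (hδ : 0 < δ) (hδ1 : δ < 1) :
    P {ω | ¬ ∀ k ∈ Icc 1 K, p ∈ confSet (logTermP S A H K δ) (fun j => traj j ω) k} ≤
      ENNReal.ofReal (δ / 2) := by
  refine (hI.measure_confSet_le hμ hp hπ (one_le_logTermP hH hK hδ hδ1)).trans
    (ENNReal.ofReal_le_ofReal ?_)
  set E := Real.exp (-logTermP S A H K δ) with hE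
  have hE0 : 0 ≤ E := (Real.exp_pos _).le
  have h1 : dimSAH S A H * K * E = δ / 6 := exp_neg_logTermP hH hK hδ
  have h2 : Real.exp (-(2 * logTermP S A H K δ)) = E * E := by
    rw [hE, ← Real.exp_add]; congr 1; ring
  have hK' : (1 : ℝ) ≤ K := by exact_mod_cast hK
  have h3 : (Fintype.card S : ℝ) * E ≤ dimSAH S A H * K * E :=
    mul_le_mul_of_nonneg_right ((card_le_dimSAH hH).trans
      (le_mul_of_one_le_right (zero_le_one.trans (one_le_dimSAH hH)) hK')) hE0
  rw [h1] at h3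
  calc _ = 2 * (dimSAH S A H * K * E * (Fintype.card S * E)) := by rw [h2]; ring
    _ ≤ 2 * (δ / 6 * (δ / 6)) := by rw [h1]; gcongr
    _ ≤ δ / 2 := by nlinarith

lemma IsInteraction.measure_not_empMean_le (hI : IsInteraction P 𝓕 μ p ν K traj x π)
    (hμ : μ ∈ stdSimplex ℝ S) (hp : IsKernel p) (hπ : ∀ k ∈ Icc 1 K, ∀ ω, IsPolicy (π k ω))
    (hH : 1 ≤ H) (hK : 1 ≤ K) (hδ : 0 < δ) (hδ1 : δ < 1)
    {c : X → Table S A H} (hc : ∀ h s a, Measurable fun y => c y h s a) {l u κ : ℝ}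
    (hlu : l < u) (hκ : (u - l) ^ 2 ≤ 2 * κ) (hκ1 : 1 ≤ κ)
    (hb : ∀ h s a, ∀ᵐ y ∂ν, c y h s a ∈ Set.Icc l u)
    (hm : ∀ h s a, |∫ y, c y h s a ∂ν| ≤ 1) :
    P {ω | ¬ ∀ k ∈ Icc 1 K, ∀ h s a,
      |empMean (fun j => traj j ω) (fun j => c (x j ω)) k h s a - ∫ y, c y h s a ∂ν| ≤
        √(κ * logTerm S A H K δ / visits (fun j => traj j ω) k h s a)} ≤
      ENNReal.ofReal (δ / 2) := by
  have hL := one_le_logTerm (S := S) (A := A) hH hK hδ hδ1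
  refine (hI.measure_empMean_le hμ hp hπ hc hlu hκ (zero_le_one.trans hL) hb fun h s a =>
    (hm h s a).trans (Real.one_le_sqrt.2 (one_le_mul_of_one_le_of_one_le hκ1 hL))).trans
    (ENNReal.ofReal_le_ofReal ?_)
  rw [exp_neg_logTerm hH hK hδ]
  linarith

lemma integral_mem_Icc {f : X → ℝ} (hf : Measurable f) {l u : ℝ}
    (hb : ∀ᵐ y ∂ν, f y ∈ Set.Icc l u) : ∫ y, f y ∂ν ∈ Set.Icc l u := by
  have hint : Integrable f ν := Integrable.of_mem_Icc l u hf.aemeasurable hb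
  constructor
  · have := integral_mono_ae (integrable_const l) hint (hb.mono fun y hy => hy.1)
    simpa using this
  · have := integral_mono_ae hint (integrable_const u) (hb.mono fun y hy => hy.2)
    simpa using this

lemma optReward_mem {traj : ℕ → Traj S A H} {r : ℕ → Table S A H} {rbar : Table S A H} {L : ℝ}
    {k : ℕ} (hk : k ∈ Icc 2 K) {h : Fin H} {s : S} {a : A}
    (hr : |empMean traj r k h s a - rbar h s a| ≤ √(1 * L / visits traj k h s a)) :
    rbar h s a ≤ optReward L traj r k (h, s, a) ∧
      optReward L traj r k (h, s, a) ≤ rbar h s a + 2 * √(L / visits traj k h s a) := by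
  have hk' : ¬ k ≤ 1 := by have := mem_Icc.1 hk; omega
  have e : optReward L traj r k (h, s, a) =
      empMean traj r k h s a + √(L / visits traj k h s a) := by
    rw [optReward, if_neg hk']; rfl
  rw [one_mul] at hr
  have := abs_le.1 hr
  rw [e]
  constructor <;> linarith

lemma optCost_mem {traj : ℕ → Traj S A H} {d : ℕ → Table S A H} {dbar : Table S A H} {L : ℝ}
    {k : ℕ} (hk : k ∈ Icc 2 K) {h : Fin H} {s : S} {a : A}
    (hd : |empMean traj d k h s a - dbar h s a| ≤ √(2 * L / visits traj k h s a)) :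
    optCost L traj d k (h, s, a) ≤ dbar h s a ∧
      dbar h s a ≤ optCost L traj d k (h, s, a) + 2 * √(2 * L / visits traj k h s a) := by
  have hk' : ¬ k ≤ 1 := by have := mem_Icc.1 hk; omega
  have e : optCost L traj d k (h, s, a) =
      empMean traj d k h s a - √(2 * L / visits traj k h s a) := by
    rw [optCost, if_neg hk']; rfl
  have := abs_le.1 hd
  rw [e]
  constructor <;> linarith

lemma revealedCost_mem {traj : ℕ → Traj S A H} {d : ℕ → Table S A H} {L : ℝ}
    {k : ℕ} (hk : k ∈ Icc 2 K) {h : Fin H} {s : S} {a : A} :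
    revealedCost d k (h, s, a) ≤ d k h s a ∧
      d k h s a ≤ revealedCost d k (h, s, a) + 2 * √(2 * L / visits traj k h s a) := by
  have hk' : ¬ k ≤ 1 := by have := mem_Icc.1 hk; omega
  have e : revealedCost d k (h, s, a) = d k h s a := by
    rw [revealedCost, if_neg hk']; rfl
  rw [e]
  exact ⟨le_rfl, by linarith [Real.sqrt_nonneg (2 * L / visits traj k h s a)]⟩

lemma measure_union_ofReal_le {E F : Set Ω} {a b : ℝ} (ha : 0 ≤ a) (hb : 0 ≤ b)
    (hE : P E ≤ ENNReal.ofReal a) (hF : P F ≤ ENNReal.ofReal b) :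
    P (E ∪ F) ≤ ENNReal.ofReal (a + b) := by
  rw [ENNReal.ofReal_add ha hb]
  exact (measure_union_le E F).trans (add_le_add hE hF)

/-- With stochastic costs, the estimates are accurate with probability at least `1 - 2 δ`. -/
lemma IsInteraction.measure_not_isAccurate_le_of_stochastic
    {ν : Measure (Table S A H × Table S A H)} [IsProbabilityMeasure ν]
    {x : ℕ → Ω → Table S A H × Table S A H} (hI : IsInteraction P 𝓕 μ p ν K traj x π)
    (hb : ∀ᵐ x ∂ν, ∀ h s a, x.1 h s a ∈ Set.Icc (0 : ℝ) 1 ∧ x.2 h s a ∈ Set.Icc (-1 : ℝ) 1)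
    (hμ : μ ∈ stdSimplex ℝ S) (hp : IsKernel p) (hπ : ∀ k ∈ Icc 1 K, ∀ ω, IsPolicy (π k ω))
    (hH : 1 ≤ H) (hK : 1 ≤ K) (hδ : 0 < δ) (hδ1 : δ < 1) :
    P {ω | ¬ IsAccurate μ p K δ (fun k => traj k ω)
        (optReward (logTerm S A H K δ) (fun k => traj k ω) fun k => (x k ω).1)
        (optCost (logTerm S A H K δ) (fun k => traj k ω) fun k => (x k ω).2)
        (fun k => π k ω) (fun h s a => ∫ x, x.1 h s a ∂ν) fun _ h s a => ∫ x, x.2 h s a ∂ν} ≤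
      ENNReal.ofReal (2 * δ) := by
  have hb1 : ∀ h s a, ∀ᵐ y ∂ν, y.1 h s a ∈ Set.Icc (0 : ℝ) 1 := fun h s a =>
    hb.mono fun y hy => (hy h s a).1
  have hb2 : ∀ h s a, ∀ᵐ y ∂ν, y.2 h s a ∈ Set.Icc (-1 : ℝ) 1 := fun h s a =>
    hb.mono fun y hy => (hy h s a).2
  have hm1 : ∀ h s a, Measurable fun y : Table S A H × Table S A H => y.1 h s a :=
    fun h s a => by fun_prop
  have hm2 : ∀ h s a, Measurable fun y : Table S A H × Table S A H => y.2 h s a :=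
    fun h s a => by fun_prop
  have hr := fun h s a => integral_mem_Icc (hm1 h s a) (hb1 h s a)
  have hd := fun h s a => integral_mem_Icc (hm2 h s a) (hb2 h s a)
  have h1 := hI.measure_not_visitMass_le hμ hp hπ hH hK hδ hδ1
  have h2 := hI.measure_not_confSet_le hμ hp hπ hH hK hδ hδ1
  have h3 := hI.measure_not_empMean_le hμ hp hπ hH hK hδ hδ1 (c := Prod.fst) hm1 (κ := 1)
    zero_lt_one (by norm_num) le_rfl hb1 fun h s a =>
      abs_le.2 ⟨by linarith [(hr h s a).1], (hr h s a).2⟩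
  have h4 := hI.measure_not_empMean_le hμ hp hπ hH hK hδ hδ1 (c := Prod.snd) hm2 (κ := 2)
    (by norm_num) (by norm_num) (by norm_num) hb2 fun h s a => abs_le.2 (hd h s a)
  have h5 := measure_union_ofReal_le (by linarith) (by linarith)
    (measure_union_ofReal_le (by linarith) (by linarith) h1 h2)
    (measure_union_ofReal_le (by linarith) (by linarith) h3 h4)
  rw [show δ / 2 + δ / 2 + (δ / 2 + δ / 2) = 2 * δ by ring] at h5
  refine (measure_mono fun ω hω => ?_).trans h5
  by_contra hgood
  simp only [Set.mem_union, Set.mem_ofPred_eq, not_or, not_not] at hgood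
  obtain ⟨⟨g1, g2⟩, g3, g4⟩ := hgood
  have hsub : ∀ k ∈ Icc 2 K, k ∈ Icc 1 K := fun k hk => Icc_subset_Icc_left (by norm_num) hk
  exact hω
    { conf := g2
      visit := g1
      rbar_mem := hr
      dd_mem := fun _ _ => hd
      rt_one := if_pos le_rfl
      dt_one := if_pos le_rfl
      rt_le := fun k hk h s a => optReward_mem (rbar := fun h s a => ∫ x, x.1 h s a ∂ν) hk
        (g3 k (hsub k hk) h s a)
      dt_le := fun k hk h s a => optCost_mem (dbar := fun h s a => ∫ x, x.2 h s a ∂ν) hk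
        (g4 k (hsub k hk) h s a) }

/-- With adversarial costs, the estimates are accurate with probability at least `1 - 2 δ`. -/
lemma IsInteraction.measure_not_isAccurate_le_of_adversarial
    {ν : Measure (Table S A H)} [IsProbabilityMeasure ν]
    {r d : ℕ → Ω → Table S A H} (hI : IsInteraction P 𝓕 μ p ν K traj r π)
    (hb : ∀ᵐ x ∂ν, ∀ h s a, x h s a ∈ Set.Icc (0 : ℝ) 1)
    (hd : ∀ k ω h s a, d k ω h s a ∈ Set.Icc (-1 : ℝ) 1)
    (hμ : μ ∈ stdSimplex ℝ S) (hp : IsKernel p) (hπ : ∀ k ∈ Icc 1 K, ∀ ω, IsPolicy (π k ω))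
    (hH : 1 ≤ H) (hK : 1 ≤ K) (hδ : 0 < δ) (hδ1 : δ < 1) :
    P {ω | ¬ IsAccurate μ p K δ (fun k => traj k ω)
        (optReward (logTerm S A H K δ) (fun k => traj k ω) fun k => r k ω)
        (revealedCost fun k => d k ω)
        (fun k => π k ω) (fun h s a => ∫ x, x h s a ∂ν) fun k => d k ω} ≤
      ENNReal.ofReal (2 * δ) := by
  have hb1 : ∀ h s a, ∀ᵐ y ∂ν, y h s a ∈ Set.Icc (0 : ℝ) 1 := fun h s a =>
    hb.mono fun y hy => hy h s a
  have hm1 : ∀ h s a, Measurable fun y : Table S A H => y h s a := fun h s a => by fun_prop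
  have hr := fun h s a => integral_mem_Icc (hm1 h s a) (hb1 h s a)
  have h1 := hI.measure_not_visitMass_le hμ hp hπ hH hK hδ hδ1
  have h2 := hI.measure_not_confSet_le hμ hp hπ hH hK hδ hδ1
  have h3 := hI.measure_not_empMean_le hμ hp hπ hH hK hδ hδ1 (c := id) hm1 (κ := 1)
    zero_lt_one (by norm_num) le_rfl hb1 fun h s a =>
      abs_le.2 ⟨by simp only [id]; linarith [(hr h s a).1], (hr h s a).2⟩
  have h5 := measure_union_ofReal_le (by linarith) (by linarith)
    (measure_union_ofReal_le (by linarith) (by linarith) h1 h2) h3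
  refine (measure_mono fun ω hω => ?_).trans
    (h5.trans (ENNReal.ofReal_le_ofReal (by linarith : δ / 2 + δ / 2 + δ / 2 ≤ 2 * δ)))
  by_contra hgood
  simp only [Set.mem_union, Set.mem_ofPred_eq, not_or, not_not] at hgood
  obtain ⟨⟨g1, g2⟩, g3⟩ := hgood
  have hsub : ∀ k ∈ Icc 2 K, k ∈ Icc 1 K := fun k hk => Icc_subset_Icc_left (by norm_num) hk
  exact hω
    { conf := g2
      visit := g1
      rbar_mem := hr
      dd_mem := fun k _ => hd k ω
      rt_one := if_pos le_rfl
      dt_one := if_pos le_rfl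
      rt_le := fun k hk h s a => optReward_mem (rbar := fun h s a => ∫ x, x h s a ∂ν) hk
        (g3 k (hsub k hk) h s a)
      dt_le := fun k hk h s a => revealedCost_mem hk }

end HighProbability

end OMDPD

end

theorem theorem1 :
    ∃ (c : ℝ) (m : ℕ), 0 < c ∧
      ∀ (S A Ω : Type*) [Fintype S] [Fintype A] [DecidableEq S] [DecidableEq A] [Nonempty S]
        [Nonempty A] [MeasurableSpace Ω] (P : MeasureTheory.Measure Ω)
        [MeasureTheory.IsProbabilityMeasure P]
        (𝓕 : MeasureTheory.Filtration ℕ (inferInstance : MeasurableSpace Ω))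
        (H K : ℕ) (_ : 1 ≤ H) (_ : 1 ≤ K) (δ : ℝ) (_ : 0 < δ) (_ : δ < 1)
        (μ : S → ℝ) (_ : μ ∈ stdSimplex ℝ S) (p : OMDPD.Kern S A H) (_ : OMDPD.IsKernel p)
        (U : OMDPD.Occ S A H → ℝ) (_ : OMDPD.IsMirrorMap μ U)
        (traj : ℕ → Ω → OMDPD.Traj S A H) (q qh g : ℕ → Ω → OMDPD.Occ S A H)
        (lam : ℕ → Ω → ℝ) (π : ℕ → Ω → OMDPD.Table S A H),
        -- stochastic costs: reward and cost tables are drawn from a fixed law `ν`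
        (∀ (ν : MeasureTheory.Measure (OMDPD.Table S A H × OMDPD.Table S A H))
          [MeasureTheory.IsProbabilityMeasure ν]
          (_ : ∀ᵐ x ∂ν, ∀ h s a, x.1 h s a ∈ Set.Icc (0 : ℝ) 1 ∧ x.2 h s a ∈ Set.Icc (-1 : ℝ) 1)
          (x : ℕ → Ω → OMDPD.Table S A H × OMDPD.Table S A H)
          (_ : OMDPD.IsInteraction P 𝓕 μ p ν K traj x π)
          (_ : ∀ ω, OMDPD.IsRun μ U K δ (fun k => traj k ω)
            (OMDPD.optReward (OMDPD.logTerm S A H K δ) (fun k => traj k ω) (fun k => (x k ω).1))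
            (OMDPD.optCost (OMDPD.logTerm S A H K δ) (fun k => traj k ω) (fun k => (x k ω).2))
            (fun k => q k ω) (fun k => qh k ω) (fun k => g k ω) (fun k => lam k ω)
            (fun k => π k ω))
          (πs : OMDPD.Table S A H)
          (_ : OMDPD.IsOptimal μ p (fun h s a => ∫ x, x.1 h s a ∂ν)
            {fun h s a => ∫ x, x.2 h s a ∂ν} πs),
          P {ω | ¬ (OMDPD.regret μ p (fun h s a => ∫ x, x.1 h s a ∂ν) πs (fun k => π k ω) K
                ≤ c * OMDPD.logTerm S A H K δ ^ m
                  * (OMDPD.rate μ p U K + OMDPD.dimSAH S A H) ∧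
              OMDPD.violation μ p (fun _ h s a => ∫ x, x.2 h s a ∂ν) (fun k => π k ω) K
                ≤ c * OMDPD.logTerm S A H K δ ^ m * OMDPD.rate μ p U K)}
            ≤ ENNReal.ofReal (2 * δ)) ∧
        -- adversarial costs: the reward tables are drawn from a fixed law `ν`, the cost tables
        -- `d k` are chosen by an adaptive adversary and revealed after the episode
        (∀ (ν : MeasureTheory.Measure (OMDPD.Table S A H)) [MeasureTheory.IsProbabilityMeasure ν]
          (_ : ∀ᵐ x ∂ν, ∀ h s a, x h s a ∈ Set.Icc (0 : ℝ) 1)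
          (r : ℕ → Ω → OMDPD.Table S A H)
          (_ : OMDPD.IsInteraction P 𝓕 μ p ν K traj r π)
          (d : ℕ → Ω → OMDPD.Table S A H)
          (_ : ∀ k ω h s a, d k ω h s a ∈ Set.Icc (-1 : ℝ) 1)
          (_ : ∀ k < K, Measurable[𝓕 (k + 1)] (d (k + 1)))
          (_ : ∀ ω, OMDPD.IsRun μ U K δ (fun k => traj k ω)
            (OMDPD.optReward (OMDPD.logTerm S A H K δ) (fun k => traj k ω) (fun k => r k ω))
            (OMDPD.revealedCost (fun k => d k ω))
            (fun k => q k ω) (fun k => qh k ω) (fun k => g k ω) (fun k => lam k ω)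
            (fun k => π k ω)),
          P {ω | ∃ πs, OMDPD.IsOptimal μ p (fun h s a => ∫ x, x h s a ∂ν)
                {e | ∃ k ∈ Finset.Icc 1 K, e = d k ω} πs ∧
              ¬ (OMDPD.regret μ p (fun h s a => ∫ x, x h s a ∂ν) πs (fun k => π k ω) K
                  ≤ c * OMDPD.logTerm S A H K δ ^ m
                    * (OMDPD.rate μ p U K + OMDPD.dimSAH S A H) ∧
                OMDPD.violation μ p (fun k => d k ω) (fun k => π k ω) K
                  ≤ c * OMDPD.logTerm S A H K δ ^ m * OMDPD.rate μ p U K)}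
            ≤ ENNReal.ofReal (2 * δ)) := by
  refine ⟨10000, 3, by norm_num, ?_⟩
  intro S A Ω _ _ _ _ _ _ _ P _ 𝓕 H K hH hK δ hδ hδ1 μ hμ p hp U hU traj q qh g lam π
  constructor
  · intro ν _ hb x hI hrun πs hopt
    have hπ : ∀ k ∈ Finset.Icc 1 K, ∀ ω, OMDPD.IsPolicy (π k ω) :=
      fun k hk ω => (hrun ω).isPolicy k hk
    refine (MeasureTheory.measure_mono ?_).trans
      (hI.measure_not_isAccurate_le_of_stochastic hb hμ hp hπ hH hK hδ hδ1)
    intro ω hbad hacc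
    have hfeas : ∀ k ∈ Finset.Icc 1 K, OMDPD.value μ p πs (fun h s a => ∫ x, x.2 h s a ∂ν) ≤ 0 :=
      fun k _ => hopt.1.2 _ rfl
    exact hbad ⟨(hrun ω).regret_le hμ hp hU hH hK hδ hδ1 hacc hopt.1.1 hfeas,
      (hrun ω).violation_le hμ hp hU hH hK hδ hδ1 hacc hopt.1.1 hfeas⟩
  · intro ν _ hb r hI d hd _ hrun
    have hπ : ∀ k ∈ Finset.Icc 1 K, ∀ ω, OMDPD.IsPolicy (π k ω) :=
      fun k hk ω => (hrun ω).isPolicy k hk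
    refine (MeasureTheory.measure_mono ?_).trans
      (hI.measure_not_isAccurate_le_of_adversarial hb hd hμ hp hπ hH hK hδ hδ1)
    rintro ω ⟨πs, hopt, hbad⟩ hacc
    have hfeas : ∀ k ∈ Finset.Icc 1 K, OMDPD.value μ p πs (d k ω) ≤ 0 :=
      fun k hk => hopt.1.2 _ ⟨k, hk, rfl⟩
    exact hbad ⟨(hrun ω).regret_le hμ hp hU hH hK hδ hδ1 hacc hopt.1.1 hfeas,
      (hrun ω).violation_le hμ hp hU hH hK hδ hδ1 hacc hopt.1.1 hfeas⟩
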